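/- **Lemma 5.11.** Let $(V,g,I,\omega,\Omega)$ be a Calabi–Yau 3-fold: a complex 3-fold $(V,I)$ with a Riemannian metric $g$ and a complex volume form $\Omega$ such that at every point there is a complex linear isomorphism of the tangent space with $\mathbb{C}^3$ taking $g$ to the Euclidean metric and $\Omega$ to $dz^1\wedge dz^2\wedge dz^3$, and such that $\omega=g(I\cdot,\cdot)$ and $\Omega$ are parallel for the Levi-Civita connection $\nabla$ of $g$. Let $C\subset V$ be a compact embedded complex curve (a closed 1-dimensional complex submanifold) with normal bundle $NC$. For tangent vectors $a,b$ of $V$ let $a\times b$ be defined by $g(a\times b,c)=\operatorname{Re}\Omega(a,b,c)$ for all $c$. The complex Dirac operator of $C$ is $$\mathcal{D}^c v(x)=a\times(\nabla_a v+I\nabla_{Ia}v)^\perp ,\qquad v\in\Gamma(NC),$$ where $a$ is any unit vector in $T_xC$ and $\perp$ is the orthogonal projection to $NC$. The curve $C$ is rigid if the holomorphic normal bundle $NC=TV|_C/TC$ has no non-zero holomorphic section. Let $\mathbb{S}^1$ be the unit circle with angle $\theta$, and equip $M=\mathbb{S}^1\times V$ with the product $G_2$-structure $\varphi=d\theta\wedge\omega+\operatorname{Re}\Omega$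 and its metric $d\theta^2+g$; let $\times$ be the cross product on $M$ whose pairing with a third vector is $\varphi$. For an associative submanifold $A\subset M$ with normal bundle $NA$, the associative deformation (Dirac) operator is $\mathcal{D}v=\sum_{i=1}^3 e_i\times\nabla^{\perp}_{e_i}v$ for $v\in\Gamma(NA)$, where $\nabla^\perp$ is the normal connection induced by the Levi-Civita connection of $M$ and $e_1,e_2,e_3$ is an orthonormal basis of $T_xA$; $A$ is rigid if $\ker\mathcal{D}=0$. Then $\mathbb{S}^1\times C$ is an associative submanifold of $\mathbb{S}^1\times V$, and the kernel of its operator $\mathcal{D}$ is exactly the set of pull-backs (constant in $\theta$) of the elements of $\ker\mathcal{D}^c\subset\Gamma(NC)$, where the normal bundle of $\mathbb{S}^1\times C$ is identified with the pull-back of $NC$. Hence $\mathbb{S}^1\times C$ is rigid as an associative submanifold if and only if $C$ is rigid as a holomorphic curve. -/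

import Mathlib

open scoped Manifold ContDiff

noncomputable section

/-! ## Levi-Civita connection and normal bundle of a submanifold

`M` is a smooth manifold (without boundary) modelled on `E`, and `A` a smooth manifold with a smooth
immersion `f : A → M`. In Mathlib the tangent space `TangentSpace I p` is the model space `E`, a
tangent vector at `p` being recorded by its coordinates in the preferred chart at `p`. -/

namespace AssocDef

section Riemannian

variable {E : Type*} [NormedAddCommGroup E] [NormedSpace ℝ E]
  {H : Type*} [TopologicalSpace H] {I : ModelWithCorners ℝ E H}
  {M : Type*} [TopologicalSpace M] [ChartedSpace H M] [IsManifold I 1 M]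
  {F : Type*} [NormedAddCommGroup F] [NormedSpace ℝ F]
  {K : Type*} [TopologicalSpace K] {J : ModelWithCorners ℝ F K}
  {A : Type*} [TopologicalSpace A] [ChartedSpace K A]

/-- The components, as a function of the coordinate `y`, of a field of bilinear forms `T` on `M` in
the preferred chart at `p`. -/
def bilinInChart (T : ∀ q : M, TangentSpace I q →L[ℝ] TangentSpace I q →L[ℝ] ℝ) (p : M) (y : E) :
    E →L[ℝ] E →L[ℝ] ℝ :=
  let q : M := (extChartAt I p).symm y
  let B : E →L[ℝ] E →L[ℝ] ℝ := T q
  B.bilinearComp (tangentCoordChange I p q q) (tangentCoordChange I p q q)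

/-- The Christoffel symbols `Γ(u, v)` at `y` of a metric with components `G` on an open set of `E`:
`2 G(Γ(u, v), w) = ∂_u G(v, w) + ∂_v G(u, w) - ∂_w G(u, v)` for all `w`. -/
def christoffel (G : E → E →L[ℝ] E →L[ℝ] ℝ) (y u v : E) : E :=
  let D : E →L[ℝ] E →L[ℝ] E →L[ℝ] ℝ := fderiv ℝ G y
  (2⁻¹ : ℝ) • (G y).inverse (D u v + D v u - (D.flip u).flip v)

/-- The Christoffel symbols at `p` of the metric `g`, in the preferred chart at `p`. -/
def christoffelAt (g : ∀ q : M, TangentSpace I q →L[ℝ] TangentSpace I q →L[ℝ] ℝ) (p : M)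
    (u v : E) : E :=
  christoffel (bilinInChart g p) (extChartAt I p p) u v

/-- The field of bilinear forms `T` is parallel for the Levi-Civita connection of `g`:
`(∇_u T)(v, w) = ∂_u T(v, w) - T(Γ(u, v), w) - T(v, Γ(u, w)) = 0`. -/
def IsParallelBilin (g T : ∀ q : M, TangentSpace I q →L[ℝ] TangentSpace I q →L[ℝ] ℝ) : Prop :=
  ∀ p : M,
    let B : E →L[ℝ] E →L[ℝ] ℝ := T p
    ∀ u v w : E, fderiv ℝ (bilinInChart T p) (extChartAt I p p) u v w
      = B (christoffelAt g p u v) w + B v (christoffelAt g p u w)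

/-- The covariant derivative `∇_a v` at `x`, for the Levi-Civita connection of `g`, of a vector
field `v` along `f : A → M` (a section of `f^* TM`) in the direction `a ∈ T_x A`. -/
def covDeriv (g : ∀ q : M, TangentSpace I q →L[ℝ] TangentSpace I q →L[ℝ] ℝ) (f : A → M)
    (v : ∀ x : A, TangentSpace I (f x)) (x : A) (a : TangentSpace J x) : TangentSpace I (f x) :=
  let D : F →L[ℝ] E :=
    mfderiv J 𝓘(ℝ, E) (fun z : A => tangentCoordChange I (f z) (f x) (f z) (v z)) x
  let df : F →L[ℝ] E := mfderiv J I f x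
  let a' : F := a
  let w : E := v x
  (D a' + christoffelAt g (f x) (df a') w : E)

/-- `v ∈ Γ(NA)`: a smooth vector field along `f : A → M`, everywhere orthogonal to `A`. -/
def IsNormalSection (J : ModelWithCorners ℝ F K)
    (g : ∀ q : M, TangentSpace I q →L[ℝ] TangentSpace I q →L[ℝ] ℝ)
    (f : A → M) (v : ∀ x : A, TangentSpace I (f x)) : Prop :=
  ContMDiff J I.tangent ∞ (fun x : A => (⟨f x, v x⟩ : TangentBundle I M)) ∧
    ∀ (x : A) (a : TangentSpace J x), g (f x) (v x) (mfderiv J I f x a) = 0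

/-- The vectors `e` of `T_x A` are orthonormal for the metric induced on `A`. With as many vectors
as the dimension of `A` this is an orthonormal basis of `T_x A`. -/
def IsOrthonormalFrame {n : ℕ} (g : ∀ q : M, TangentSpace I q →L[ℝ] TangentSpace I q →L[ℝ] ℝ)
    (f : A → M) (x : A) (e : Fin n → TangentSpace J x) : Prop :=
  ∀ i j, g (f x) (mfderiv J I f x (e i)) (mfderiv J I f x (e j)) = if i = j then 1 else 0

/-- The normal component `u^⊥` of `u ∈ T_{f x} M`, in terms of an orthonormal basis `e` of
`T_x A`. -/
def normalPart {n : ℕ} (g : ∀ q : M, TangentSpace I q →L[ℝ] TangentSpace I q →L[ℝ] ℝ)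
    (f : A → M) (x : A) (e : Fin n → TangentSpace J x) (u : TangentSpace I (f x)) :
    TangentSpace I (f x) :=
  u - ∑ i, g (f x) u (mfderiv J I f x (e i)) • mfderiv J I f x (e i)

/-- The product `u × v` defined by `g(u × v, w) = φ(u, v, w)` for all `w`. -/
def cross (g : ∀ q : M, TangentSpace I q →L[ℝ] TangentSpace I q →L[ℝ] ℝ)
    (φ : ∀ q : M, TangentSpace I q [⋀^Fin 3]→L[ℝ] ℝ) (p : M) (u v : TangentSpace I p) :
    TangentSpace I p :=
  (g p).inverse ((φ p).toContinuousLinearMap ![u, v, 0] 2)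

/-- The immersed 3-manifold `f : A → M` is associative for the 3-form `φ` with associated metric `g`:
each tangent space of `A` is calibrated by `φ` for one choice of its orientation, that is,
`φ(e₁, e₂, e₃) = ±1` for its orthonormal bases. -/
def IsAssociative (J : ModelWithCorners ℝ F K)
    (g : ∀ q : M, TangentSpace I q →L[ℝ] TangentSpace I q →L[ℝ] ℝ)
    (φ : ∀ q : M, TangentSpace I q [⋀^Fin 3]→L[ℝ] ℝ) (f : A → M) : Prop :=
  ∀ (x : A) (e : Fin 3 → TangentSpace J x), IsOrthonormalFrame g f x e →
    |φ (f x) (fun i => mfderiv J I f x (e i))| = 1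

/-- The Dirac operator `𝒟v(x) = ∑ i, e i × ∇^⊥_{e i} v` of the associative `f : A → M`, computed in
the orthonormal basis `e` of `T_x A` (the value does not depend on `e`). -/
def dirac (g : ∀ q : M, TangentSpace I q →L[ℝ] TangentSpace I q →L[ℝ] ℝ)
    (φ : ∀ q : M, TangentSpace I q [⋀^Fin 3]→L[ℝ] ℝ) (f : A → M)
    (v : ∀ x : A, TangentSpace I (f x)) (x : A) (e : Fin 3 → TangentSpace J x) :
    TangentSpace I (f x) :=
  ∑ i, cross g φ (f x) (mfderiv J I f x (e i)) (normalPart g f x e (covDeriv g f v x (e i)))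

/-- The kernel of `𝒟 : Γ(NA) → Γ(NA)`, the infinitesimal deformation space of the associative
`f : A → M`. -/
def diracKernel (J : ModelWithCorners ℝ F K)
    (g : ∀ q : M, TangentSpace I q →L[ℝ] TangentSpace I q →L[ℝ] ℝ)
    (φ : ∀ q : M, TangentSpace I q [⋀^Fin 3]→L[ℝ] ℝ) (f : A → M) :
    Set (∀ x : A, TangentSpace I (f x)) :=
  {v | IsNormalSection J g f v ∧
    ∀ (x : A) (e : Fin 3 → TangentSpace J x), IsOrthonormalFrame g f x e → dirac g φ f v x e = 0}

/-- The associative `f : A → M` is rigid: its infinitesimal deformation space vanishes. -/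
def IsRigidAssociative (J : ModelWithCorners ℝ F K)
    (g : ∀ q : M, TangentSpace I q →L[ℝ] TangentSpace I q →L[ℝ] ℝ)
    (φ : ∀ q : M, TangentSpace I q [⋀^Fin 3]→L[ℝ] ℝ) (f : A → M) : Prop :=
  ∀ v ∈ diracKernel J g φ f, ∀ x, v x = 0

end Riemannian

/-! ## Calabi-Yau 3-folds and complex curves -/

/-- The model space `ℂ³` of complex 3-folds. -/
abbrev C3 : Type := EuclideanSpace ℂ (Fin 3)

/-- A complex manifold is a smooth real manifold, with the same charts. -/
instance realManifold {W : Type*} [NormedAddCommGroup W] [NormedSpace ℂ W] [NormedSpace ℝ W]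
    [IsScalarTower ℝ ℂ W] {V : Type*} [TopologicalSpace V] [ChartedSpace W V]
    [h : IsManifold 𝓘(ℂ, W) ∞ V] : IsManifold 𝓘(ℝ, W) ∞ V := by
  refine isManifold_of_contDiffOn _ _ _ fun e e' he he' => ?_
  have := h.compatible he he'
  rw [contDiffGroupoid, mem_groupoid_of_pregroupoid] at this
  exact ContDiffOn.restrict_scalars ℝ this.1

section Complex

variable {V : Type*} [TopologicalSpace V] [ChartedSpace C3 V] [IsManifold 𝓘(ℂ, C3) ∞ V]

/-- The complex structure `I` on the real tangent spaces of the complex manifold `V`. -/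
def complexStr (x : V) : TangentSpace 𝓘(ℝ, C3) x →L[ℝ] TangentSpace 𝓘(ℝ, C3) x :=
  let m : C3 →L[ℝ] C3 := Complex.I • ContinuousLinearMap.id ℝ C3
  m

/-- The 2-form `ω(u, v) = g(Iu, v)`. -/
def kahlerForm (g : ∀ q : V, TangentSpace 𝓘(ℝ, C3) q →L[ℝ] TangentSpace 𝓘(ℝ, C3) q →L[ℝ] ℝ)
    (x : V) : TangentSpace 𝓘(ℝ, C3) x →L[ℝ] TangentSpace 𝓘(ℝ, C3) x →L[ℝ] ℝ :=
  (g x).comp (complexStr x)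

/-- The components, as a function of the coordinate `y`, of a field of complex trilinear
alternating forms in the preferred chart at `p`. -/
def volInChart (Ω : ∀ x : V, TangentSpace 𝓘(ℂ, C3) x [⋀^Fin 3]→L[ℂ] ℂ) (p : V) (y : C3) :
    C3 [⋀^Fin 3]→L[ℂ] ℂ :=
  let q : V := (extChartAt 𝓘(ℂ, C3) p).symm y
  let B : C3 [⋀^Fin 3]→L[ℂ] ℂ := Ω q
  B.compContinuousLinearMap (tangentCoordChange 𝓘(ℂ, C3) p q q)

variable (V) in
/-- A Calabi-Yau structure `(g, I, ω, Ω)` on the complex 3-fold `V`: a torsion-free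
`SU(3)`-structure whose complex structure is that of `V`. -/
structure CalabiYau where
  /-- The Riemannian metric. -/
  metric : Bundle.ContMDiffRiemannianMetric 𝓘(ℝ, C3) ∞ C3
    (fun x : V => TangentSpace 𝓘(ℝ, C3) x)
  /-- The complex volume form. -/
  Ω : ∀ x : V, TangentSpace 𝓘(ℂ, C3) x [⋀^Fin 3]→L[ℂ] ℂ
  smooth_Ω : ∀ p : V, ContDiffOn ℝ ∞ (volInChart Ω p) (extChartAt 𝓘(ℂ, C3) p).target
  /-- At each point the structure is isomorphic to `ℂ³` with its Euclidean metric and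
  `dz¹ ∧ dz² ∧ dz³` (and hence `ω` to the standard Kähler form). -/
  frame : ∀ x : V, ∃ β : C3 ≃L[ℂ] TangentSpace 𝓘(ℂ, C3) x,
    (∀ a b : C3, metric.inner x (β a) (β b) = (inner ℂ a b).re) ∧
    ∀ a : Fin 3 → C3, Ω x (fun i => β (a i)) = Matrix.det (Matrix.of fun i j => a i j)
  /-- `∇ω = 0`. -/
  parallel_ω : IsParallelBilin metric.inner (kahlerForm metric.inner)
  /-- `∇Ω = 0`: `(∇_u Ω)(a₀, a₁, a₂) = ∂_u Ω(a₀, a₁, a₂) - ∑ i, Ω(.., Γ(u, a i), ..) = 0`. -/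
  parallel_Ω : ∀ p : V,
    let B : C3 [⋀^Fin 3]→L[ℂ] ℂ := Ω p
    ∀ (u : C3) (a : Fin 3 → C3), fderiv ℝ (volInChart Ω p) (extChartAt 𝓘(ℂ, C3) p p) u a
      = ∑ i, B (Function.update a i (christoffelAt (I := 𝓘(ℝ, C3)) metric.inner p u (a i)))

namespace CalabiYau

variable (X : CalabiYau V)

/-- The metric tensor of the Calabi-Yau structure. -/
abbrev g (x : V) : TangentSpace 𝓘(ℝ, C3) x →L[ℝ] TangentSpace 𝓘(ℝ, C3) x →L[ℝ] ℝ :=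
  X.metric.inner x

/-- The Kähler form of the Calabi-Yau structure. -/
abbrev kahler (x : V) : TangentSpace 𝓘(ℝ, C3) x →L[ℝ] TangentSpace 𝓘(ℝ, C3) x →L[ℝ] ℝ :=
  kahlerForm X.g x

/-- The real 3-form `α = Re Ω`. -/
def reΩ (x : V) : TangentSpace 𝓘(ℝ, C3) x [⋀^Fin 3]→L[ℝ] ℝ :=
  let B : C3 [⋀^Fin 3]→L[ℂ] ℂ := X.Ω x
  Complex.reCLM.compContinuousAlternatingMap (B.restrictScalars ℝ)

theorem kahler_swap (x : V) (u v : TangentSpace 𝓘(ℝ, C3) x) : X.kahler x u v = -X.kahler x v u := by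
  obtain ⟨β, hβ, -⟩ := X.frame x
  have key : ∀ a b : C3, X.kahler x (β a) (β b) = (inner ℂ (Complex.I • a) b).re := by
    intro a b
    rw [← hβ, map_smul]
    rfl
  obtain ⟨a, rfl⟩ := β.surjective u
  obtain ⟨b, rfl⟩ := β.surjective v
  have h := congrArg Complex.im (inner_conj_symm (𝕜 := ℂ) a b)
  rw [Complex.conj_im] at h
  rw [key, key, inner_smul_left, inner_smul_left]
  simp
  linarith

end CalabiYau

/-- The inclusion `f : C → V` of an embedded complex curve (a 1-dimensional complex submanifold):
a holomorphic map that is a homeomorphism onto its image and has injective differentials. -/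
structure IsComplexCurve {C : Type*} [TopologicalSpace C] [ChartedSpace ℂ C] (f : C → V) :
    Prop where
  holomorphic : ContMDiff 𝓘(ℂ, ℂ) 𝓘(ℂ, C3) ∞ f
  embedding : Topology.IsEmbedding f
  immersion : ∀ x, Function.Injective (mfderiv 𝓘(ℂ, ℂ) 𝓘(ℂ, C3) f x)

variable {C : Type*} [TopologicalSpace C] [ChartedSpace ℂ C]

namespace CalabiYau

variable (X : CalabiYau V)

/-- The complex Dirac operator `𝒟ᶜ v(x) = a × (∇_a v + I ∇_{Ia} v)^⊥` on the normal bundle of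
`f : C → V`, computed with the unit vector `a ∈ T_x C` (the value does not depend on `a`). -/
def complexDirac (f : C → V) (v : ∀ x : C, TangentSpace 𝓘(ℝ, C3) (f x)) (x : C)
    (a : TangentSpace 𝓘(ℝ, ℂ) x) : TangentSpace 𝓘(ℝ, C3) (f x) :=
  let Ia : TangentSpace 𝓘(ℝ, ℂ) x := Complex.I * (show ℂ from a)
  cross X.g X.reΩ (f x) (mfderiv 𝓘(ℝ, ℂ) 𝓘(ℝ, C3) f x a)
    (normalPart X.g f x ![a, Ia]
      (covDeriv X.g f v x a + complexStr (f x) (covDeriv X.g f v x Ia)))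

/-- The kernel of `𝒟ᶜ` on `Γ(NC)`. -/
def complexDiracKernel (f : C → V) : Set (∀ x : C, TangentSpace 𝓘(ℝ, C3) (f x)) :=
  {v | IsNormalSection 𝓘(ℝ, ℂ) X.g f v ∧
    ∀ (x : C) (a : TangentSpace 𝓘(ℝ, ℂ) x),
      X.g (f x) (mfderiv 𝓘(ℝ, ℂ) 𝓘(ℝ, C3) f x a) (mfderiv 𝓘(ℝ, ℂ) 𝓘(ℝ, C3) f x a) = 1 →
        X.complexDirac f v x a = 0}

end CalabiYau

/-- The normal field `v` along `f : C → V`, regarded as a section of the holomorphic quotient bundle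
`NC = f^* TV / TC`, is holomorphic: near every point it is congruent modulo `TC` to a holomorphic
section of `f^* TV`. -/
def IsHolomorphicNormal (f : C → V) (v : ∀ x : C, TangentSpace 𝓘(ℝ, C3) (f x)) : Prop :=
  ∀ x₀ : C, ∃ U : Set C, IsOpen U ∧ x₀ ∈ U ∧ ∃ s : ∀ x : C, TangentSpace 𝓘(ℂ, C3) (f x),
    ContMDiffOn 𝓘(ℂ, ℂ) 𝓘(ℂ, C3).tangent ∞
      (fun x : C => (⟨f x, s x⟩ : TangentBundle 𝓘(ℂ, C3) V)) U ∧
    ∀ x ∈ U, ∃ a : TangentSpace 𝓘(ℂ, ℂ) x, s x + mfderiv 𝓘(ℂ, ℂ) 𝓘(ℂ, C3) f x a = v x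

/-- The complex curve `f : C → V` is rigid: it has no non-zero holomorphic normal vector field. -/
def CalabiYau.IsRigidCurve (X : CalabiYau V) (f : C → V) : Prop :=
  ∀ v : ∀ x : C, TangentSpace 𝓘(ℝ, C3) (f x),
    IsNormalSection 𝓘(ℝ, ℂ) X.g f v → IsHolomorphicNormal f v → ∀ x, v x = 0

end Complex

/-! ## The product `S¹ × V` -/

section Product

/-- The model space `ℝ × ℂ³` of `S¹ × V`. -/
abbrev RC3 : Type := EuclideanSpace ℝ (Fin 1) × C3

/-- The 1-form `dθ` on the unit circle, `θ` being the angle: `dθ(u) = Im(z̄ · u)` for `u` tangent to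
the circle in `ℂ` at `z`. -/
def dθ (z : Circle) : EuclideanSpace ℝ (Fin 1) →L[ℝ] ℝ :=
  let D : EuclideanSpace ℝ (Fin 1) →L[ℝ] ℂ :=
    mfderiv (𝓡 1) 𝓘(ℝ, ℂ) (fun w : Circle => (w : ℂ)) z
  Complex.imCLM.comp ((ContinuousLinearMap.mul ℝ ℂ ((starRingEnd ℂ) (z : ℂ))).comp D)

variable {V : Type*} [TopologicalSpace V] [ChartedSpace C3 V] [IsManifold 𝓘(ℂ, C3) ∞ V]

namespace CalabiYau

variable (X : CalabiYau V)

/-- The product metric `dθ² + g` on `S¹ × V`. -/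
def productMetric (p : Circle × V) :
    TangentSpace ((𝓡 1).prod 𝓘(ℝ, C3)) p →L[ℝ] TangentSpace ((𝓡 1).prod 𝓘(ℝ, C3)) p →L[ℝ] ℝ :=
  let B : C3 →L[ℝ] C3 →L[ℝ] ℝ := X.g p.2
  let t : RC3 →L[ℝ] ℝ := (dθ p.1).comp (ContinuousLinearMap.fst ℝ _ _)
  let G : RC3 →L[ℝ] RC3 →L[ℝ] ℝ :=
    (ContinuousLinearMap.mul ℝ ℝ).bilinearComp t t +
      B.bilinearComp (ContinuousLinearMap.snd ℝ _ _) (ContinuousLinearMap.snd ℝ _ _)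
  G

/-- The 3-form `φ = dθ ∧ ω + Re Ω` on `S¹ × V`. -/
def productForm (p : Circle × V) :
    TangentSpace ((𝓡 1).prod 𝓘(ℝ, C3)) p [⋀^Fin 3]→L[ℝ] ℝ :=
  let t : EuclideanSpace ℝ (Fin 1) →L[ℝ] ℝ := dθ p.1
  let w : C3 →L[ℝ] C3 →L[ℝ] ℝ := X.kahler p.2
  let α : C3 [⋀^Fin 3]→L[ℝ] ℝ := X.reΩ p.2
  have hw : ∀ a b, w a b = -w b a := X.kahler_swap p.2
  let tw : RC3 [⋀^Fin 3]→L[ℝ] ℝ :=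
    { toFun := fun m => t (m 0).1 * w (m 1).2 (m 2).2 + t (m 1).1 * w (m 2).2 (m 0).2
        + t (m 2).1 * w (m 0).2 (m 1).2
      map_update_add' := by
        intro inst m i x y
        obtain rfl := Subsingleton.elim inst (instDecidableEqFin 3)
        fin_cases i <;> simp [Function.update] <;> ring
      map_update_smul' := by
        intro inst m i c x
        obtain rfl := Subsingleton.elim inst (instDecidableEqFin 3)
        fin_cases i <;> simp [Function.update] <;> ring
      cont := by fun_prop
      map_eq_zero_of_eq' := by
        intro m i j h hij
        have h0 : ∀ a, w a a = 0 := fun a => by linarith [hw a a]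
        fin_cases i <;> fin_cases j <;> simp at h hij ⊢ <;> rw [h, h0] <;>
          first
            | (rw [hw (m 0).2 (m 1).2]; ring)
            | (rw [hw (m 0).2 (m 2).2]; ring)
            | (rw [hw (m 1).2 (m 2).2]; ring) }
  tw + α.compContinuousLinearMap (ContinuousLinearMap.snd ℝ _ _)

end CalabiYau

variable {C : Type*}

/-- The submanifold `S¹ × C → S¹ × V`. -/
def circleTimes (f : C → V) : Circle × C → Circle × V := Prod.map id f

/-- The pull-back to `S¹ × C` of a normal vector field of `C`, independent of `θ`, through the
identification of the normal bundle of `S¹ × C ⊂ S¹ × V` with that of `C ⊂ V`. -/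
def pullBack (f : C → V) (w : ∀ x : C, TangentSpace 𝓘(ℝ, C3) (f x)) (p : Circle × C) :
    TangentSpace ((𝓡 1).prod 𝓘(ℝ, C3)) (circleTimes f p) :=
  let u : RC3 := (0, w p.2)
  u

end Product

end AssocDef

end

noncomputable section

set_option linter.unusedSectionVars false
namespace AssocDef

/-! ### Orthonormal bases of a real bilinear form. -/

section Orthonormal

variable {n : ℕ} {F N : Type*} [AddCommGroup F] [Module ℝ F] [FiniteDimensional ℝ F]
  [AddCommGroup N] [Module ℝ N]

/-! A normal field of `S¹ × C` has no component along the circle, so it is a `2π`-periodic family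
`v_t` of normal fields of `C`. In holomorphic charts let `F'` be the complex derivative of the curve
and `∂̄v = ∂_x v + i ∂_y v`, computed on components. Since `ω` is parallel, the Christoffel symbols
commute with `I` in both slots (`Γ_I_right`, `Γ_I_left`); they cancel in `∇_a v + I ∇_{Ia} v`, which
is therefore `ā ∂̄v` (`cov_add_I`). Evaluating `𝒟` in a frame `∂_θ, U, IU` with `U` a unit multiple
of `F'` gives `⟨𝒟v, c⟩ = g(I ∂_t v, c) + Re Ω(F', ∂̄v, c) / |F'|²`, where `c` enters through its
`V`-component (`dirac_pairing`). The second term alone is the pairing with `𝒟ᶜ`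
(`form_complexDirac`), so pull-backs of `ker 𝒟ᶜ` lie in `ker 𝒟`. Associativity is `φ(∂_θ, U, IU) =
ω(U, IU) = 1`.

For the converse inclusion, the equation `𝒟v = 0` reads `∂_t v = Av` with `g(Av, w) = Im Ω(F', ∂̄v,
w) / |F'|²` (`form_circleDeriv`). The operator `A` is symmetric for the `L²` product on `C`: since
`Ω` is parallel its coefficients are annihilated by `∂̄` along `C`, so the difference of `⟨Av, w⟩`
and `⟨v, Aw⟩` is, as a density, the imaginary part of `∂̄` of the coefficient of the 1-form `Ω(·, v,
w)` (`dbar_volOneForm`), and it integrates to zero by Stokes (`exists_areaMeasure`). Hence `P(s, t)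
= ∫ g(v_s, v_t)` satisfies `∂_s P = ∂_t P` and depends only on `s + t`. Now `‖v_a - v_b‖² ≥ 0` says
that `t ↦ P(t, t)` is midpoint convex; being continuous and periodic it has a maximum, so it is
constant, and then `‖v_a - v_b‖² = 0` (`eq_zero_of_antidiagonal`). Thus `v_t` does not depend on
`t`. Only first-order operators enter, and no elliptic theory.

For rigidity, `Re Ω(F', ∂̄v, ·) = 0` holds exactly when `∂̄v` is tangent to `C`
(`diracPairing_eq_zero_iff`), and this is the Cauchy-Riemann equation for the class of `v` in
`TV/TC` (`isHolomorphicNormal_iff`). So `ker 𝒟ᶜ` consists of the holomorphic normal fields, and the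
two notions of rigidity agree. -/

theorem eq_sum_of_orthonormal (hn : Module.finrank ℝ F = n) (G : F →ₗ[ℝ] F →ₗ[ℝ] ℝ)
    {e : Fin n → F} (he : ∀ i j, G (e i) (e j) = if i = j then 1 else 0) (x : F) :
    x = ∑ i, G x (e i) • e i := by
  have hli : LinearIndependent ℝ e := by
    rw [Fintype.linearIndependent_iff]
    intro c hc j
    have := congrArg (fun y => G y (e j)) hc
    simpa [he, Finset.sum_ite_eq'] using this
  have hx : x ∈ Submodule.span ℝ (Set.range e) := by
    rw [hli.span_eq_top_of_card_eq_finrank' (by simp [hn])]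
    trivial
  obtain ⟨c, rfl⟩ := (Submodule.mem_span_range_iff_exists_fun ℝ).1 hx
  simp [he]

/-- The trace of a bilinear map does not depend on the orthonormal basis. -/
theorem sum_bilin_orthonormal (hn : Module.finrank ℝ F = n) (G : F →ₗ[ℝ] F →ₗ[ℝ] ℝ)
    {e b : Fin n → F} (he : ∀ i j, G (e i) (e j) = if i = j then 1 else 0)
    (hb : ∀ i j, G (b i) (b j) = if i = j then 1 else 0) (hG : ∀ x y, G x y = G y x)
    (B : F →ₗ[ℝ] F →ₗ[ℝ] N) : ∑ i, B (e i) (e i) = ∑ i, B (b i) (b i) := by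
  have h1 : ∀ i, B (e i) (e i) = ∑ j, ∑ k, (G (e i) (b j) * G (e i) (b k)) • B (b j) (b k) := by
    intro i
    conv_lhs => rw [eq_sum_of_orthonormal hn G hb (e i)]
    simp only [map_sum, map_smul, LinearMap.sum_apply, LinearMap.smul_apply, smul_smul,
      Finset.smul_sum]
    rw [Finset.sum_comm]
    simp only [mul_comm]
  -- The change of basis between two orthonormal bases is orthogonal: its columns are orthonormal.
  have h2 : ∀ j k, ∑ i, G (e i) (b j) * G (e i) (b k) = if j = k then 1 else 0 := by
    intro j k
    rw [← hb j k]
    conv_rhs => rw [eq_sum_of_orthonormal hn G he (b j)]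
    simp only [map_sum, map_smul, LinearMap.sum_apply, LinearMap.smul_apply, smul_eq_mul]
    exact Finset.sum_congr rfl fun i _ => by rw [hG (e i) (b j)]
  simp only [h1]
  rw [Finset.sum_comm]
  refine Finset.sum_congr rfl fun j _ => ?_
  rw [Finset.sum_comm]
  simp only [← Finset.sum_smul, h2]
  simp

/-- An alternating form of top degree takes the same values, up to sign, on orthonormal bases. -/
theorem abs_alternating_orthonormal (hn : Module.finrank ℝ F = n) (G : F →ₗ[ℝ] F →ₗ[ℝ] ℝ)
    {e b : Fin n → F} (he : ∀ i j, G (e i) (e j) = if i = j then 1 else 0)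
    (hb : ∀ i j, G (b i) (b j) = if i = j then 1 else 0)
    (φ : F [⋀^Fin n]→ₗ[ℝ] ℝ) : |φ e| = |φ b| := by
  let O : Matrix (Fin n) (Fin n) ℝ := Matrix.of fun i j => G (e i) (b j)
  have hO : O * O.transpose = 1 := by
    ext i j
    rw [Matrix.mul_apply, Matrix.one_apply, ← he i j]
    conv_rhs => rw [eq_sum_of_orthonormal hn G hb (e i), eq_sum_of_orthonormal hn G hb (e j)]
    simp [O, hb, mul_comm]
  have hdet : |O.det| = 1 := by
    have := congrArg Matrix.det hO
    rw [Matrix.det_mul, Matrix.det_transpose, Matrix.det_one] at this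
    rcases mul_self_eq_one_iff.1 this with h | h <;> simp [h]
  have h1 : φ e = O.det * φ b := by
    have h2 : e = fun i => ∑ j, O i j • b j := funext fun i => eq_sum_of_orthonormal hn G hb (e i)
    -- The determinant formula is applied to the pull-back of `φ` to `ℝⁿ` along `b`, where the
    -- standard basis is available.
    have h3 : φ (fun i => Fintype.linearCombination ℝ b (O i))
        = φ (fun i => Fintype.linearCombination ℝ b (Pi.basisFun ℝ (Fin n) i)) * O.det := by
      have h6 := (φ.compLinearMap (Fintype.linearCombination ℝ b)).eq_smul_basis_det
        (Pi.basisFun ℝ (Fin n))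
      rw [Pi.basisFun_det] at h6
      exact DFunLike.congr_fun h6 O
    have h4 : (fun i => Fintype.linearCombination ℝ b (O i)) = e := by
      rw [h2]
      rfl
    have h5 : (fun i => Fintype.linearCombination ℝ b (Pi.basisFun ℝ (Fin n) i)) = b := by
      funext i
      simp [Fintype.linearCombination_apply_single]
    rw [h4, h5, mul_comm] at h3
    exact h3
  rw [h1, abs_mul, hdet, one_mul]

end Orthonormal

/-- A positive definite form on a finite dimensional space is inverted by its inverse. -/
theorem apply_inverse_of_pos {E : Type*} [NormedAddCommGroup E] [NormedSpace ℝ E]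
    [FiniteDimensional ℝ E] (G : E →L[ℝ] E →L[ℝ] ℝ) (hG : ∀ v, v ≠ 0 → 0 < G v v)
    (l : E →L[ℝ] ℝ) : G (G.inverse l) = l := by
  have hinj : Function.Injective (G : E →ₗ[ℝ] (E →L[ℝ] ℝ)) := by
    refine (injective_iff_map_eq_zero _).2 fun v hv => ?_
    by_contra h
    have h1 := hG v h
    have h2 : G v = 0 := hv
    rw [h2] at h1
    simp at h1
  have hfr : Module.finrank ℝ E = Module.finrank ℝ (E →L[ℝ] ℝ) := by
    rw [← (LinearMap.toContinuousLinearMap (𝕜 := ℝ) (E := E) (F' := ℝ)).finrank_eq]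
    exact (Subspace.dual_finrank_eq (K := ℝ) (V := E)).symm
  -- `inverse` is zero by default on maps that are not invertible, so `G` must be exhibited as an
  -- equivalence; injectivity and equal dimensions suffice.
  let L := LinearEquiv.ofInjectiveOfFinrankEq (G : E →ₗ[ℝ] (E →L[ℝ] ℝ)) hinj hfr
  let e : E ≃L[ℝ] (E →L[ℝ] ℝ) := L.toContinuousLinearEquiv
  have he : (e : E →L[ℝ] (E →L[ℝ] ℝ)) = G := by
    ext x y
    rfl
  rw [← he, ContinuousLinearMap.inverse_equiv]
  exact e.apply_symm_apply l


/-! ### Alternating trilinear forms, slot by slot. -/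

section Trilinear

variable {𝕜 E : Type*} [RCLike 𝕜] [NormedAddCommGroup E] [NormedSpace 𝕜 E]
  (Ω : E [⋀^Fin 3]→L[𝕜] 𝕜) (c : 𝕜) (u v w u' : E)

theorem tri_add₀ : Ω ![u + u', v, w] = Ω ![u, v, w] + Ω ![u', v, w] := by
  have := Ω.toMultilinearMap.map_update_add ![u, v, w] 0 u u'
  simp only [Matrix.vecCons, Fin.update_cons_zero] at this
  exact this

theorem tri_smul₀ : Ω ![c • u, v, w] = c * Ω ![u, v, w] := by
  have := Ω.toMultilinearMap.map_update_smul ![u, v, w] 0 c u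
  simp only [Matrix.vecCons, Fin.update_cons_zero] at this
  exact this

theorem tri_swap₀₁ : Ω ![u, v, w] = - Ω ![v, u, w] := by
  have := Ω.toAlternatingMap.map_swap ![v, u, w] (i := 0) (j := 1) (by decide)
  refine Eq.trans ?_ this
  change Ω _ = Ω _
  congr 1
  ext i : 1
  fin_cases i <;> rfl

theorem tri_swap₁₂ : Ω ![u, v, w] = - Ω ![u, w, v] := by
  have := Ω.toAlternatingMap.map_swap ![u, w, v] (i := 1) (j := 2) (by decide)
  refine Eq.trans ?_ this
  change Ω _ = Ω _
  congr 1
  ext i : 1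
  fin_cases i <;> rfl

theorem tri_smul₁ : Ω ![u, c • v, w] = c * Ω ![u, v, w] := by
  rw [tri_swap₀₁, tri_smul₀, tri_swap₀₁ Ω u]; ring

theorem tri_smul₂ : Ω ![u, v, c • w] = c * Ω ![u, v, w] := by
  rw [tri_swap₁₂, tri_smul₁, tri_swap₁₂ Ω u v]; ring

theorem tri_add₁ : Ω ![u, v + u', w] = Ω ![u, v, w] + Ω ![u, u', w] := by
  rw [tri_swap₀₁, tri_add₀, tri_swap₀₁ Ω u, tri_swap₀₁ Ω u]; ring

theorem tri_add₂ : Ω ![u, v, w + u'] = Ω ![u, v, w] + Ω ![u, v, u'] := by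
  rw [tri_swap₁₂, tri_add₁, tri_swap₁₂ Ω u v, tri_swap₁₂ Ω u v]; ring

theorem tri_self₀₁ : Ω ![u, u, w] = 0 := by
  have := tri_swap₀₁ Ω u u w
  exact self_eq_neg.1 this

end Trilinear

/-! ### Pointwise `SU(3)` linear algebra. -/

/-- The metric `G` and the complex volume form `Ω` are isomorphic to the standard ones. -/
def IsSU3 (G : C3 →L[ℝ] C3 →L[ℝ] ℝ) (Ω : C3 [⋀^Fin 3]→L[ℂ] ℂ) : Prop :=
  ∃ β : C3 ≃L[ℂ] C3, (∀ a b : C3, G (β a) (β b) = (inner ℂ a b).re) ∧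
    ∀ a : Fin 3 → C3, Ω (fun i => β (a i)) = Matrix.det (Matrix.of fun i j => a i j)

namespace IsSU3

variable {G : C3 →L[ℝ] C3 →L[ℝ] ℝ} {Ω : C3 [⋀^Fin 3]→L[ℂ] ℂ} (h : IsSU3 G Ω)
include h

theorem symm (u v : C3) : G u v = G v u := by
  obtain ⟨β, hβ, -⟩ := h
  obtain ⟨a, rfl⟩ := β.surjective u
  obtain ⟨b, rfl⟩ := β.surjective v
  rw [hβ, hβ, ← inner_conj_symm, Complex.conj_re]

theorem pos (u : C3) (hu : u ≠ 0) : 0 < G u u := by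
  obtain ⟨β, hβ, -⟩ := h
  obtain ⟨a, rfl⟩ := β.surjective u
  rw [hβ]
  have ha : a ≠ 0 := by rintro rfl; simp at hu
  rw [inner_self_eq_norm_sq_to_K]
  have h2 := norm_pos_iff.2 ha
  have h3 : ((‖a‖ : ℂ) ^ 2).re = ‖a‖ ^ 2 := by norm_cast
  exact h3 ▸ pow_pos h2 2

theorem map_I (u v : C3) : G (Complex.I • u) (Complex.I • v) = G u v := by
  obtain ⟨β, hβ, -⟩ := h
  obtain ⟨a, rfl⟩ := β.surjective u
  obtain ⟨b, rfl⟩ := β.surjective v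
  rw [← map_smul, ← map_smul, hβ, hβ, inner_smul_left, inner_smul_right]
  simp

theorem map_I_left (u v : C3) : G (Complex.I • u) v = - G u (Complex.I • v) := by
  rw [← h.map_I u, smul_smul, Complex.I_mul_I, neg_one_smul, map_neg, neg_neg]

theorem map_self_I (u : C3) : G u (Complex.I • u) = 0 := by
  have := h.map_I_left u u
  rw [h.symm] at this
  linarith

theorem map_smul_smul (c : ℂ) (u v : C3) : G (c • u) (c • v) = Complex.normSq c * G u v := by
  have hc : ∀ w : C3, c • w = (c.re : ℝ) • w + c.im • (Complex.I • w) := by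
    intro w
    conv_lhs => rw [← Complex.re_add_im c]
    rw [add_smul, mul_smul]
    rfl
  rw [hc, hc]
  simp only [map_add, map_smul, add_apply, smul_apply,
    smul_eq_mul, h.map_I, h.map_I_left, Complex.normSq_apply]
  ring

/-- Replacing `w` by `Iw` recovers the imaginary part, so `Ω(u, n, ·)` vanishes altogether. In the
standard model its values on the three basis vectors are, up to sign, the `2 × 2` minors of the
pair, so `n` is a complex multiple of `u`; the two orthogonality hypotheses say that `n` is
Hermitian orthogonal to `u`, and the multiple is zero. -/
theorem eq_zero_of_tri {u n : C3} (hu : u ≠ 0) (h0 : G n u = 0) (h1 : G n (Complex.I • u) = 0)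
    (hn : ∀ w, (Ω ![u, n, w]).re = 0) : n = 0 := by
  have hn' : ∀ w, Ω ![u, n, w] = 0 := by
    intro w
    apply Complex.ext
    · exact hn w
    · have := hn (Complex.I • w)
      rw [tri_smul₂] at this
      simpa using this
  obtain ⟨β, hβ, hΩ⟩ := h
  obtain ⟨a, rfl⟩ := β.surjective u
  obtain ⟨b, rfl⟩ := β.surjective n
  rw [hβ] at h0
  rw [← map_smul, hβ, inner_smul_right] at h1
  have hi : (inner ℂ b a : ℂ) = 0 := by
    apply Complex.ext
    · exact h0
    · simpa using h1
  have key : ∀ c : C3, Matrix.det (Matrix.of fun i j => (![a, b, c] : Fin 3 → C3) i j) = 0 := by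
    intro c
    rw [← hΩ, ← hn' (β c)]
    congr 1
    ext i : 1
    fin_cases i <;> rfl
  have k0 := key (EuclideanSpace.single 0 1)
  have k1 := key (EuclideanSpace.single 1 1)
  have k2 := key (EuclideanSpace.single 2 1)
  simp [Matrix.det_fin_three] at k0 k1 k2
  have ha : a ≠ 0 := by rintro rfl; simp at hu
  have hab : ∀ i j, a i * b j = a j * b i := by
    intro i j
    fin_cases i <;> fin_cases j <;> simp <;>
      first
        | linear_combination k0
        | linear_combination -k0
        | linear_combination k1
        | linear_combination -k1
        | linear_combination k2
        | linear_combination -k2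
  obtain ⟨k, hk⟩ : ∃ k, a k ≠ 0 := by
    by_contra! hc
    exact ha (by ext i; simp [hc i])
  have hb : b = (b k / a k) • a := by
    ext i
    simp only [PiLp.smul_apply, smul_eq_mul]
    field_simp
    rw [mul_comm, hab k i, mul_comm]
  have : b k = 0 := by
    rw [hb, inner_smul_left] at hi
    simpa [ha, hk] using hi
  rw [hb, this]
  simp

end IsSU3

end AssocDef
namespace AssocDef

/-! ### Vector fields and bilinear forms in one fixed chart. -/

section RealManifold

variable {E : Type*} [NormedAddCommGroup E] [NormedSpace ℝ E]
  {H : Type*} [TopologicalSpace H] {I : ModelWithCorners ℝ E H}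
  {M : Type*} [TopologicalSpace M] [ChartedSpace H M]
  {F : Type*} [NormedAddCommGroup F] [NormedSpace ℝ F]
  {K : Type*} [TopologicalSpace K] {J : ModelWithCorners ℝ F K}
  {A : Type*} [TopologicalSpace A] [ChartedSpace K A]

/-- The components in the preferred chart at `q` of the vector field `v` along `f`. -/
def chartRep [IsManifold I 1 M] (f : A → M) (v : ∀ x : A, TangentSpace I (f x)) (q : M) (x : A) :
    E :=
  tangentCoordChange I (f x) q (f x) (v x)

theorem contMDiffOn_chartRep [IsManifold I ∞ M] {f : A → M} {v : ∀ x : A, TangentSpace I (f x)}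
    (hv : ContMDiff J I.tangent ∞ (fun x : A => (⟨f x, v x⟩ : TangentBundle I M))) (q : M) :
    ContMDiffOn J 𝓘(ℝ, E) ∞ (chartRep f v q) (f ⁻¹' (chartAt H q).source) := by
  have hv' : ContMDiffOn J I.tangent ∞ (fun x : A => (⟨f x, v x⟩ : TangentBundle I M))
    (f ⁻¹' (chartAt H q).source) := hv.contMDiffOn
  refine ((Bundle.Trivialization.contMDiffOn_iff (e := trivializationAt E (TangentSpace I) q)
    ?_).1 hv').2
  intro x hx
  simpa using hx

theorem contMDiffOn_section_iff_chartRep [IsManifold I ∞ M] {f : A → M}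
    {v : ∀ x : A, TangentSpace I (f x)} {q : M} {s : Set A}
    (hs : Set.MapsTo f s (chartAt H q).source) :
    ContMDiffOn J I.tangent ∞ (fun x : A => (⟨f x, v x⟩ : TangentBundle I M)) s ↔
      ContMDiffOn J I ∞ f s ∧ ContMDiffOn J 𝓘(ℝ, E) ∞ (chartRep f v q) s := by
  refine (Bundle.Trivialization.contMDiffOn_iff (e := trivializationAt E (TangentSpace I) q)
    ?_)
  intro x hx
  simpa using hs hx

theorem apply_eq_bilinInChart [IsManifold I 1 M]
    (T : ∀ q : M, TangentSpace I q →L[ℝ] TangentSpace I q →L[ℝ] ℝ) {p q : M}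
    (hq : q ∈ (chartAt H p).source) (u v : E) :
    (T q : E →L[ℝ] E →L[ℝ] ℝ) u v = bilinInChart T p (extChartAt I p q)
      (tangentCoordChange I q p q u) (tangentCoordChange I q p q v) := by
  have hq' : q ∈ (extChartAt I p).source := by rwa [extChartAt_source]
  have hqq : q ∈ (extChartAt I q).source := mem_extChartAt_source q
  -- The base point in `bilinInChart` is the chart inverse of the chart image of `q`, equal to `q`
  -- only by a proved equation; a variable `q'` stands for it until the two can be identified.
  have key : ∀ q' : M, q' = q → (T q : E →L[ℝ] E →L[ℝ] ℝ) u v = (T q' : E →L[ℝ] E →L[ℝ] ℝ)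
      (tangentCoordChange I p q' q' (tangentCoordChange I q p q u))
      (tangentCoordChange I p q' q' (tangentCoordChange I q p q v)) := by
    rintro _ rfl
    rw [tangentCoordChange_comp ⟨⟨hqq, hq'⟩, hqq⟩, tangentCoordChange_comp ⟨⟨hqq, hq'⟩, hqq⟩,
      tangentCoordChange_self hqq, tangentCoordChange_self hqq]
  exact key _ ((extChartAt I p).left_inv hq')

theorem bilinInChart_self [IsManifold I 1 M]
    (T : ∀ q : M, TangentSpace I q →L[ℝ] TangentSpace I q →L[ℝ] ℝ) (p : M) :
    bilinInChart T p (extChartAt I p p) = T p := by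
  ext u v
  have := apply_eq_bilinInChart T (mem_chart_source H p) u v
  rw [tangentCoordChange_self (mem_extChartAt_source p),
    tangentCoordChange_self (mem_extChartAt_source p)] at this
  exact this.symm

omit [TopologicalSpace A] in
theorem chartRep_self [IsManifold I 1 M] (f : A → M) (v : ∀ x : A, TangentSpace I (f x)) (x : A) :
    chartRep f v (f x) x = v x :=
  tangentCoordChange_self (mem_extChartAt_source (f x))

/-- Vector fields with constant components in the chart at `p` are smooth sections there, so the
metric evaluated on two of them is smooth. In finite dimension, smoothness of all these values gives
smoothness of the form itself. -/
theorem contDiffOn_bilinInChart [FiniteDimensional ℝ E] [IsManifold I ∞ M]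
    (g : Bundle.ContMDiffRiemannianMetric I ∞ E (fun x : M => TangentSpace I x)) (p : M) :
    ContDiffOn ℝ ∞ (bilinInChart g.inner p) (extChartAt I p).target := by
  have hsec : ∀ u : E, ContMDiffOn I I.tangent ∞
      (fun q : M => (⟨q, (tangentCoordChange I p q q u : E)⟩ : TangentBundle I M))
      (chartAt H p).source := by
    intro u
    refine (contMDiffOn_section_iff_chartRep (f := id) (q := p)
      (v := fun q => (tangentCoordChange I p q q u : E)) (fun _ h => h)).2 ?_
    refine ⟨contMDiffOn_id, contMDiffOn_const (c := u) |>.congr fun q hq => ?_⟩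
    have hq' : q ∈ (extChartAt I p).source := by rwa [extChartAt_source]
    change tangentCoordChange I q p q (tangentCoordChange I p q q u) = u
    rw [tangentCoordChange_comp ⟨⟨hq', mem_extChartAt_source q⟩, hq'⟩, tangentCoordChange_self hq']
  have hmain : ∀ u w : E, ContMDiffOn I 𝓘(ℝ, ℝ) ∞ (fun q : M =>
      (g.inner q (tangentCoordChange I p q q u : E) (tangentCoordChange I p q q w : E) : ℝ))
      (chartAt H p).source := by
    intro u w q hq
    have := ContMDiffWithinAt.clm_bundle_apply₂ (F₁ := E) (F₂ := E) (F₃ := ℝ)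
      (E₃ := Bundle.Trivial M ℝ) (b := fun q : M => q)
      (g.contMDiff.contMDiffAt.contMDiffWithinAt (s := (chartAt H p).source)) (hsec u q hq)
      (hsec w q hq)
    rw [Bundle.contMDiffWithinAt_totalSpace] at this
    exact this.2
  rw [contDiffOn_clm_apply]
  intro u
  rw [contDiffOn_clm_apply]
  intro w
  rw [← contMDiffOn_iff_contDiffOn]
  refine (hmain u w).comp (contMDiffOn_extChartAt_symm p) fun y hy => ?_
  rw [← extChartAt_source I]
  exact (extChartAt I p).map_target hy

end RealManifold

end AssocDef
namespace AssocDef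

/-! ### The Cauchy-Riemann operator in the plane. -/

section CauchyRiemann

variable {W : Type*} [NormedAddCommGroup W] [NormedSpace ℂ W] [NormedSpace ℝ W]
  [IsScalarTower ℝ ℂ W]

/-- Twice the derivative with respect to the conjugate variable. -/
def dbar (u : ℂ → W) (y : ℂ) : W := fderiv ℝ u y 1 + Complex.I • fderiv ℝ u y Complex.I

/-- The left side is twice the conjugate-linear part of `D` evaluated at `a`, hence determined by
its value at `1`. -/
theorem antilinear_part_smul (D : ℂ →L[ℝ] W) (a : ℂ) :
    D a + Complex.I • D (Complex.I * a)
      = (starRingEnd ℂ a) • (D 1 + Complex.I • D Complex.I) := by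
  have h1 : ∀ r : ℝ, ∀ w : W, ((r : ℂ)) • w = r • w := fun r w => by
    rw [← algebraMap_smul ℂ r w]; rfl
  have ha : a = a.re • (1 : ℂ) + a.im • Complex.I := by simp
  have hIa : Complex.I * a = a.re • Complex.I + (-a.im) • (1 : ℂ) := by
    apply Complex.ext <;> simp
  have hc : starRingEnd ℂ a = (a.re : ℂ) - (a.im : ℂ) * Complex.I := by
    apply Complex.ext <;> simp
  rw [hIa]
  conv_lhs => enter [1]; rw [ha]
  simp only [map_add, map_smul]
  rw [hc]
  simp only [← h1]
  simp only [smul_add, smul_smul, sub_smul]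
  rw [sub_mul, mul_assoc (a.im : ℂ), Complex.I_mul_I, Complex.ofReal_neg]
  module

omit [IsScalarTower ℝ ℂ W] in
theorem dbar_congr {u v : ℂ → W} {y : ℂ} (h : u =ᶠ[nhds y] v) : dbar u y = dbar v y := by
  unfold dbar
  rw [h.fderiv_eq]

theorem _root_.DifferentiableAt.fderiv_real {u : ℂ → W} {y : ℂ} (h : DifferentiableAt ℂ u y)
    (a : ℂ) : fderiv ℝ u y a = a • deriv u y := by
  rw [(h.hasFDerivAt.restrictScalars ℝ).fderiv]
  change fderiv ℂ u y a = _
  rw [← fderiv_apply_one_eq_deriv, ← ContinuousLinearMap.map_smul, smul_eq_mul, mul_one]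

theorem dbar_of_differentiableAt {u : ℂ → W} {y : ℂ} (h : DifferentiableAt ℂ u y) :
    dbar u y = 0 := by
  unfold dbar
  rw [h.fderiv_real, h.fderiv_real, smul_smul, Complex.I_mul_I, one_smul, neg_one_smul,
    add_neg_cancel]

/-- The Cauchy-Riemann equations. -/
theorem differentiableAt_of_dbar {u : ℂ → W} {y : ℂ} (h : DifferentiableAt ℝ u y)
    (h0 : dbar u y = 0) : DifferentiableAt ℂ u y := by
  unfold dbar at h0
  have h1 : fderiv ℝ u y Complex.I = Complex.I • fderiv ℝ u y 1 := by
    rw [eq_neg_of_add_eq_zero_left h0, smul_neg, smul_smul, Complex.I_mul_I, neg_one_smul, neg_neg]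
  refine (hasFDerivAt_of_restrictScalars ℝ h.hasFDerivAt
    (f' := ContinuousLinearMap.toSpanSingleton ℂ (fderiv ℝ u y 1)) ?_).differentiableAt
  ext a
  change a • fderiv ℝ u y 1 = fderiv ℝ u y a
  have ha : a = a.re • (1 : ℂ) + a.im • Complex.I := by simp
  have hr : ∀ r : ℝ, ∀ w : W, r • w = (r : ℂ) • w := fun r w => by
    rw [← algebraMap_smul ℂ r w]; rfl
  conv_rhs => rw [ha, map_add, map_smul, map_smul, h1, hr, hr, smul_smul, ← add_smul,
    Complex.re_add_im]

theorem dbar_comp {u : ℂ → W} {τ : ℂ → ℂ} {y : ℂ} (hu : DifferentiableAt ℝ u (τ y))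
    (hτ : DifferentiableAt ℂ τ y) :
    dbar (u ∘ τ) y = (starRingEnd ℂ (deriv τ y)) • dbar u (τ y) := by
  unfold dbar
  rw [fderiv_comp y hu (hτ.restrictScalars ℝ), ← antilinear_part_smul]
  simp only [ContinuousLinearMap.comp_apply]
  rw [hτ.fderiv_real, hτ.fderiv_real]
  simp

omit [IsScalarTower ℝ ℂ W] in
theorem dbar_sub {u v : ℂ → W} {y : ℂ} (hu : DifferentiableAt ℝ u y)
    (hv : DifferentiableAt ℝ v y) : dbar (fun z => u z - v z) y = dbar u y - dbar v y := by
  unfold dbar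
  rw [fderiv_fun_sub hu hv]
  simp only [sub_apply, smul_sub]
  abel

variable {W' : Type*} [NormedAddCommGroup W'] [NormedSpace ℂ W'] [NormedSpace ℝ W']
  [IsScalarTower ℝ ℂ W']

theorem dbar_clm_comp (L : W →L[ℂ] W') {u : ℂ → W} {y : ℂ} (hu : DifferentiableAt ℝ u y) :
    dbar (fun z => L (u z)) y = L (dbar u y) := by
  have h := (((L.restrictScalars ℝ).hasFDerivAt (x := u y)).comp y hu.hasFDerivAt).fderiv
  have h' : fderiv ℝ (fun z => L (u z)) y = (L.restrictScalars ℝ).comp (fderiv ℝ u y) := h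
  unfold dbar
  rw [h', map_add, map_smul]
  rfl

theorem dbar_smul {c : ℂ → ℂ} {u : ℂ → W} {y : ℂ} (hc : DifferentiableAt ℝ c y)
    (hu : DifferentiableAt ℝ u y) :
    dbar (fun z => c z • u z) y = c y • dbar u y + dbar c y • u y := by
  unfold dbar
  rw [fderiv_fun_smul hc hu]
  simp only [add_apply, smul_apply, ContinuousLinearMap.smulRight_apply]
  simp only [smul_add, add_smul, smul_smul, smul_eq_mul]
  rw [mul_comm Complex.I (c y)]
  abel

/-- A holomorphic family of linear maps commutes with the Cauchy-Riemann operator. -/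
theorem dbar_clm_apply {L : ℂ → W →L[ℂ] W'} {u : ℂ → W} {y : ℂ} (hL : DifferentiableAt ℂ L y)
    (hu : DifferentiableAt ℝ u y) :
    dbar (fun z => L z (u z)) y = L y (dbar u y) := by
  have hR := (ContinuousLinearMap.restrictScalarsL ℂ W W' ℝ ℝ).hasFDerivAt.comp y
    (hL.hasFDerivAt.restrictScalars ℝ)
  have h := (hR.clm_apply hu.hasFDerivAt).fderiv
  have h' : fderiv ℝ (fun z => L z (u z)) y = _ := h
  unfold dbar
  rw [h']
  -- Complex linearity of the derivative of `L` makes the two terms that differentiate `L` cancel,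
  -- as `I² = -1`.
  have hI : fderiv ℂ L y Complex.I = Complex.I • fderiv ℂ L y 1 := by
    rw [← ContinuousLinearMap.map_smul, smul_eq_mul, mul_one]
  change L y (fderiv ℝ u y 1) + fderiv ℂ L y 1 (u y)
    + Complex.I • (L y (fderiv ℝ u y Complex.I) + fderiv ℂ L y Complex.I (u y)) = _
  rw [hI, smul_apply, map_add, map_smul, smul_add, smul_smul, Complex.I_mul_I]
  module

end CauchyRiemann

end AssocDef
namespace AssocDef

/-! ### Holomorphic curves and vector fields along them, in charts. -/

section ComplexManifold

variable {W : Type*} [NormedAddCommGroup W] [NormedSpace ℂ W] [NormedSpace ℝ W]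
  [IsScalarTower ℝ ℂ W] {V : Type*} [TopologicalSpace V] [ChartedSpace W V]
  [IsManifold 𝓘(ℂ, W) ∞ V]

theorem hasFDerivAt_chart_trans {x y z : V} (hx : z ∈ (chartAt W x).source)
    (hy : z ∈ (chartAt W y).source) :
    HasFDerivAt (fun w => chartAt W y ((chartAt W x).symm w)) (tangentCoordChange 𝓘(ℂ, W) x y z)
      (chartAt W x z) := by
  have h := hasFDerivWithinAt_tangentCoordChange (I := 𝓘(ℂ, W)) (x := x) (y := y) (z := z)
    (by simpa using ⟨hx, hy⟩)
  rw [ModelWithCorners.range_eq_univ, hasFDerivWithinAt_univ] at h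
  exact h

/-- Both sides are the derivative of the same transition map, once over `ℝ` and once over `ℂ`.
Through this lemma complex linearity is available for the real tangent bundle. -/
theorem tangentCoordChange_real {x y z : V} (hx : z ∈ (chartAt W x).source)
    (hy : z ∈ (chartAt W y).source) :
    tangentCoordChange 𝓘(ℝ, W) x y z = (tangentCoordChange 𝓘(ℂ, W) x y z).restrictScalars ℝ := by
  have h := hasFDerivWithinAt_tangentCoordChange (I := 𝓘(ℝ, W)) (x := x) (y := y) (z := z)
    (by simpa using ⟨hx, hy⟩)
  rw [ModelWithCorners.range_eq_univ, hasFDerivWithinAt_univ] at h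
  exact h.unique ((hasFDerivAt_chart_trans hx hy).restrictScalars ℝ)

theorem contDiffOn_chart_trans (x y : V) :
    ContDiffOn ℂ ∞ (fun w => chartAt W y ((chartAt W x).symm w))
      ((chartAt W x).target ∩ (chartAt W x).symm ⁻¹' (chartAt W y).source) := by
  rw [← contMDiffOn_iff_contDiffOn]
  refine (contMDiffOn_extChartAt (I := 𝓘(ℂ, W)) (x := y)).comp
    ((contMDiffOn_extChartAt_symm (I := 𝓘(ℂ, W)) x).mono ?_) ?_
  · intro w hw
    simpa using hw.1
  · intro w hw
    exact hw.2

variable {C : Type*} [TopologicalSpace C] [ChartedSpace ℂ C]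

variable (W) in
/-- The curve `f` in the preferred charts at `p` and `q`. -/
def curveRep (f : C → V) (p : C) (q : V) (y : ℂ) : W :=
  chartAt W q (f ((chartAt ℂ p).symm y))

/-- The vector field `v` along the curve `f` in the preferred charts at `p` and `q`. -/
def fieldRep (f : C → V) (v : ∀ x : C, TangentSpace 𝓘(ℝ, W) (f x)) (p : C) (q : V) (y : ℂ) : W :=
  chartRep f v q ((chartAt ℂ p).symm y)

variable (W) in
/-- The part of the chart at `p` that `f` maps to the chart at `q`. -/
def curveDomain (f : C → V) (p : C) (q : V) : Set ℂ :=
  (chartAt ℂ p).target ∩ (chartAt ℂ p).symm ⁻¹' (f ⁻¹' (chartAt W q).source)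

variable (W) in
/-- The complex derivative of the curve, in the preferred charts. -/
def curveDeriv (f : C → V) (x : C) : W := deriv (curveRep W f x (f x)) (chartAt ℂ x x)

/-- The Cauchy-Riemann operator on vector fields along the curve, in the preferred charts. -/
def dbarField (f : C → V) (v : ∀ x : C, TangentSpace 𝓘(ℝ, W) (f x)) (x : C) : W :=
  dbar (fieldRep f v x (f x)) (chartAt ℂ x x)

theorem isOpen_curveDomain {f : C → V} (hf : Continuous f) (p : C) (q : V) :
    IsOpen (curveDomain W f p q) :=
  (chartAt ℂ p).isOpen_inter_preimage_symm ((chartAt W q).open_source.preimage hf)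

theorem mem_curveDomain {f : C → V} {p x : C} {q : V} (hx : x ∈ (chartAt ℂ p).source)
    (hq : f x ∈ (chartAt W q).source) : chartAt ℂ p x ∈ curveDomain W f p q := by
  refine ⟨(chartAt ℂ p).map_source hx, ?_⟩
  simpa [(chartAt ℂ p).left_inv hx] using hq

variable [IsManifold 𝓘(ℂ, ℂ) ∞ C]

theorem contDiffOn_curveRep {f : C → V} (hf : ContMDiff 𝓘(ℂ, ℂ) 𝓘(ℂ, W) ∞ f) (p : C) (q : V) :
    ContDiffOn ℂ ∞ (curveRep W f p q) (curveDomain W f p q) := by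
  rw [← contMDiffOn_iff_contDiffOn]
  refine (contMDiffOn_extChartAt (I := 𝓘(ℂ, W)) (x := q)).comp
    (hf.comp_contMDiffOn ((contMDiffOn_extChartAt_symm (I := 𝓘(ℂ, ℂ)) p).mono ?_)) ?_
  · intro w hw
    simpa using hw.1
  · intro w hw
    exact hw.2

theorem contMDiff_real {f : C → V} (hf : ContMDiff 𝓘(ℂ, ℂ) 𝓘(ℂ, W) ∞ f) :
    ContMDiff 𝓘(ℝ, ℂ) 𝓘(ℝ, W) ∞ f := by
  rw [contMDiff_iff] at hf ⊢
  exact ⟨hf.1, fun x y => (hf.2 x y).restrict_scalars ℝ⟩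

theorem contDiffOn_fieldRep {f : C → V} {v : ∀ x : C, TangentSpace 𝓘(ℝ, W) (f x)}
    (hv : ContMDiff 𝓘(ℝ, ℂ) 𝓘(ℝ, W).tangent ∞ (fun x : C => (⟨f x, v x⟩ : TangentBundle 𝓘(ℝ, W) V)))
    (p : C) (q : V) : ContDiffOn ℝ ∞ (fieldRep f v p q) (curveDomain W f p q) := by
  rw [← contMDiffOn_iff_contDiffOn]
  refine (contMDiffOn_chartRep hv q).comp
    ((contMDiffOn_extChartAt_symm (I := 𝓘(ℝ, ℂ)) p).mono ?_) ?_
  · intro w hw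
    simpa using hw.1
  · intro w hw
    exact hw.2

theorem differentiableAt_curveRep {f : C → V} (hf : ContMDiff 𝓘(ℂ, ℂ) 𝓘(ℂ, W) ∞ f) {p : C} {q : V}
    {y : ℂ} (hy : y ∈ curveDomain W f p q) : DifferentiableAt ℂ (curveRep W f p q) y :=
  ((contDiffOn_curveRep hf p q).differentiableOn (by simp)).differentiableAt
    ((isOpen_curveDomain hf.continuous p q).mem_nhds hy)

theorem mfderiv_curve {f : C → V} (hf : ContMDiff 𝓘(ℂ, ℂ) 𝓘(ℂ, W) ∞ f) (x : C) (a : ℂ) :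
    (mfderiv 𝓘(ℂ, ℂ) 𝓘(ℂ, W) f x : ℂ →L[ℂ] W) a = a • curveDeriv W f x := by
  have h1 : (mfderiv 𝓘(ℂ, ℂ) 𝓘(ℂ, W) f x : ℂ →L[ℂ] W) = _ :=
    (hf.mdifferentiable (by simp) x).mfderiv
  rw [h1, ModelWithCorners.range_eq_univ, fderivWithin_univ]
  change fderiv ℂ (curveRep W f x (f x)) (chartAt ℂ x x) a = _
  rw [curveDeriv, ← fderiv_apply_one_eq_deriv, ← ContinuousLinearMap.map_smul, smul_eq_mul, mul_one]

theorem mfderiv_curve_real {f : C → V} (hf : ContMDiff 𝓘(ℂ, ℂ) 𝓘(ℂ, W) ∞ f) (x : C) (a : ℂ) :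
    (mfderiv 𝓘(ℝ, ℂ) 𝓘(ℝ, W) f x : ℂ →L[ℝ] W) a = a • curveDeriv W f x := by
  have h1 : (mfderiv 𝓘(ℝ, ℂ) 𝓘(ℝ, W) f x : ℂ →L[ℝ] W) = _ :=
    ((contMDiff_real hf).mdifferentiable (by simp) x).mfderiv
  rw [h1, ModelWithCorners.range_eq_univ, fderivWithin_univ]
  change fderiv ℝ (curveRep W f x (f x)) (chartAt ℂ x x) a = _
  exact (differentiableAt_curveRep hf (mem_curveDomain (mem_chart_source ℂ x)
    (mem_chart_source W (f x)))).fderiv_real a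

/-- The derivative at `x` of the change from the chart at `p` to the preferred chart. -/
def chartFactor (p x : C) : ℂ := tangentCoordChange 𝓘(ℂ, ℂ) p x x 1

theorem hasDerivAt_chart_trans {p x : C} (hx : x ∈ (chartAt ℂ p).source) :
    HasDerivAt (fun w => chartAt ℂ x ((chartAt ℂ p).symm w)) (chartFactor p x) (chartAt ℂ p x) :=
  (hasFDerivAt_chart_trans (W := ℂ) hx (mem_chart_source ℂ x)).hasDerivAt

theorem chartFactor_ne_zero {p x : C} (hx : x ∈ (chartAt ℂ p).source) : chartFactor p x ≠ 0 := by
  intro h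
  have h1 := tangentCoordChange_comp (I := 𝓘(ℂ, ℂ)) (w := p) (x := x) (y := p) (z := x) (v := 1)
    (by simpa using hx)
  rw [tangentCoordChange_self (by simpa using hx)] at h1
  change tangentCoordChange 𝓘(ℂ, ℂ) x p x (chartFactor p x) = 1 at h1
  rw [h, map_zero] at h1
  exact zero_ne_one h1

/-- Chain rule: near `x`, the curve in the charts at `p` and `q` factors through the preferred
charts at `x` and `f x`. It relates `curveDeriv`, which uses a different chart at each point, to one
function that can be differentiated again. -/
theorem deriv_curveRep {f : C → V} (hf : ContMDiff 𝓘(ℂ, ℂ) 𝓘(ℂ, W) ∞ f) {p x : C} {q : V}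
    (hx : x ∈ (chartAt ℂ p).source) (hq : f x ∈ (chartAt W q).source) :
    deriv (curveRep W f p q) (chartAt ℂ p x)
      = chartFactor p x • tangentCoordChange 𝓘(ℂ, W) (f x) q (f x) (curveDeriv W f x) := by
  have h1 := hasDerivAt_chart_trans hx
  have h2 : HasDerivAt (curveRep W f x (f x)) (curveDeriv W f x)
      (chartAt ℂ x ((chartAt ℂ p).symm (chartAt ℂ p x))) := by
    rw [(chartAt ℂ p).left_inv hx]
    exact (differentiableAt_curveRep hf (mem_curveDomain (mem_chart_source ℂ x)
      (mem_chart_source W (f x)))).hasDerivAt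
  have h3 : HasFDerivAt (fun w => chartAt W q ((chartAt W (f x)).symm w))
      (tangentCoordChange 𝓘(ℂ, W) (f x) q (f x)) (curveRep W f x (f x)
        (chartAt ℂ x ((chartAt ℂ p).symm (chartAt ℂ p x)))) := by
    have := hasFDerivAt_chart_trans (mem_chart_source W (f x)) hq
    convert this using 1
    simp [curveRep, (chartAt ℂ p).left_inv hx]
  have h4 := h3.comp_hasDerivAt (chartAt ℂ p x) (f := curveRep W f x (f x) ∘
    fun w => chartAt ℂ x ((chartAt ℂ p).symm w))
    (h2.scomp (chartAt ℂ p x) (h := fun w => chartAt ℂ x ((chartAt ℂ p).symm w)) h1)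
  have h5 : curveRep W f p q =ᶠ[nhds (chartAt ℂ p x)]
      (fun w => chartAt W q ((chartAt W (f x)).symm w)) ∘ curveRep W f x (f x) ∘
        fun w => chartAt ℂ x ((chartAt ℂ p).symm w) := by
    have hU : curveDomain W f p (f x) ∩ ((chartAt ℂ p).target ∩ (chartAt ℂ p).symm ⁻¹'
        (chartAt ℂ x).source) ∈ nhds (chartAt ℂ p x) := by
      refine ((isOpen_curveDomain hf.continuous p (f x)).inter
        ((chartAt ℂ p).isOpen_inter_preimage_symm (chartAt ℂ x).open_source)).mem_nhds
        ⟨mem_curveDomain hx (mem_chart_source W (f x)), (chartAt ℂ p).map_source hx, ?_⟩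
      simp [(chartAt ℂ p).left_inv hx]
    filter_upwards [hU] with y hy
    simp only [curveRep, Function.comp_apply]
    rw [(chartAt ℂ x).left_inv hy.2.2, (chartAt W (f x)).left_inv hy.1.2]
  rw [h5.deriv_eq, h4.deriv, map_smul]

/-- The Cauchy-Riemann operator on vector fields along a holomorphic curve is compatible with
holomorphic changes of charts. -/
theorem dbar_fieldRep {f : C → V} (hf : ContMDiff 𝓘(ℂ, ℂ) 𝓘(ℂ, W) ∞ f)
    {v : ∀ x : C, TangentSpace 𝓘(ℝ, W) (f x)} {p x : C} {q : V}
    (hv : DifferentiableAt ℝ (fieldRep f v x (f x)) (chartAt ℂ x x))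
    (hx : x ∈ (chartAt ℂ p).source) (hq : f x ∈ (chartAt W q).source) :
    dbar (fieldRep f v p q) (chartAt ℂ p x)
      = starRingEnd ℂ (chartFactor p x) •
        tangentCoordChange 𝓘(ℂ, W) (f x) q (f x) (dbarField f v x) := by
  let τ : ℂ → ℂ := fun w => chartAt ℂ x ((chartAt ℂ p).symm w)
  let σ : W → W := fun w => chartAt W q ((chartAt W (f x)).symm w)
  let S : Set W := (chartAt W (f x)).target ∩ (chartAt W (f x)).symm ⁻¹' (chartAt W q).source
  have hτx : τ (chartAt ℂ p x) = chartAt ℂ x x := by simp [τ, (chartAt ℂ p).left_inv hx]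
  have hτ := hasDerivAt_chart_trans hx
  have hS : IsOpen S := (chartAt W (f x)).isOpen_inter_preimage_symm (chartAt W q).open_source
  have hxS : chartAt W (f x) (f x) ∈ S := by
    refine ⟨(chartAt W (f x)).map_source (mem_chart_source W (f x)), ?_⟩
    simpa using hq
  have hrep : curveRep W f p (f x) (chartAt ℂ p x) = chartAt W (f x) (f x) := by
    simp [curveRep, (chartAt ℂ p).left_inv hx]
  have hσ : DifferentiableAt ℂ (fderiv ℂ σ) (chartAt W (f x) (f x)) := by
    have h1 : ContDiffOn ℂ ∞ (fderiv ℂ σ) S :=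
      (contDiffOn_chart_trans (f x) q).fderiv_of_isOpen hS (by simp)
    exact (h1.differentiableOn (by simp)).differentiableAt (hS.mem_nhds hxS)
  have hL : DifferentiableAt ℂ (fun y => fderiv ℂ σ (curveRep W f p (f x) y)) (chartAt ℂ p x) := by
    refine DifferentiableAt.comp (chartAt ℂ p x) (g := fderiv ℂ σ) ?_
      (differentiableAt_curveRep hf (mem_curveDomain hx (mem_chart_source W (f x))))
    rw [hrep]
    exact hσ
  have hu : DifferentiableAt ℝ (fieldRep f v x (f x) ∘ τ) (chartAt ℂ p x) := by
    refine DifferentiableAt.comp (chartAt ℂ p x) ?_ (hτ.differentiableAt.restrictScalars ℝ)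
    rw [hτx]
    exact hv
  have hU : curveDomain W f p (f x) ∩ (curveDomain W f p q ∩ ((chartAt ℂ p).target ∩
      (chartAt ℂ p).symm ⁻¹' (chartAt ℂ x).source)) ∈ nhds (chartAt ℂ p x) := by
    refine ((isOpen_curveDomain hf.continuous p (f x)).inter
      ((isOpen_curveDomain hf.continuous p q).inter
      ((chartAt ℂ p).isOpen_inter_preimage_symm (chartAt ℂ x).open_source))).mem_nhds
      ⟨mem_curveDomain hx (mem_chart_source W (f x)), mem_curveDomain hx hq,
        (chartAt ℂ p).map_source hx, ?_⟩
    simp [(chartAt ℂ p).left_inv hx]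
  -- The components in the two target charts differ by the derivative of the transition map along
  -- the curve, a holomorphic family of linear maps because the curve is holomorphic; such a family
  -- passes through `∂̄`.
  have key : fieldRep f v p q =ᶠ[nhds (chartAt ℂ p x)]
      fun y => fderiv ℂ σ (curveRep W f p (f x) y) ((fieldRep f v x (f x) ∘ τ) y) := by
    filter_upwards [hU] with y hy
    set z : C := (chartAt ℂ p).symm y with hz
    have hz1 : f z ∈ (chartAt W (f x)).source := hy.1.2
    have hz2 : f z ∈ (chartAt W q).source := hy.2.1.2
    have hz3 : (chartAt ℂ x).symm (τ y) = z := (chartAt ℂ x).left_inv hy.2.2.2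
    have h1 : fderiv ℂ σ (curveRep W f p (f x) y) = tangentCoordChange 𝓘(ℂ, W) (f x) q (f z) :=
      (hasFDerivAt_chart_trans hz1 hz2).fderiv
    have h2 : (fieldRep f v x (f x) ∘ τ) y = chartRep f v (f x) z := by
      simp only [fieldRep, Function.comp_apply]
      rw [hz3]
    have h3 : ∀ w, tangentCoordChange 𝓘(ℂ, W) (f x) q (f z) w
        = tangentCoordChange 𝓘(ℝ, W) (f x) q (f z) w := by
      intro w
      rw [tangentCoordChange_real hz1 hz2]
      rfl
    rw [h1, h2, h3]
    change tangentCoordChange 𝓘(ℝ, W) (f z) q (f z) (v z)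
      = tangentCoordChange 𝓘(ℝ, W) (f x) q (f z)
        (tangentCoordChange 𝓘(ℝ, W) (f z) (f x) (f z) (v z))
    exact (tangentCoordChange_comp (by simpa using ⟨hz1, hz2⟩)).symm
  have hv' : DifferentiableAt ℝ (fieldRep f v x (f x)) (τ (chartAt ℂ p x)) := by rwa [hτx]
  rw [dbar_congr key, dbar_clm_apply hL hu, dbar_comp (τ := τ) hv' hτ.differentiableAt,
    hτ.deriv, hτx, hrep, map_smul]
  rw [(hasFDerivAt_chart_trans (mem_chart_source W (f x)) hq).fderiv]
  rfl

end ComplexManifold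

end AssocDef
namespace AssocDef

/-! ### Christoffel symbols of a metric on an open set of a vector space. -/

section Christoffel

variable {E : Type*} [NormedAddCommGroup E] [NormedSpace ℝ E] [FiniteDimensional ℝ E]
  {G : E → E →L[ℝ] E →L[ℝ] ℝ} {y : E}

theorem apply_christoffel (hG : ∀ v, v ≠ 0 → 0 < G y v v) (u v w : E) :
    G y (christoffel G y u v) w
      = 2⁻¹ * (fderiv ℝ G y u v w + fderiv ℝ G y v u w - fderiv ℝ G y w u v) := by
  unfold christoffel
  rw [map_smul, apply_inverse_of_pos _ hG]
  rfl

theorem fderiv_bilin_apply (hd : DifferentiableAt ℝ G y) (u v w : E) :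
    fderiv ℝ G y w u v = fderiv ℝ (fun z => G z u v) y w := by
  have h1 := (hd.hasFDerivAt.clm_apply (hasFDerivAt_const u y)).clm_apply (hasFDerivAt_const v y)
  rw [h1.fderiv]
  simp

theorem fderiv_bilin_symm (hd : DifferentiableAt ℝ G y) (hs : ∀ᶠ z in nhds y, ∀ u v, G z u v = G z v u)
    (u v w : E) : fderiv ℝ G y w u v = fderiv ℝ G y w v u := by
  rw [fderiv_bilin_apply hd, fderiv_bilin_apply hd]
  have : (fun z => G z u v) =ᶠ[nhds y] fun z => G z v u := hs.mono fun z hz => hz u v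
  rw [this.fderiv_eq]

theorem eq_of_apply_eq (hG : ∀ v, v ≠ 0 → 0 < G y v v) {u v : E} (h : ∀ w, G y u w = G y v w) :
    u = v := by
  by_contra hne
  have h1 := hG (u - v) (sub_ne_zero.2 hne)
  rw [map_sub (G y), sub_apply, h, sub_self] at h1
  exact lt_irrefl _ h1

theorem christoffel_symm (hG : ∀ v, v ≠ 0 → 0 < G y v v) (hd : DifferentiableAt ℝ G y)
    (hs : ∀ᶠ z in nhds y, ∀ u v, G z u v = G z v u) (u v : E) :
    christoffel G y u v = christoffel G y v u := by
  refine eq_of_apply_eq hG fun w => ?_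
  rw [apply_christoffel hG, apply_christoffel hG, fderiv_bilin_symm hd hs u v]
  ring

/-- Metric compatibility: in the sum of the two Koszul formulas, four of the six derivatives cancel
by symmetry of `G`. -/
theorem fderiv_eq_christoffel (hG : ∀ v, v ≠ 0 → 0 < G y v v) (hd : DifferentiableAt ℝ G y)
    (hs : ∀ᶠ z in nhds y, ∀ u v, G z u v = G z v u) (u v w : E) :
    fderiv ℝ G y u v w = G y (christoffel G y u v) w + G y v (christoffel G y u w) := by
  rw [hs.self_of_nhds v, apply_christoffel hG, apply_christoffel hG,
    fderiv_bilin_symm hd hs w v u, fderiv_bilin_symm hd hs u w v, fderiv_bilin_symm hd hs u v w]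
  ring

theorem christoffel_add_left (hG : ∀ v, v ≠ 0 → 0 < G y v v) (u u' v : E) :
    christoffel G y (u + u') v = christoffel G y u v + christoffel G y u' v := by
  refine eq_of_apply_eq hG fun w => ?_
  simp only [map_add, add_apply, apply_christoffel hG]
  ring

theorem christoffel_smul_left (hG : ∀ v, v ≠ 0 → 0 < G y v v) (c : ℝ) (u v : E) :
    christoffel G y (c • u) v = c • christoffel G y u v := by
  refine eq_of_apply_eq hG fun w => ?_
  simp only [map_smul, smul_apply, apply_christoffel hG, smul_eq_mul]
  ring

end Christoffel

/-! ### Consequences of parallel `ω` and `Ω` for the Levi-Civita connection. -/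

section Kahler

variable {V : Type*} [TopologicalSpace V] [ChartedSpace C3 V] [IsManifold 𝓘(ℂ, C3) ∞ V]

namespace CalabiYau

variable (X : CalabiYau V)

/-- The metric, as a bilinear form on the model space. -/
def form (x : V) : C3 →L[ℝ] C3 →L[ℝ] ℝ := X.g x

/-- The complex volume form, as a form on the model space. -/
def vol (x : V) : C3 [⋀^Fin 3]→L[ℂ] ℂ := X.Ω x

theorem isSU3 (x : V) : IsSU3 (X.form x) (X.vol x) := X.frame x

theorem form_pos (x : V) (v : C3) (hv : v ≠ 0) : 0 < X.form x v v := (X.isSU3 x).pos v hv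

/-- The metric in the preferred chart at `p`. -/
def chartForm (p : V) : C3 → C3 →L[ℝ] C3 →L[ℝ] ℝ := bilinInChart X.g p

theorem chartForm_self (p : V) : X.chartForm p (chartAt C3 p p) = X.form p :=
  bilinInChart_self X.g p

theorem contDiffOn_chartForm (p : V) :
    ContDiffOn ℝ ∞ (X.chartForm p) (chartAt C3 p).target := by
  have := contDiffOn_bilinInChart X.metric p
  rwa [extChartAt_target, modelWithCornersSelf_coe_symm, modelWithCornersSelf_coe, Set.range_id,
    Set.preimage_id, Set.inter_univ] at this

theorem target_mem_nhds (p : V) : (chartAt C3 p).target ∈ nhds (chartAt C3 p p) :=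
  (chartAt C3 p).open_target.mem_nhds ((chartAt C3 p).map_source (mem_chart_source C3 p))

theorem differentiableAt_chartForm (p : V) :
    DifferentiableAt ℝ (X.chartForm p) (chartAt C3 p p) :=
  ((X.contDiffOn_chartForm p).differentiableOn (by simp)).differentiableAt (target_mem_nhds p)

theorem chartForm_symm (p : V) (y u v : C3) : X.chartForm p y u v = X.chartForm p y v u :=
  X.metric.symm _ _ _

theorem chartForm_pos (p : V) (v : C3) (hv : v ≠ 0) :
    0 < X.chartForm p (chartAt C3 p p) v v := by
  rw [chartForm_self]
  exact X.form_pos p v hv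

/-- The Christoffel symbols at `p`, in the preferred chart at `p`. -/
def Γ (p : V) (u v : C3) : C3 := christoffel (X.chartForm p) (chartAt C3 p p) u v

theorem Γ_symm (p : V) (u v : C3) : X.Γ p u v = X.Γ p v u :=
  christoffel_symm (X.chartForm_pos p) (X.differentiableAt_chartForm p)
    (Filter.Eventually.of_forall (X.chartForm_symm p)) u v

theorem fderiv_chartForm (p : V) (u v w : C3) :
    fderiv ℝ (X.chartForm p) (chartAt C3 p p) u v w
      = X.form p (X.Γ p u v) w + X.form p v (X.Γ p u w) := by
  rw [fderiv_eq_christoffel (X.chartForm_pos p) (X.differentiableAt_chartForm p)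
    (Filter.Eventually.of_forall (X.chartForm_symm p)), chartForm_self]
  rfl

/-- Coordinate changes are complex linear, so in a chart the complex structure is the constant
multiplication by `i`. -/
theorem bilinInChart_kahler {p : V} {y : C3} (hy : y ∈ (chartAt C3 p).target) (u v : C3) :
    bilinInChart (kahlerForm X.g) p y u v = X.chartForm p y (Complex.I • u) v := by
  set q : V := (chartAt C3 p).symm y with hq
  have hqp : q ∈ (chartAt C3 p).source := (chartAt C3 p).map_target hy
  have h := tangentCoordChange_real hqp (mem_chart_source C3 q)
  change X.form q (Complex.I • tangentCoordChange 𝓘(ℝ, C3) p q q u)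
      (tangentCoordChange 𝓘(ℝ, C3) p q q v)
    = X.form q (tangentCoordChange 𝓘(ℝ, C3) p q q (Complex.I • u))
      (tangentCoordChange 𝓘(ℝ, C3) p q q v)
  rw [h]
  congr 2
  exact (map_smul (tangentCoordChange 𝓘(ℂ, C3) p q q) Complex.I u).symm

/-- Comparing `∇ω = 0` with `∇g = 0` gives `∇I = 0`; as `I` is constant in the chart, this says that
`Γ(u, ·)` commutes with it. -/
theorem Γ_I_right (p : V) (u v : C3) : X.Γ p u (Complex.I • v) = Complex.I • X.Γ p u v := by
  have hK : ∀ a b : C3, (fun z => bilinInChart (kahlerForm X.g) p z a b)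
      =ᶠ[nhds (chartAt C3 p p)] fun z => X.chartForm p z (Complex.I • a) b := fun a b => by
    filter_upwards [target_mem_nhds p] with z hz using X.bilinInChart_kahler hz a b
  have hdiff : DifferentiableAt ℝ (bilinInChart (kahlerForm X.g) p) (chartAt C3 p p) := by
    let m : C3 →L[ℝ] C3 := Complex.I • ContinuousLinearMap.id ℝ C3
    have h1 : bilinInChart (kahlerForm X.g) p =ᶠ[nhds (chartAt C3 p p)]
        fun z => (X.chartForm p z).comp m := by
      filter_upwards [target_mem_nhds p] with z hz
      ext a b
      exact X.bilinInChart_kahler hz a b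
    refine DifferentiableAt.congr_of_eventuallyEq ?_ h1
    exact (X.differentiableAt_chartForm p).clm_comp (differentiableAt_const m)
  refine eq_of_apply_eq (G := X.chartForm p) (X.chartForm_pos p) fun w => ?_
  have h2 := X.parallel_ω p u v w
  have h3 : fderiv ℝ (bilinInChart (kahlerForm X.g) p) (chartAt C3 p p) u v w
      = X.form p (Complex.I • X.Γ p u v) w + X.form p (Complex.I • v) (X.Γ p u w) := h2
  rw [fderiv_bilin_apply hdiff, (hK v w).fderiv_eq,
    ← fderiv_bilin_apply (X.differentiableAt_chartForm p), fderiv_chartForm] at h3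
  rw [chartForm_self]
  linarith

theorem Γ_I_left (p : V) (u v : C3) : X.Γ p (Complex.I • u) v = Complex.I • X.Γ p u v := by
  rw [Γ_symm, Γ_I_right, Γ_symm]

theorem vol_eq_volInChart {p q : V} (hq : q ∈ (chartAt C3 p).source) (a : Fin 3 → C3) :
    X.vol q a = volInChart X.Ω p (chartAt C3 p q)
      (fun i => tangentCoordChange 𝓘(ℂ, C3) q p q (a i)) := by
  have hq' : q ∈ (extChartAt 𝓘(ℂ, C3) p).source := by rwa [extChartAt_source]
  have hqq : q ∈ (extChartAt 𝓘(ℂ, C3) q).source := mem_extChartAt_source q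
  have key : ∀ q' : V, q' = q → X.vol q a = X.vol q' (fun i =>
      tangentCoordChange 𝓘(ℂ, C3) p q' q' (tangentCoordChange 𝓘(ℂ, C3) q p q (a i))) := by
    rintro _ rfl
    congr 1
    funext i
    rw [tangentCoordChange_comp ⟨⟨hqq, hq'⟩, hqq⟩, tangentCoordChange_self hqq]
  exact key _ ((extChartAt 𝓘(ℂ, C3) p).left_inv hq')

theorem volInChart_self (p : V) : volInChart X.Ω p (chartAt C3 p p) = X.vol p := by
  ext a
  rw [X.vol_eq_volInChart (mem_chart_source C3 p)]
  congr 1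
  funext i
  exact (tangentCoordChange_self (mem_extChartAt_source p)).symm

theorem form_eq_chartForm {p q : V} (hq : q ∈ (chartAt C3 p).source) (u v : C3) :
    X.form q u v = X.chartForm p (chartAt C3 p q) (tangentCoordChange 𝓘(ℝ, C3) q p q u)
      (tangentCoordChange 𝓘(ℝ, C3) q p q v) :=
  apply_eq_bilinInChart X.g hq u v

theorem contDiffOn_volInChart (p : V) :
    ContDiffOn ℝ ∞ (volInChart X.Ω p) (chartAt C3 p).target := by
  have := X.smooth_Ω p
  rwa [extChartAt_target, modelWithCornersSelf_coe_symm, modelWithCornersSelf_coe, Set.range_id,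
    Set.preimage_id, Set.inter_univ] at this

theorem differentiableAt_volInChart (p : V) :
    DifferentiableAt ℝ (volInChart X.Ω p) (chartAt C3 p p) :=
  ((X.contDiffOn_volInChart p).differentiableOn (by simp)).differentiableAt (target_mem_nhds p)

/-- `∇Ω = 0` expresses the derivative of the coefficients through `Γ(u, ·)`, which is complex linear
in `u`. Hence the coefficients of `Ω` satisfy the Cauchy-Riemann equations at the centre of the
chart, which is the holomorphy needed for Stokes. -/
theorem fderiv_volInChart_I (p : V) (u : C3) :
    fderiv ℝ (volInChart X.Ω p) (chartAt C3 p p) (Complex.I • u)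
      = Complex.I • fderiv ℝ (volInChart X.Ω p) (chartAt C3 p p) u := by
  have h : ∀ (u : C3) (a : Fin 3 → C3), fderiv ℝ (volInChart X.Ω p) (chartAt C3 p p) u a
      = ∑ i, X.vol p (Function.update a i (X.Γ p u (a i))) := X.parallel_Ω p
  ext a
  rw [h]
  change _ = Complex.I • fderiv ℝ (volInChart X.Ω p) (chartAt C3 p p) u a
  rw [h, Finset.smul_sum]
  refine Finset.sum_congr rfl fun i _ => ?_
  rw [Γ_I_left]
  exact (X.vol p).toMultilinearMap.map_update_smul a i Complex.I _

variable {C : Type*} [TopologicalSpace C] [ChartedSpace ℂ C] [IsManifold 𝓘(ℂ, ℂ) ∞ C]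
  {f : C → V}

theorem dbar_volInChart (hf : ContMDiff 𝓘(ℂ, ℂ) 𝓘(ℂ, C3) ∞ f) {p x : C}
    (hx : x ∈ (chartAt ℂ p).source) :
    DifferentiableAt ℝ (fun y => volInChart X.Ω (f x) (curveRep C3 f p (f x) y)) (chartAt ℂ p x) ∧
    dbar (fun y => volInChart X.Ω (f x) (curveRep C3 f p (f x) y)) (chartAt ℂ p x) = 0 := by
  have hrep : curveRep C3 f p (f x) (chartAt ℂ p x) = chartAt C3 (f x) (f x) := by
    simp [curveRep, (chartAt ℂ p).left_inv hx]
  have h1 : DifferentiableAt ℝ (volInChart X.Ω (f x)) (curveRep C3 f p (f x) (chartAt ℂ p x)) := by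
    rw [hrep]; exact X.differentiableAt_volInChart (f x)
  have h2 := differentiableAt_curveRep hf (mem_curveDomain hx (mem_chart_source C3 (f x)))
  refine ⟨h1.comp (chartAt ℂ p x) (h2.restrictScalars ℝ), ?_⟩
  have h3 := fderiv_comp (chartAt ℂ p x) h1 (h2.restrictScalars ℝ)
  have h4 : fderiv ℝ (fun y => volInChart X.Ω (f x) (curveRep C3 f p (f x) y)) (chartAt ℂ p x) = _ :=
    h3
  unfold dbar
  rw [h4]
  simp only [ContinuousLinearMap.comp_apply]
  rw [h2.fderiv_real, h2.fderiv_real, hrep, one_smul, fderiv_volInChart_I, smul_smul,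
    Complex.I_mul_I]
  exact (congrArg (_ + ·) (neg_one_smul ℂ _)).trans (add_neg_cancel _)

omit [IsManifold 𝓘(ℂ, ℂ) ∞ C] in
theorem mfderiv_chartRep {v : ∀ x : C, TangentSpace 𝓘(ℝ, C3) (f x)} (x : C)
    (hv : MDifferentiableAt 𝓘(ℝ, ℂ) 𝓘(ℝ, C3) (chartRep f v (f x)) x) (a : ℂ) :
    (mfderiv 𝓘(ℝ, ℂ) 𝓘(ℝ, C3) (chartRep f v (f x)) x : ℂ →L[ℝ] C3) a
      = fderiv ℝ (fieldRep f v x (f x)) (chartAt ℂ x x) a := by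
  have h1 : (mfderiv 𝓘(ℝ, ℂ) 𝓘(ℝ, C3) (chartRep f v (f x)) x : ℂ →L[ℝ] C3) = _ := hv.mfderiv
  rw [h1, ModelWithCorners.range_eq_univ, fderivWithin_univ]
  rfl

/-- The Levi-Civita covariant derivative along the curve, with values in the model space. -/
def cov (f : C → V) (v : ∀ x : C, TangentSpace 𝓘(ℝ, C3) (f x)) (x : C) (a : ℂ) : C3 :=
  covDeriv (J := 𝓘(ℝ, ℂ)) X.g f v x a

/-- The value of a vector field along `f`, in the model space. -/
def fieldVal (f : C → V) (v : ∀ x : C, TangentSpace 𝓘(ℝ, C3) (f x)) (x : C) : C3 := v x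

theorem cov_eq (hf : ContMDiff 𝓘(ℂ, ℂ) 𝓘(ℂ, C3) ∞ f)
    {v : ∀ x : C, TangentSpace 𝓘(ℝ, C3) (f x)} {x : C}
    (hv : MDifferentiableAt 𝓘(ℝ, ℂ) 𝓘(ℝ, C3) (chartRep f v (f x)) x) (a : ℂ) :
    X.cov f v x a = fderiv ℝ (fieldRep f v x (f x)) (chartAt ℂ x x) a
      + X.Γ (f x) (a • curveDeriv C3 f x) (fieldVal f v x) := by
  rw [← mfderiv_curve_real hf, ← mfderiv_chartRep x hv]
  rfl

/-- The Christoffel terms cancel: `Γ(I a F', v) = I Γ(a F', v)` and `I² = -1`. What remains is the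
conjugate-linear part of the coordinate derivative, so the metric disappears from the first-order
operator. -/
theorem cov_add_I (hf : ContMDiff 𝓘(ℂ, ℂ) 𝓘(ℂ, C3) ∞ f)
    {v : ∀ x : C, TangentSpace 𝓘(ℝ, C3) (f x)} {x : C}
    (hv : MDifferentiableAt 𝓘(ℝ, ℂ) 𝓘(ℝ, C3) (chartRep f v (f x)) x) (a : ℂ) :
    X.cov f v x a + Complex.I • X.cov f v x (Complex.I * a)
      = starRingEnd ℂ a • dbarField f v x := by
  rw [X.cov_eq hf hv a, X.cov_eq hf hv (Complex.I * a), mul_smul, Γ_I_left, smul_add,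
    smul_smul Complex.I Complex.I, Complex.I_mul_I, neg_one_smul, dbarField, dbar,
    ← antilinear_part_smul]
  abel

end CalabiYau

end Kahler

end AssocDef
namespace AssocDef

/-! ### The circle and its angular form. -/

section Circle

/-- The velocity of the angular parametrization of the circle. -/
def angularVelocity (t : ℝ) : EuclideanSpace ℝ (Fin 1) :=
  mfderiv 𝓘(ℝ, ℝ) (𝓡 1) Circle.exp t (1 : ℝ)

theorem contMDiff_circle_coe : ContMDiff (𝓡 1) 𝓘(ℝ, ℂ) ∞ (fun z : Circle => (z : ℂ)) := by
  have : Fact (Module.finrank ℝ ℂ = 1 + 1) := Complex.finrank_real_complex_fact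
  exact contMDiff_coe_sphere (E := ℂ) (n := 1)

/-- The inclusion of the circle in the plane, in the preferred chart at `z`. -/
def circleRep (z : Circle) (y : EuclideanSpace ℝ (Fin 1)) : ℂ :=
  ((extChartAt (𝓡 1) z).symm y : Circle)

theorem contDiffOn_circleRep (z : Circle) :
    ContDiffOn ℝ ∞ (circleRep z) (extChartAt (𝓡 1) z).target := by
  rw [← contMDiffOn_iff_contDiffOn]
  exact contMDiff_circle_coe.comp_contMDiffOn (contMDiffOn_extChartAt_symm z)

theorem dθ_apply (z : Circle) (e : EuclideanSpace ℝ (Fin 1)) :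
    (dθ z : EuclideanSpace ℝ (Fin 1) →L[ℝ] ℝ) e
      = (starRingEnd ℂ (z : ℂ) * fderiv ℝ (circleRep z) (extChartAt (𝓡 1) z z) e).im := by
  have h : (mfderiv (𝓡 1) 𝓘(ℝ, ℂ) (fun w : Circle => (w : ℂ)) z :
      EuclideanSpace ℝ (Fin 1) →L[ℝ] ℂ) = _ :=
    (contMDiff_circle_coe.mdifferentiable (by simp) z).mfderiv
  rw [ModelWithCorners.range_eq_univ, fderivWithin_univ] at h
  unfold dθ
  simp only
  rw [h]
  rfl

/-- Seen in the plane, the velocity of `t ↦ e^{it}` is `i e^{it}`, and multiplication by the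
conjugate of `e^{it}` leaves `i`. -/
theorem dθ_angularVelocity (t : ℝ) : dθ (Circle.exp t) (angularVelocity t) = 1 := by
  have h1 := mfderiv_comp t (contMDiff_circle_coe.mdifferentiable (by simp) (Circle.exp t))
    ((contMDiff_circleExp (m := ∞)).mdifferentiable (by simp) t)
  have h2 : HasFDerivAt (fun s : ℝ => Complex.exp (s * Complex.I))
      (ContinuousLinearMap.toSpanSingleton ℝ (Complex.exp (t * Complex.I) * Complex.I)) t := by
    have : HasDerivAt (fun s : ℝ => Complex.exp (s * Complex.I))
      (Complex.exp (t * Complex.I) * (1 * Complex.I)) t :=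
      ((Complex.ofRealCLM.hasDerivAt (x := t)).mul_const Complex.I).cexp
    rw [one_mul] at this
    exact this.hasFDerivAt
  have h3 : ((fun w : Circle => (w : ℂ)) ∘ Circle.exp) = fun s : ℝ => Complex.exp (s * Complex.I) := by
    funext s
    simp [Circle.coe_exp]
  rw [h3, mfderiv_eq_fderiv, h2.fderiv] at h1
  let D : EuclideanSpace ℝ (Fin 1) →L[ℝ] ℂ :=
    mfderiv (𝓡 1) 𝓘(ℝ, ℂ) (fun w : Circle => (w : ℂ)) (Circle.exp t)
  have h4 : Complex.exp (t * Complex.I) * Complex.I = D (angularVelocity t) := by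
    have := congrArg (fun L : ℝ →L[ℝ] ℂ => L 1) h1
    rw [ContinuousLinearMap.toSpanSingleton_apply, one_smul] at this
    exact this
  change (starRingEnd ℂ (Circle.exp t : ℂ) * D (angularVelocity t)).im = 1
  rw [← h4, Circle.coe_exp, ← mul_assoc, ← Complex.exp_conj, ← Complex.exp_add]
  simp

/-- `dθ_apply` uses a different chart at each point; here one smooth function `circleRep z`
describes `dθ` on the whole chart domain, as its differentiability requires. -/
theorem dθ_chart {z q : Circle} (hq : q ∈ (extChartAt (𝓡 1) z).source)
    (e : EuclideanSpace ℝ (Fin 1)) :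
    (dθ q : EuclideanSpace ℝ (Fin 1) →L[ℝ] ℝ) (tangentCoordChange (𝓡 1) z q q e)
      = (starRingEnd ℂ (q : ℂ) * fderiv ℝ (circleRep z) (extChartAt (𝓡 1) z q) e).im := by
  rw [dθ_apply]
  congr 2
  have h1 := hasFDerivWithinAt_tangentCoordChange (I := 𝓡 1) (x := z) (y := q) (z := q)
    ⟨hq, mem_extChartAt_source q⟩
  rw [ModelWithCorners.range_eq_univ, hasFDerivWithinAt_univ] at h1
  have h2 : HasFDerivAt (circleRep q) (fderiv ℝ (circleRep q) (extChartAt (𝓡 1) q q))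
      ((extChartAt (𝓡 1) q ∘ (extChartAt (𝓡 1) z).symm) (extChartAt (𝓡 1) z q)) := by
    rw [Function.comp_apply, (extChartAt (𝓡 1) z).left_inv hq]
    exact (((contDiffOn_circleRep q).differentiableOn (by simp)).differentiableAt
      ((isOpen_extChartAt_target q).mem_nhds (mem_extChartAt_target q))).hasFDerivAt
  have h3 := h2.comp (extChartAt (𝓡 1) z q) h1
  have h4 : circleRep z =ᶠ[nhds (extChartAt (𝓡 1) z q)]
      circleRep q ∘ (extChartAt (𝓡 1) q ∘ (extChartAt (𝓡 1) z).symm) := by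
    have hU := (continuousOn_extChartAt_symm (I := 𝓡 1) z).isOpen_inter_preimage
      (isOpen_extChartAt_target z) (isOpen_extChartAt_source (I := 𝓡 1) q)
    filter_upwards [hU.mem_nhds ⟨(extChartAt (𝓡 1) z).map_source hq, by
      rw [Set.mem_preimage, (extChartAt (𝓡 1) z).left_inv hq]
      exact mem_extChartAt_source q⟩] with y hy
    simp only [circleRep, Function.comp_apply]
    rw [(extChartAt (𝓡 1) q).left_inv hy.2]
  rw [h4.fderiv_eq, h3.fderiv]
  rfl

/-- The 1-form `dθ` in the preferred chart at `z`. -/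
def angleForm (z : Circle) (y : EuclideanSpace ℝ (Fin 1)) : EuclideanSpace ℝ (Fin 1) →L[ℝ] ℝ :=
  let q : Circle := (extChartAt (𝓡 1) z).symm y
  (dθ q : EuclideanSpace ℝ (Fin 1) →L[ℝ] ℝ).comp (tangentCoordChange (𝓡 1) z q q)

theorem angleForm_self (z : Circle) :
    angleForm z (extChartAt (𝓡 1) z z) = dθ z := by
  have hq' := mem_extChartAt_source (I := 𝓡 1) z
  have key : ∀ q : Circle, q = z → (dθ q : EuclideanSpace ℝ (Fin 1) →L[ℝ] ℝ).comp
      (tangentCoordChange (𝓡 1) z q q) = dθ z := by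
    rintro _ rfl
    ext e
    rw [ContinuousLinearMap.comp_apply, tangentCoordChange_self hq']
  exact key _ ((extChartAt (𝓡 1) z).left_inv hq')

theorem differentiableAt_angleForm (z : Circle) :
    DifferentiableAt ℝ (angleForm z) (extChartAt (𝓡 1) z z) := by
  have hT := (isOpen_extChartAt_target (I := 𝓡 1) z).mem_nhds (mem_extChartAt_target z)
  have h0 : ContDiffOn ℝ ∞ (fderiv ℝ (circleRep z)) (extChartAt (𝓡 1) z).target :=
    (contDiffOn_circleRep z).fderiv_of_isOpen (isOpen_extChartAt_target z) (by simp)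
  have h1 := (h0.differentiableOn (by simp)).differentiableAt hT
  have h2 := ((contDiffOn_circleRep z).differentiableOn (by simp)).differentiableAt hT
  let Λ : EuclideanSpace ℝ (Fin 1) → EuclideanSpace ℝ (Fin 1) →L[ℝ] ℝ := fun y =>
    Complex.imCLM.comp ((ContinuousLinearMap.mul ℝ ℂ (Complex.conjCLE (circleRep z y))).comp
      (fderiv ℝ (circleRep z) y))
  have hΛ : DifferentiableAt ℝ Λ (extChartAt (𝓡 1) z z) := by
    refine (differentiableAt_const _).clm_comp (DifferentiableAt.clm_comp ?_ h1)
    exact (ContinuousLinearMap.mul ℝ ℂ).differentiableAt.comp _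
      (Complex.conjCLE.differentiableAt.comp _ h2)
  refine hΛ.congr_of_eventuallyEq ?_
  filter_upwards [hT] with y hy
  ext e
  have := dθ_chart ((extChartAt (𝓡 1) z).map_target hy) e
  rw [(extChartAt (𝓡 1) z).right_inv hy] at this
  exact this

end Circle

/-! ### Christoffel symbols of a product metric. -/

section Product

variable {E₁ E₂ : Type*} [NormedAddCommGroup E₁] [NormedSpace ℝ E₁] [FiniteDimensional ℝ E₁]
  [NormedAddCommGroup E₂] [NormedSpace ℝ E₂] [FiniteDimensional ℝ E₂]

/-- The orthogonal sum of two bilinear forms. -/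
def prodBilin (m : E₁ →L[ℝ] E₁ →L[ℝ] ℝ) (h : E₂ →L[ℝ] E₂ →L[ℝ] ℝ) :
    E₁ × E₂ →L[ℝ] E₁ × E₂ →L[ℝ] ℝ :=
  m.bilinearComp (ContinuousLinearMap.fst ℝ _ _) (ContinuousLinearMap.fst ℝ _ _) +
    h.bilinearComp (ContinuousLinearMap.snd ℝ _ _) (ContinuousLinearMap.snd ℝ _ _)

theorem prodBilin_apply (m : E₁ →L[ℝ] E₁ →L[ℝ] ℝ) (h : E₂ →L[ℝ] E₂ →L[ℝ] ℝ) (a b : E₁ × E₂) :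
    prodBilin m h a b = m a.1 b.1 + h a.2 b.2 := rfl

theorem prodBilin_pos {m : E₁ →L[ℝ] E₁ →L[ℝ] ℝ} {h : E₂ →L[ℝ] E₂ →L[ℝ] ℝ}
    (hm : ∀ v, v ≠ 0 → 0 < m v v) (hh : ∀ v, v ≠ 0 → 0 < h v v) (a : E₁ × E₂) (ha : a ≠ 0) :
    0 < prodBilin m h a a := by
  rw [prodBilin_apply]
  rcases a with ⟨a, b⟩
  by_cases h1 : a = 0
  · subst h1
    have hb : b ≠ 0 := by rintro rfl; exact ha rfl
    simpa using hh b hb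
  · by_cases h2 : b = 0
    · subst h2
      simpa using hm a h1
    · exact add_pos (hm a h1) (hh b h2)

/-- The Christoffel symbols of a product metric, on vectors tangent to the second factor. -/
theorem christoffel_prod {m : E₁ → E₁ →L[ℝ] E₁ →L[ℝ] ℝ} {h : E₂ → E₂ →L[ℝ] E₂ →L[ℝ] ℝ}
    {G : E₁ × E₂ → E₁ × E₂ →L[ℝ] E₁ × E₂ →L[ℝ] ℝ} {y : E₁ × E₂}
    (hG : G =ᶠ[nhds y] fun z => prodBilin (m z.1) (h z.2))
    (hm : DifferentiableAt ℝ m y.1) (hh : DifferentiableAt ℝ h y.2)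
    (hmp : ∀ v, v ≠ 0 → 0 < m y.1 v v) (hhp : ∀ v, v ≠ 0 → 0 < h y.2 v v) (s : E₁) (u w : E₂) :
    christoffel G y (s, u) (0, w) = (0, christoffel h y.2 u w) := by
  have hGy : G y = prodBilin (m y.1) (h y.2) := hG.self_of_nhds
  have hpos : ∀ v, v ≠ 0 → 0 < G y v v := by
    rw [hGy]
    exact prodBilin_pos hmp hhp
  have hd : DifferentiableAt ℝ G y := by
    refine DifferentiableAt.congr_of_eventuallyEq ?_ hG
    have h1 : DifferentiableAt ℝ (fun z : E₁ × E₂ => m z.1) y :=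
      DifferentiableAt.fun_comp' (𝕜 := ℝ) (E := E₁ × E₂) (F := E₁) (G := E₁ →L[ℝ] E₁ →L[ℝ] ℝ) y hm
        differentiableAt_fst
    have h2 : DifferentiableAt ℝ (fun z : E₁ × E₂ => h z.2) y :=
      DifferentiableAt.fun_comp' (𝕜 := ℝ) (E := E₁ × E₂) (F := E₂) (G := E₂ →L[ℝ] E₂ →L[ℝ] ℝ) y hh
        differentiableAt_snd
    have h3 : (fun z : E₁ × E₂ => prodBilin (m z.1) (h z.2)) = fun z =>
      ((ContinuousLinearMap.compL ℝ (E₁ × E₂) E₁ ℝ).flip (ContinuousLinearMap.fst ℝ E₁ E₂)).comp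
        ((m z.1).comp (ContinuousLinearMap.fst ℝ E₁ E₂)) +
      ((ContinuousLinearMap.compL ℝ (E₁ × E₂) E₂ ℝ).flip (ContinuousLinearMap.snd ℝ E₁ E₂)).comp
        ((h z.2).comp (ContinuousLinearMap.snd ℝ E₁ E₂)) := by
      funext z
      ext <;> rfl
    rw [h3]
    have k1 := (differentiableAt_const (𝕜 := ℝ) ((ContinuousLinearMap.compL ℝ (E₁ × E₂) E₁ ℝ).flip
      (ContinuousLinearMap.fst ℝ E₁ E₂))).clm_comp
        (h1.clm_comp (differentiableAt_const (ContinuousLinearMap.fst ℝ E₁ E₂)))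
    have k2 := (differentiableAt_const (𝕜 := ℝ) ((ContinuousLinearMap.compL ℝ (E₁ × E₂) E₂ ℝ).flip
      (ContinuousLinearMap.snd ℝ E₁ E₂))).clm_comp
        (h2.clm_comp (differentiableAt_const (ContinuousLinearMap.snd ℝ E₁ E₂)))
    exact DifferentiableAt.fun_add (𝕜 := ℝ) (E := E₁ × E₂) (F := E₁ × E₂ →L[ℝ] E₁ × E₂ →L[ℝ] ℝ) k1 k2
  -- Each block depends on its own variable only. With `(0, w)` as second argument, every derivative
  -- of the first block in the Koszul formula has a zero argument, so nothing more about the metric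
  -- `m` is needed.
  have hD : ∀ a b c : E₁ × E₂, fderiv ℝ G y c a b
      = fderiv ℝ m y.1 c.1 a.1 b.1 + fderiv ℝ h y.2 c.2 a.2 b.2 := by
    intro a b c
    rw [fderiv_bilin_apply hd]
    have h1 : (fun z => G z a b) =ᶠ[nhds y] fun z => m z.1 a.1 b.1 + h z.2 a.2 b.2 := by
      filter_upwards [hG] with z hz
      rw [hz, prodBilin_apply]
    have hm1 : DifferentiableAt ℝ (fun z => m z a.1 b.1) y.1 :=
      (hm.clm_apply (differentiableAt_const a.1)).clm_apply (differentiableAt_const b.1)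
    have hh1 : DifferentiableAt ℝ (fun z => h z a.2 b.2) y.2 :=
      (hh.clm_apply (differentiableAt_const a.2)).clm_apply (differentiableAt_const b.2)
    have h2 := (hm1.hasFDerivAt.comp y hasFDerivAt_fst).add (hh1.hasFDerivAt.comp y hasFDerivAt_snd)
    have h3 : fderiv ℝ (fun z => m z.1 a.1 b.1 + h z.2 a.2 b.2) y = _ := h2.fderiv
    rw [h1.fderiv_eq, h3, fderiv_bilin_apply hm, fderiv_bilin_apply hh]
    rfl
  refine eq_of_apply_eq hpos fun c => ?_
  rw [apply_christoffel hpos, hD, hD, hD, hGy, prodBilin_apply, apply_christoffel hhp]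
  simp

end Product

end AssocDef
namespace AssocDef

/-! ### The metric of `S¹ × V` in product charts. -/

section ProductCharts

variable {E₁ E₂ : Type*} [NormedAddCommGroup E₁] [NormedSpace ℝ E₁]
  [NormedAddCommGroup E₂] [NormedSpace ℝ E₂]
  {H₁ H₂ : Type*} [TopologicalSpace H₁] [TopologicalSpace H₂]
  {I₁ : ModelWithCorners ℝ E₁ H₁} {I₂ : ModelWithCorners ℝ E₂ H₂}
  [I₁.Boundaryless] [I₂.Boundaryless]
  {M₁ M₂ : Type*} [TopologicalSpace M₁] [ChartedSpace H₁ M₁] [IsManifold I₁ 1 M₁]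
  [TopologicalSpace M₂] [ChartedSpace H₂ M₂] [IsManifold I₂ 1 M₂]

theorem tangentCoordChange_prod {p p' q : M₁ × M₂}
    (h₁ : q.1 ∈ (extChartAt I₁ p.1).source ∩ (extChartAt I₁ p'.1).source)
    (h₂ : q.2 ∈ (extChartAt I₂ p.2).source ∩ (extChartAt I₂ p'.2).source) :
    tangentCoordChange (I₁.prod I₂) p p' q
      = (tangentCoordChange I₁ p.1 p'.1 q.1).prodMap (tangentCoordChange I₂ p.2 p'.2 q.2) := by
  have k₁ := hasFDerivWithinAt_tangentCoordChange h₁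
  have k₂ := hasFDerivWithinAt_tangentCoordChange h₂
  have k := hasFDerivWithinAt_tangentCoordChange (I := I₁.prod I₂) (x := p) (y := p') (z := q) (by
    simp only [extChartAt_prod, PartialEquiv.prod_source]
    exact ⟨⟨h₁.1, h₂.1⟩, ⟨h₁.2, h₂.2⟩⟩)
  rw [ModelWithCorners.range_eq_univ, hasFDerivWithinAt_univ] at k₁ k₂ k
  exact k.unique (HasFDerivAt.prodMap (extChartAt I₁ p.1 q.1, extChartAt I₂ p.2 q.2) k₁ k₂)

end ProductCharts

variable {V : Type*} [TopologicalSpace V] [ChartedSpace C3 V] [IsManifold 𝓘(ℂ, C3) ∞ V]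
  {C : Type*} [TopologicalSpace C] [ChartedSpace ℂ C] [IsManifold 𝓘(ℂ, ℂ) ∞ C] {f : C → V}

/-- The metric `dθ²` in the preferred chart at `z`. -/
def angleMetric (z : Circle) (y : EuclideanSpace ℝ (Fin 1)) :
    EuclideanSpace ℝ (Fin 1) →L[ℝ] EuclideanSpace ℝ (Fin 1) →L[ℝ] ℝ :=
  (ContinuousLinearMap.mul ℝ ℝ).bilinearComp (angleForm z y) (angleForm z y)

/-- The tangent line is one-dimensional, so the angular velocity, on which `dθ` is `1`, is a
multiple of `s`. -/
theorem dθ_ne_zero (z : Circle) {s : EuclideanSpace ℝ (Fin 1)} (hs : s ≠ 0) :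
    (dθ z : EuclideanSpace ℝ (Fin 1) →L[ℝ] ℝ) s ≠ 0 := by
  obtain ⟨t, rfl⟩ : ∃ t, Circle.exp t = z := ⟨Complex.arg z, Circle.exp_arg z⟩
  intro h
  have h1 := dθ_angularVelocity t
  have h0 : ∀ u : EuclideanSpace ℝ (Fin 1), u = u 0 • EuclideanSpace.single 0 1 := by
    intro u
    ext i
    fin_cases i
    simp
  have hs0 : s 0 ≠ 0 := fun hc => hs (by rw [h0 s, hc, zero_smul])
  have h2 : angularVelocity t = (angularVelocity t 0 / s 0) • s := by
    ext i
    fin_cases i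
    simp [hs0]
  rw [h2, map_smul, h, smul_zero] at h1
  exact zero_ne_one h1

theorem angleMetric_pos (z : Circle) (s : EuclideanSpace ℝ (Fin 1)) (hs : s ≠ 0) :
    0 < angleMetric z (extChartAt (𝓡 1) z z) s s := by
  unfold angleMetric
  rw [angleForm_self]
  exact mul_self_pos.2 (dθ_ne_zero z hs)

set_option synthInstance.maxHeartbeats 400000 in
set_option synthInstance.maxSize 2000 in
set_option maxSynthPendingDepth 4 in
theorem differentiableAt_bilinearComp_mul {E G : Type*} [NormedAddCommGroup E] [NormedSpace ℝ E]
    [NormedAddCommGroup G] [NormedSpace ℝ G] {α : G → E →L[ℝ] ℝ} {y : G}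
    (h : DifferentiableAt ℝ α y) :
    DifferentiableAt ℝ (fun z => (ContinuousLinearMap.mul ℝ ℝ).bilinearComp (α z) (α z)) y := by
  let L : (E →L[ℝ] ℝ) →L[ℝ] (E →L[ℝ] ℝ) →L[ℝ] (E →L[ℝ] E →L[ℝ] ℝ) :=
    ContinuousLinearMap.smulRightL ℝ E (E →L[ℝ] ℝ)
  have k : DifferentiableAt ℝ (fun z => L (α z)) y :=
    DifferentiableAt.fun_comp' (𝕜 := ℝ) (E := G) (F := E →L[ℝ] ℝ)
      (G := (E →L[ℝ] ℝ) →L[ℝ] (E →L[ℝ] E →L[ℝ] ℝ)) _ L.differentiableAt h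
  exact DifferentiableAt.clm_apply (G := E →L[ℝ] ℝ) (H := E →L[ℝ] E →L[ℝ] ℝ) k h

theorem differentiableAt_angleMetric (z : Circle) :
    DifferentiableAt ℝ (angleMetric z) (extChartAt (𝓡 1) z z) :=
  differentiableAt_bilinearComp_mul (differentiableAt_angleForm z)

namespace CalabiYau

variable (X : CalabiYau V)

/-- The product metric on the model space. -/
def prodForm (P : Circle × V) : RC3 →L[ℝ] RC3 →L[ℝ] ℝ := X.productMetric P

theorem prodForm_apply (P : Circle × V) (a b : RC3) :
    X.prodForm P a b = dθ P.1 a.1 * dθ P.1 b.1 + X.form P.2 a.2 b.2 := rfl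

theorem prodForm_pos (P : Circle × V) (a : RC3) (ha : a ≠ 0) : 0 < X.prodForm P a a := by
  refine prodBilin_pos (m := (ContinuousLinearMap.mul ℝ ℝ).bilinearComp (dθ P.1) (dθ P.1))
    (h := X.form P.2) (fun s hs => ?_) (X.form_pos P.2) a ha
  exact mul_self_pos.2 (dθ_ne_zero P.1 hs)

theorem bilinInChart_productMetric (P : Circle × V) :
    bilinInChart X.productMetric P =ᶠ[nhds (extChartAt ((𝓡 1).prod 𝓘(ℝ, C3)) P P)]
      fun y => prodBilin (angleMetric P.1 y.1) (X.chartForm P.2 y.2) := by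
  filter_upwards [(isOpen_extChartAt_target (I := (𝓡 1).prod 𝓘(ℝ, C3)) P).mem_nhds
    (mem_extChartAt_target P)] with y hy
  rw [extChartAt_prod] at hy
  have h := tangentCoordChange_prod (I₁ := 𝓡 1) (I₂ := 𝓘(ℝ, C3)) (p := P)
    (p' := ((extChartAt (𝓡 1) P.1).symm y.1, (extChartAt 𝓘(ℝ, C3) P.2).symm y.2))
    (q := ((extChartAt (𝓡 1) P.1).symm y.1, (extChartAt 𝓘(ℝ, C3) P.2).symm y.2))
    ⟨(extChartAt (𝓡 1) P.1).map_target hy.1, mem_extChartAt_source _⟩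
    ⟨(extChartAt 𝓘(ℝ, C3) P.2).map_target hy.2, mem_extChartAt_source _⟩
  refine ContinuousLinearMap.ext fun a => ContinuousLinearMap.ext fun b => ?_
  have ha := congrArg (fun L : RC3 →L[ℝ] RC3 => X.prodForm
    ((extChartAt (𝓡 1) P.1).symm y.1, (extChartAt 𝓘(ℝ, C3) P.2).symm y.2) (L a) (L b)) h
  exact ha

theorem christoffelAt_productMetric (P : Circle × V) (s : EuclideanSpace ℝ (Fin 1)) (u w : C3) :
    christoffelAt X.productMetric P (s, u) (0, w) = (0, X.Γ P.2 u w) :=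
  christoffel_prod (X.bilinInChart_productMetric P) (differentiableAt_angleMetric P.1)
    (X.differentiableAt_chartForm P.2) (angleMetric_pos P.1) (X.chartForm_pos P.2) s u w

/-- The component along `V` of a vector field along `S¹ × C`. -/
def vert (f : C → V)
    (v : ∀ P : Circle × C, TangentSpace ((𝓡 1).prod 𝓘(ℝ, C3)) (circleTimes f P)) (P : Circle × C) :
    TangentSpace 𝓘(ℝ, C3) ((f ∘ Prod.snd) P) :=
  let u : RC3 := v P
  u.2

/-- The restriction to `C` of the component along `V`, at a point of the circle. -/
def slice (f : C → V)
    (v : ∀ P : Circle × C, TangentSpace ((𝓡 1).prod 𝓘(ℝ, C3)) (circleTimes f P)) (z : Circle)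
    (x : C) : TangentSpace 𝓘(ℝ, C3) (f x) := vert f v (z, x)

/-- `vert` is the tangent map of the projection `S¹ × V → V` applied to the field. -/
theorem contMDiff_vert
    {v : ∀ P : Circle × C, TangentSpace ((𝓡 1).prod 𝓘(ℝ, C3)) (circleTimes f P)}
    (hv : ContMDiff ((𝓡 1).prod 𝓘(ℝ, ℂ)) ((𝓡 1).prod 𝓘(ℝ, C3)).tangent ∞ (fun P : Circle × C =>
      (⟨circleTimes f P, v P⟩ : TangentBundle ((𝓡 1).prod 𝓘(ℝ, C3)) (Circle × V)))) :
    ContMDiff ((𝓡 1).prod 𝓘(ℝ, ℂ)) 𝓘(ℝ, C3).tangent ∞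
      (fun P => (⟨(f ∘ Prod.snd) P, vert f v P⟩ : TangentBundle 𝓘(ℝ, C3) V)) := by
  have h1 : ContMDiff ((𝓡 1).prod 𝓘(ℝ, C3)).tangent 𝓘(ℝ, C3).tangent ∞
      (tangentMap ((𝓡 1).prod 𝓘(ℝ, C3)) 𝓘(ℝ, C3) (@Prod.snd Circle V)) :=
    (contMDiff_snd (n := ∞)).contMDiff_tangentMap (by simp)
  exact (h1.comp hv).congr fun P => (tangentMap_prodSnd (I := 𝓡 1) (I' := 𝓘(ℝ, C3))
    (p := (⟨circleTimes f P, v P⟩ : TangentBundle ((𝓡 1).prod 𝓘(ℝ, C3)) (Circle × V)))).symm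

theorem contMDiff_slice
    {v : ∀ P : Circle × C, TangentSpace ((𝓡 1).prod 𝓘(ℝ, C3)) (circleTimes f P)}
    (hv : ContMDiff ((𝓡 1).prod 𝓘(ℝ, ℂ)) ((𝓡 1).prod 𝓘(ℝ, C3)).tangent ∞ (fun P : Circle × C =>
      (⟨circleTimes f P, v P⟩ : TangentBundle ((𝓡 1).prod 𝓘(ℝ, C3)) (Circle × V)))) (z : Circle) :
    ContMDiff 𝓘(ℝ, ℂ) 𝓘(ℝ, C3).tangent ∞
      (fun x => (⟨f x, slice f v z x⟩ : TangentBundle 𝓘(ℝ, C3) V)) :=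
  (contMDiff_vert hv).comp (contMDiff_const.prodMk contMDiff_id)

end CalabiYau

end AssocDef
namespace AssocDef

/-! ### Covariant derivatives along `S¹ × C`. -/

variable {V : Type*} [TopologicalSpace V] [ChartedSpace C3 V] [IsManifold 𝓘(ℂ, C3) ∞ V]
  {C : Type*} [TopologicalSpace C] [ChartedSpace ℂ C] [IsManifold 𝓘(ℂ, ℂ) ∞ C] {f : C → V}

/-- The real model space of `S¹`. -/
abbrev R1 : Type := EuclideanSpace ℝ (Fin 1)

theorem mfderiv_circleTimes (hf : ContMDiff 𝓘(ℂ, ℂ) 𝓘(ℂ, C3) ∞ f) (P : Circle × C) (a : R1 × ℂ) :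
    (mfderiv ((𝓡 1).prod 𝓘(ℝ, ℂ)) ((𝓡 1).prod 𝓘(ℝ, C3)) (circleTimes f) P : R1 × ℂ →L[ℝ] RC3) a
      = (a.1, a.2 • curveDeriv C3 f P.2) := by
  have h : (mfderiv ((𝓡 1).prod 𝓘(ℝ, ℂ)) ((𝓡 1).prod 𝓘(ℝ, C3)) (circleTimes f) P :
      R1 × ℂ →L[ℝ] RC3) = ((mfderiv (𝓡 1) (𝓡 1) (id : Circle → Circle) P.1 : R1 →L[ℝ] R1)).prodMap
        (mfderiv 𝓘(ℝ, ℂ) 𝓘(ℝ, C3) f P.2 : ℂ →L[ℝ] C3) :=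
    mfderiv_prodMap (p := P) (f := (id : Circle → Circle)) (g := f) mdifferentiableAt_id
      ((contMDiff_real hf).mdifferentiable (by simp) P.2)
  have h1 : (mfderiv (𝓡 1) (𝓡 1) (id : Circle → Circle) P.1 : R1 →L[ℝ] R1)
    = ContinuousLinearMap.id ℝ R1 := mfderiv_id
  rw [h, h1]
  exact Prod.ext rfl (mfderiv_curve_real hf P.2 a.2)

namespace CalabiYau

/-- The derivative along the circle of a vector field along `S¹ × C` tangent to `V`. -/
def circleDeriv (f : C → V)
    (v : ∀ P : Circle × C, TangentSpace ((𝓡 1).prod 𝓘(ℝ, C3)) (circleTimes f P)) (z : Circle)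
    (x : C) : R1 →L[ℝ] C3 :=
  mfderiv (𝓡 1) 𝓘(ℝ, C3) (fun z' : Circle => fieldVal f (slice f v z') x) z

theorem mdifferentiableAt_vertRep
    {v : ∀ P : Circle × C, TangentSpace ((𝓡 1).prod 𝓘(ℝ, C3)) (circleTimes f P)}
    (hv : ContMDiff ((𝓡 1).prod 𝓘(ℝ, ℂ)) ((𝓡 1).prod 𝓘(ℝ, C3)).tangent ∞ (fun P : Circle × C =>
      (⟨circleTimes f P, v P⟩ : TangentBundle ((𝓡 1).prod 𝓘(ℝ, C3)) (Circle × V))))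
    (hf : Continuous f) (P : Circle × C) :
    MDifferentiableAt ((𝓡 1).prod 𝓘(ℝ, ℂ)) 𝓘(ℝ, C3)
      (chartRep (f ∘ Prod.snd) (vert f v) (f P.2)) P :=
  ((contMDiffOn_chartRep (contMDiff_vert hv) (f P.2)).contMDiffAt
    (((chartAt C3 (f P.2)).open_source.preimage (hf.comp continuous_snd)).mem_nhds
      (mem_chart_source C3 (f P.2)))).mdifferentiableAt (by simp)

variable (X : CalabiYau V)

/-- The Levi-Civita covariant derivative along `S¹ × C`, with values in the model space. -/
def prodCov (f : C → V)
    (v : ∀ P : Circle × C, TangentSpace ((𝓡 1).prod 𝓘(ℝ, C3)) (circleTimes f P)) (P : Circle × C)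
    (a : R1 × ℂ) : RC3 :=
  covDeriv (J := (𝓡 1).prod 𝓘(ℝ, ℂ)) X.productMetric (circleTimes f) v P a

/-- The field has components `(0, u)` in product charts, the derivative of `u` splits into partial
derivatives, and the Christoffel symbols of the product are those of `V`. Along the circle the field
stays in the fixed space `T_{f x} V`, so its derivative there is an ordinary one. -/
theorem prodCov_eq (hf : ContMDiff 𝓘(ℂ, ℂ) 𝓘(ℂ, C3) ∞ f)
    {v : ∀ P : Circle × C, TangentSpace ((𝓡 1).prod 𝓘(ℝ, C3)) (circleTimes f P)}
    (hv : ContMDiff ((𝓡 1).prod 𝓘(ℝ, ℂ)) ((𝓡 1).prod 𝓘(ℝ, C3)).tangent ∞ (fun P : Circle × C =>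
      (⟨circleTimes f P, v P⟩ : TangentBundle ((𝓡 1).prod 𝓘(ℝ, C3)) (Circle × V))))
    (hv0 : ∀ P, (v P : RC3).1 = 0) (z : Circle) (x : C) (s : R1) (a : ℂ) :
    X.prodCov f v (z, x) (s, a)
      = (0, circleDeriv f v z x s + X.cov f (slice f v z) x a) := by
  set u : Circle × C → C3 := chartRep (f ∘ Prod.snd) (vert f v) (f x) with hu
  have hud : MDifferentiableAt ((𝓡 1).prod 𝓘(ℝ, ℂ)) 𝓘(ℝ, C3) u (z, x) :=
    mdifferentiableAt_vertRep hv hf.continuous (z, x)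
  have h1 : (fun Z : Circle × C => (tangentCoordChange ((𝓡 1).prod 𝓘(ℝ, C3)) (circleTimes f Z)
      (circleTimes f (z, x)) (circleTimes f Z) (v Z) : RC3)) =ᶠ[nhds (z, x)]
      (ContinuousLinearMap.inr ℝ R1 C3) ∘ u := by
    have hU : {Z : Circle × C | Z.1 ∈ (chartAt R1 z).source ∧ f Z.2 ∈ (chartAt C3 (f x)).source} ∈
        nhds (z, x) :=
      (((chartAt R1 z).open_source.preimage continuous_fst).inter
        ((chartAt C3 (f x)).open_source.preimage (hf.continuous.comp continuous_snd))).mem_nhds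
        ⟨mem_chart_source R1 z, mem_chart_source C3 (f x)⟩
    filter_upwards [hU] with Z hZ
    have h := tangentCoordChange_prod (I₁ := 𝓡 1) (I₂ := 𝓘(ℝ, C3)) (p := circleTimes f Z)
      (p' := circleTimes f (z, x)) (q := circleTimes f Z)
      ⟨mem_extChartAt_source _, by rw [extChartAt_source]; exact hZ.1⟩
      ⟨mem_extChartAt_source _, by rw [extChartAt_source]; exact hZ.2⟩
    have h2 := congrArg (fun L : RC3 →L[ℝ] RC3 => L (v Z : RC3)) h
    refine h2.trans (Prod.ext ?_ rfl)
    exact (congrArg _ (hv0 Z)).trans (map_zero (tangentCoordChange (𝓡 1) _ _ _))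
  obtain ⟨D, hD⟩ : ∃ D : R1 × ℂ →L[ℝ] RC3, D = mfderiv ((𝓡 1).prod 𝓘(ℝ, ℂ)) 𝓘(ℝ, RC3)
      (fun Z : Circle × C => (tangentCoordChange ((𝓡 1).prod 𝓘(ℝ, C3)) (circleTimes f Z)
      (circleTimes f (z, x)) (circleTimes f Z) (v Z) : RC3)) (z, x) := ⟨_, rfl⟩
  obtain ⟨D', hD'⟩ : ∃ D : R1 × ℂ →L[ℝ] C3,
    D = mfderiv ((𝓡 1).prod 𝓘(ℝ, ℂ)) 𝓘(ℝ, C3) u (z, x) := ⟨_, rfl⟩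
  obtain ⟨D'', hD''⟩ : ∃ D : ℂ →L[ℝ] C3,
    D = mfderiv 𝓘(ℝ, ℂ) 𝓘(ℝ, C3) (chartRep f (slice f v z) (f x)) x := ⟨_, rfl⟩
  have h2 : D = (ContinuousLinearMap.inr ℝ R1 C3).comp D' := by
    have k1 := h1.mfderiv_eq (I := (𝓡 1).prod 𝓘(ℝ, ℂ)) (I' := 𝓘(ℝ, RC3))
    have k2 := mfderiv_comp (I := (𝓡 1).prod 𝓘(ℝ, ℂ)) (I' := 𝓘(ℝ, C3)) (I'' := 𝓘(ℝ, RC3)) (z, x)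
      (ContinuousLinearMap.inr ℝ R1 C3).mdifferentiableAt hud
    rw [hD, hD']
    refine (k1.trans k2).trans ?_
    rw [ContinuousLinearMap.mfderiv_eq]
    rfl
  have h3 : D' (s, a) = circleDeriv f v z x s + D'' a := by
    have k1 := mfderiv_prod_eq_add_apply (v := ((s, a) : R1 × ℂ)) hud
    have k2 : (fun z' : Circle => u (z', x)) = fun z' : Circle => fieldVal f (slice f v z') x := by
      funext z'
      exact chartRep_self (f ∘ Prod.snd) (vert f v) (z', x)
    obtain ⟨K, hK⟩ : ∃ D : R1 →L[ℝ] C3,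
      D = mfderiv (𝓡 1) 𝓘(ℝ, C3) (fun z' : Circle => u (z', x)) z := ⟨_, rfl⟩
    have k3 : D' (s, a) = K s + D'' a := by
      rw [hD', hD'', hK]
      exact k1
    rw [k3, hK, k2]
    rfl
  have h4 := X.christoffelAt_productMetric (circleTimes f (z, x)) s (a • curveDeriv C3 f x)
    (fieldVal f (slice f v z) x)
  have h5 : (v (z, x) : RC3) = (0, fieldVal f (slice f v z) x) := Prod.ext (hv0 (z, x)) rfl
  have h6 : X.prodCov f v (z, x) (s, a) = D (s, a)
      + christoffelAt X.productMetric (circleTimes f (z, x))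
        ((mfderiv ((𝓡 1).prod 𝓘(ℝ, ℂ)) ((𝓡 1).prod 𝓘(ℝ, C3)) (circleTimes f) (z, x) :
          R1 × ℂ →L[ℝ] RC3) (s, a)) (0, fieldVal f (slice f v z) x) := by
    rw [hD, ← h5]
    rfl
  have h7 : X.cov f (slice f v z) x a
      = D'' a + X.Γ (f x) (a • curveDeriv C3 f x) (fieldVal f (slice f v z) x) := by
    rw [hD'', ← mfderiv_curve_real hf]
    rfl
  rw [h6, mfderiv_circleTimes hf, h2, h7, ← add_assoc, ← h3]
  refine (congrArg (_ + ·) h4).trans ?_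
  exact Prod.ext (add_zero _) rfl

end CalabiYau

end AssocDef
namespace AssocDef

/-! ### Frame independence of the Dirac operators and their pairings with a vector. -/

section Frames

variable {E F : Type*} [AddCommGroup E] [Module ℝ E] [AddCommGroup F] [Module ℝ F] {n : ℕ}
  [FiniteDimensional ℝ F]

/-- The main term is the trace of `T(D ·, K ·)`. The tangential correction is a double sum which is
a trace in `j` for fixed `i` and a trace in `i` for fixed `j`, so the frame is exchanged in one
index at a time. -/
theorem sum_normalPart_orthonormal (hn : Module.finrank ℝ F = n) (G : E →ₗ[ℝ] E →ₗ[ℝ] ℝ)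
    (hG : ∀ x y, G x y = G y x) (D K : F →ₗ[ℝ] E) {e b : Fin n → F}
    (he : ∀ i j, G (D (e i)) (D (e j)) = if i = j then 1 else 0)
    (hb : ∀ i j, G (D (b i)) (D (b j)) = if i = j then 1 else 0) (T : E →ₗ[ℝ] E →ₗ[ℝ] ℝ) :
    ∑ i, T (D (e i)) (K (e i) - ∑ j, G (K (e i)) (D (e j)) • D (e j))
      = ∑ i, T (D (b i)) (K (b i) - ∑ j, G (K (b i)) (D (b j)) • D (b j)) := by
  have hG' : ∀ x y, (G.compl₁₂ D D) x y = (G.compl₁₂ D D) y x := fun x y => hG _ _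
  have h1 : ∀ c : Fin n → F, ∑ i, T (D (c i)) (K (c i) - ∑ j, G (K (c i)) (D (c j)) • D (c j))
      = ∑ i, T (D (c i)) (K (c i))
        - ∑ i, ∑ j, G (K (c i)) (D (c j)) * T (D (c i)) (D (c j)) := by
    intro c
    rw [← Finset.sum_sub_distrib]
    refine Finset.sum_congr rfl fun i _ => ?_
    rw [map_sub (T (D (c i))), map_sum (T (D (c i)))]
    simp only [map_smul, smul_eq_mul]
  have h2 : ∑ i, T (D (e i)) (K (e i)) = ∑ i, T (D (b i)) (K (b i)) :=
    sum_bilin_orthonormal hn (G.compl₁₂ D D) he hb hG' (T.compl₁₂ D K)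
  have h3 : ∀ i, ∑ j, G (K (e i)) (D (e j)) * T (D (e i)) (D (e j))
      = ∑ j, G (K (e i)) (D (b j)) * T (D (e i)) (D (b j)) := fun i =>
    sum_bilin_orthonormal hn (G.compl₁₂ D D) he hb hG'
      ((LinearMap.mul ℝ ℝ).compl₁₂ (G (K (e i)) ∘ₗ D) (T (D (e i)) ∘ₗ D))
  have h4 : ∑ i, ∑ j, G (K (e i)) (D (b j)) * T (D (e i)) (D (b j))
      = ∑ i, ∑ j, G (K (b i)) (D (b j)) * T (D (b i)) (D (b j)) := by
    rw [Finset.sum_comm, Finset.sum_comm (f := fun i j => G (K (b i)) (D (b j)) * _)]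
    refine Finset.sum_congr rfl fun j _ => ?_
    exact sum_bilin_orthonormal hn (G.compl₁₂ D D) he hb hG'
      ((LinearMap.mul ℝ ℝ).compl₁₂ (G.flip (D (b j)) ∘ₗ K) (T.flip (D (b j)) ∘ₗ D))
  rw [h1, h1, h2, Finset.sum_congr rfl fun i _ => h3 i, h4]

end Frames

/-- The bilinear form obtained by fixing the last argument of an alternating trilinear form. -/
def contract {E : Type*} [NormedAddCommGroup E] [NormedSpace ℝ E] (φ : E [⋀^Fin 3]→L[ℝ] ℝ) (c : E) :
    E →ₗ[ℝ] E →ₗ[ℝ] ℝ :=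
  LinearMap.mk₂ ℝ (fun a b => φ ![a, b, c]) (fun _ _ _ => tri_add₀ _ _ _ _ _)
    (fun _ _ _ => tri_smul₀ _ _ _ _ _) (fun _ _ _ => tri_add₁ _ _ _ _ _)
    (fun _ _ _ => tri_smul₁ _ _ _ _ _)

theorem apply_inverse_contract {E : Type*} [NormedAddCommGroup E] [NormedSpace ℝ E]
    [FiniteDimensional ℝ E] (G : E →L[ℝ] E →L[ℝ] ℝ) (hG : ∀ v, v ≠ 0 → 0 < G v v)
    (φ : E [⋀^Fin 3]→L[ℝ] ℝ) (u v w : E) :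
    G (G.inverse (φ.toContinuousLinearMap ![u, v, 0] 2)) w = φ ![u, v, w] := by
  rw [apply_inverse_of_pos G hG]
  change φ (Function.update ![u, v, 0] 2 w) = _
  congr 1
  ext i : 1
  fin_cases i <;> rfl

variable {V : Type*} [TopologicalSpace V] [ChartedSpace C3 V] [IsManifold 𝓘(ℂ, C3) ∞ V]
  {C : Type*} [TopologicalSpace C] [ChartedSpace ℂ C] [IsManifold 𝓘(ℂ, ℂ) ∞ C] {f : C → V}

namespace CalabiYau

variable (X : CalabiYau V)

/-- The real part of the complex volume form, on the model space. -/
def reVol (x : V) : C3 [⋀^Fin 3]→L[ℝ] ℝ := X.reΩ x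

theorem reVol_apply (x : V) (m : Fin 3 → C3) : X.reVol x m = (X.vol x m).re := rfl

/-- The product 3-form, on the model space. -/
def prodVol (P : Circle × V) : RC3 [⋀^Fin 3]→L[ℝ] ℝ := X.productForm P

theorem prodVol_apply (P : Circle × V) (a b c : RC3) :
    X.prodVol P ![a, b, c] = dθ P.1 a.1 * X.form P.2 (Complex.I • b.2) c.2
      + dθ P.1 b.1 * X.form P.2 (Complex.I • c.2) a.2
      + dθ P.1 c.1 * X.form P.2 (Complex.I • a.2) b.2 + X.reVol P.2 ![a.2, b.2, c.2] := by
  have h : X.prodVol P ![a, b, c] = dθ P.1 a.1 * X.form P.2 (Complex.I • b.2) c.2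
      + dθ P.1 b.1 * X.form P.2 (Complex.I • c.2) a.2
      + dθ P.1 c.1 * X.form P.2 (Complex.I • a.2) b.2
      + X.reVol P.2 (fun i => (![a, b, c] i).2) := rfl
  rw [h]
  congr 2
  ext i : 1
  fin_cases i <;> rfl

theorem cov_add (hf : ContMDiff 𝓘(ℂ, ℂ) 𝓘(ℂ, C3) ∞ f)
    {v : ∀ x : C, TangentSpace 𝓘(ℝ, C3) (f x)} {x : C}
    (hv : MDifferentiableAt 𝓘(ℝ, ℂ) 𝓘(ℝ, C3) (chartRep f v (f x)) x) (a b : ℂ) :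
    X.cov f v x (a + b) = X.cov f v x a + X.cov f v x b := by
  rw [X.cov_eq hf hv, X.cov_eq hf hv, X.cov_eq hf hv, map_add, add_smul, Γ,
    christoffel_add_left (X.chartForm_pos _)]
  unfold Γ
  abel

theorem cov_smul (hf : ContMDiff 𝓘(ℂ, ℂ) 𝓘(ℂ, C3) ∞ f)
    {v : ∀ x : C, TangentSpace 𝓘(ℝ, C3) (f x)} {x : C}
    (hv : MDifferentiableAt 𝓘(ℝ, ℂ) 𝓘(ℝ, C3) (chartRep f v (f x)) x) (r : ℝ) (a : ℂ) :
    X.cov f v x (r • a) = r • X.cov f v x a := by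
  rw [X.cov_eq hf hv, X.cov_eq hf hv, map_smul, smul_assoc, Γ,
    christoffel_smul_left (X.chartForm_pos _), smul_add]
  rfl

/-- The pairing with `w` of the complex Dirac operator, up to the norm of the tangent vector. -/
def diracPairing (f : C → V) (v : ∀ x : C, TangentSpace 𝓘(ℝ, C3) (f x)) (x : C) (w : C3) : ℝ :=
  X.reVol (f x) ![curveDeriv C3 f x, dbarField f v x, w]

theorem reVol_smul_smul (x : V) (a : ℂ) (u d w : C3) :
    X.reVol x ![a • u, starRingEnd ℂ a • d, w] = Complex.normSq a * X.reVol x ![u, d, w] := by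
  rw [reVol_apply, reVol_apply, tri_smul₀, tri_smul₁, ← mul_assoc, Complex.mul_conj,
    Complex.re_ofReal_mul]

/-- `Ω(u, u, ·) = 0` and, by complex linearity, `Ω(u, Iu, ·) = 0`: crossing with a tangent vector of
`C` ignores tangential components, so the projection to `NC` can be dropped. -/
theorem reVol_normal (x : V) (u d w : C3) (r s : ℝ) :
    X.reVol x ![u, d - (r • u + s • (Complex.I • u)), w] = X.reVol x ![u, d, w] := by
  rw [sub_eq_add_neg, tri_add₁, ← neg_one_smul ℝ (r • u + _), tri_smul₁, tri_add₁, tri_smul₁,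
    tri_smul₁, tri_self₀₁]
  have : X.reVol x ![u, Complex.I • u, w] = 0 := by
    rw [reVol_apply, tri_smul₁, tri_self₀₁]
    simp
  rw [this]
  ring

/-- Once the projection is dropped, the two slots carry the factors `a` and `ā`. The vector `a` need
not be a unit vector: whatever its coefficients, the tangential correction contributes nothing. -/
theorem form_complexDirac (hf : ContMDiff 𝓘(ℂ, ℂ) 𝓘(ℂ, C3) ∞ f)
    {v : ∀ x : C, TangentSpace 𝓘(ℝ, C3) (f x)} {x : C}
    (hv : MDifferentiableAt 𝓘(ℝ, ℂ) 𝓘(ℝ, C3) (chartRep f v (f x)) x) (a : ℂ) (w : C3) :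
    X.form (f x) (X.complexDirac f v x a) w = Complex.normSq a * X.diracPairing f v x w := by
  obtain ⟨D, hD⟩ : ∃ D : ℂ →L[ℝ] C3, D = mfderiv 𝓘(ℝ, ℂ) 𝓘(ℝ, C3) f x := ⟨_, rfl⟩
  have hDa : ∀ a : ℂ, D a = a • curveDeriv C3 f x := fun a => by
    rw [hD]
    exact mfderiv_curve_real hf x a
  obtain ⟨K, hK⟩ : ∃ K : C3, K = X.cov f v x a + Complex.I • X.cov f v x (Complex.I * a) := ⟨_, rfl⟩
  have h1 : X.form (f x) (X.complexDirac f v x a) w = X.reVol (f x) ![D a, K -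
      ∑ i, X.form (f x) K (D ((![a, Complex.I * a] : Fin 2 → ℂ) i)) •
        D ((![a, Complex.I * a] : Fin 2 → ℂ) i), w] := by
    rw [hD, hK]
    exact apply_inverse_contract (X.form (f x)) (X.form_pos (f x)) (X.reVol (f x)) _ _ w
  rw [h1, Fin.sum_univ_two]
  simp only [Matrix.cons_val_zero, Matrix.cons_val_one, hDa]
  rw [mul_smul, reVol_normal, hK, X.cov_add_I hf hv, reVol_smul_smul]
  rfl

end CalabiYau

end AssocDef
namespace AssocDef

/-! ### The Dirac operator of `S¹ × C`, and associativity. -/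

variable {V : Type*} [TopologicalSpace V] [ChartedSpace C3 V] [IsManifold 𝓘(ℂ, C3) ∞ V]
  {C : Type*} [TopologicalSpace C] [ChartedSpace ℂ C] [IsManifold 𝓘(ℂ, ℂ) ∞ C] {f : C → V}

theorem finrank_real_prod_complex : Module.finrank ℝ (R1 × ℂ) = 3 := by
  rw [Module.finrank_prod, finrank_euclideanSpace_fin, Complex.finrank_real_complex]

theorem mdifferentiableAt_chartRep {v : ∀ x : C, TangentSpace 𝓘(ℝ, C3) (f x)}
    (hv : ContMDiff 𝓘(ℝ, ℂ) 𝓘(ℝ, C3).tangent ∞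
      (fun x => (⟨f x, v x⟩ : TangentBundle 𝓘(ℝ, C3) V))) (hf : Continuous f) (x : C) :
    MDifferentiableAt 𝓘(ℝ, ℂ) 𝓘(ℝ, C3) (chartRep f v (f x)) x :=
  ((contMDiffOn_chartRep hv (f x)).contMDiffAt
    (((chartAt C3 (f x)).open_source.preimage hf).mem_nhds
      (mem_chart_source C3 (f x)))).mdifferentiableAt (by simp)

namespace CalabiYau

theorem hasDerivAt_slice
    {v : ∀ P : Circle × C, TangentSpace ((𝓡 1).prod 𝓘(ℝ, C3)) (circleTimes f P)}
    (hv : ContMDiff ((𝓡 1).prod 𝓘(ℝ, ℂ)) ((𝓡 1).prod 𝓘(ℝ, C3)).tangent ∞ (fun P : Circle × C =>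
      (⟨circleTimes f P, v P⟩ : TangentBundle ((𝓡 1).prod 𝓘(ℝ, C3)) (Circle × V))))
    (hf : Continuous f) (t : ℝ) (x : C) :
    HasDerivAt (fun t => fieldVal f (slice f v (Circle.exp t)) x)
      (circleDeriv f v (Circle.exp t) x (angularVelocity t)) t := by
  have h1 : MDifferentiableAt (𝓡 1) 𝓘(ℝ, C3) (fun z' : Circle => fieldVal f (slice f v z') x)
      (Circle.exp t) := by
    have k := (mdifferentiableAt_vertRep hv hf (Circle.exp t, x)).comp (Circle.exp t)
      (f := fun z' : Circle => (z', x)) (mdifferentiableAt_id.prodMk mdifferentiableAt_const)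
    have k2 : (fun z' : Circle => chartRep (f ∘ Prod.snd) (vert f v) (f x) (z', x))
        = fun z' : Circle => fieldVal f (slice f v z') x := by
      funext z'
      exact chartRep_self (f ∘ Prod.snd) (vert f v) (z', x)
    rw [← k2]
    exact k
  have h2 : MDifferentiableAt 𝓘(ℝ, ℝ) (𝓡 1) Circle.exp t :=
    contMDiff_circleExp.mdifferentiable (n := ∞) (by simp) t
  have h3 := HasMFDerivAt.comp t h1.hasMFDerivAt h2.hasMFDerivAt
  obtain ⟨L, hL⟩ : ∃ L : ℝ →L[ℝ] C3, L = (circleDeriv f v (Circle.exp t) x).comp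
    (mfderiv 𝓘(ℝ, ℝ) (𝓡 1) Circle.exp t : ℝ →L[ℝ] R1) := ⟨_, rfl⟩
  have h4 : HasFDerivAt (𝕜 := ℝ) (E := ℝ) (F := C3)
      (fun t => fieldVal f (slice f v (Circle.exp t)) x) L t := by
    rw [hL]
    exact hasMFDerivAt_iff_hasFDerivAt.1 h3
  have h5 : circleDeriv f v (Circle.exp t) x (angularVelocity t) = L 1 := by
    rw [hL]
    rfl
  rw [h5]
  have h6 : L = ContinuousLinearMap.toSpanSingleton ℝ (L 1) := by
    refine ContinuousLinearMap.ext fun r => ?_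
    have h7 : L (r • (1 : ℝ)) = r • L 1 := map_smul L r (1 : ℝ)
    rw [smul_eq_mul, mul_one] at h7
    exact h7
  rw [h6] at h4
  exact h4

variable (X : CalabiYau V)

/-- An orthonormal basis of the tangent space of `S¹ × C`. -/
def stdFrame (f : C → V) (t : ℝ) (x : C) : Fin 3 → R1 × ℂ :=
  let r : ℂ := ((Real.sqrt (X.form (f x) (curveDeriv C3 f x) (curveDeriv C3 f x)))⁻¹ : ℝ)
  ![(angularVelocity t, 0), (0, r), (0, Complex.I * r)]

variable {X}

theorem curveDeriv_ne_zero (hf : IsComplexCurve f) (x : C) : curveDeriv C3 f x ≠ 0 := by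
  intro h
  have h1 := mfderiv_curve (W := C3) hf.holomorphic x 1
  rw [h, smul_zero] at h1
  have h2 := hf.immersion x (h1.trans (map_zero (mfderiv 𝓘(ℂ, ℂ) 𝓘(ℂ, C3) f x : ℂ →L[ℂ] C3)).symm)
  exact one_ne_zero (α := ℂ) h2

variable (X)

theorem form_curveDeriv_pos (hf : IsComplexCurve f) (x : C) :
    0 < X.form (f x) (curveDeriv C3 f x) (curveDeriv C3 f x) :=
  X.form_pos _ _ (curveDeriv_ne_zero hf x)

theorem form_unit (hf : IsComplexCurve f) (x : C) :
    let r : ℂ := ((Real.sqrt (X.form (f x) (curveDeriv C3 f x) (curveDeriv C3 f x)))⁻¹ : ℝ)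
    Complex.normSq r = (X.form (f x) (curveDeriv C3 f x) (curveDeriv C3 f x))⁻¹ := by
  intro r
  have := X.form_curveDeriv_pos hf x
  simp only [r, Complex.normSq_ofReal]
  rw [← mul_inv, Real.mul_self_sqrt this.le]

theorem stdFrame_orthonormal (hf : IsComplexCurve f) (t : ℝ) (x : C) :
    IsOrthonormalFrame (J := (𝓡 1).prod 𝓘(ℝ, ℂ)) X.productMetric (circleTimes f)
      (Circle.exp t, x) (X.stdFrame f t x) := by
  intro i j
  have h : ∀ a b : R1 × ℂ, X.productMetric (circleTimes f (Circle.exp t, x))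
      (mfderiv ((𝓡 1).prod 𝓘(ℝ, ℂ)) ((𝓡 1).prod 𝓘(ℝ, C3)) (circleTimes f) (Circle.exp t, x) a)
      (mfderiv ((𝓡 1).prod 𝓘(ℝ, ℂ)) ((𝓡 1).prod 𝓘(ℝ, C3)) (circleTimes f) (Circle.exp t, x) b)
      = X.prodForm (Circle.exp t, f x) (a.1, a.2 • curveDeriv C3 f x)
        (b.1, b.2 • curveDeriv C3 f x) := by
    intro a b
    rw [← mfderiv_circleTimes hf.holomorphic (Circle.exp t, x) a,
      ← mfderiv_circleTimes hf.holomorphic (Circle.exp t, x) b]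
    rfl
  refine (h (X.stdFrame f t x i) (X.stdFrame f t x j)).trans ?_
  have hu := X.form_unit hf x
  have hp := (X.form_curveDeriv_pos hf x).ne'
  simp only at hu
  have hS := X.isSU3 (f x)
  rw [prodForm_apply]
  unfold stdFrame
  fin_cases i <;> fin_cases j <;>
    simp [dθ_angularVelocity, mul_smul, hS.map_I, hS.map_smul_smul, hS.map_self_I, hS.map_I_left,
      hu, hp, -Complex.ofReal_inv, -Complex.coe_smul]

/-- By frame independence the frame may be taken to be `∂_θ, U, IU`. The cross product of `∂_θ` with
a vector of `V` is multiplication by `I`, which gives the circle term; the identity `Ω(IU, k, ·) =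
Ω(U, Ik, ·)` merges the other two terms into `U × (∇_U v + I ∇_{IU} v)^⊥`. -/
theorem dirac_pairing (hf : IsComplexCurve f)
    {v : ∀ P : Circle × C, TangentSpace ((𝓡 1).prod 𝓘(ℝ, C3)) (circleTimes f P)}
    (hv : ContMDiff ((𝓡 1).prod 𝓘(ℝ, ℂ)) ((𝓡 1).prod 𝓘(ℝ, C3)).tangent ∞ (fun P : Circle × C =>
      (⟨circleTimes f P, v P⟩ : TangentBundle ((𝓡 1).prod 𝓘(ℝ, C3)) (Circle × V))))
    (hv0 : ∀ P, (v P : RC3).1 = 0)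
    (hvn : ∀ z x (a : ℂ), X.form (f x) (fieldVal f (slice f v z) x) (a • curveDeriv C3 f x) = 0)
    (t : ℝ) (x : C) (e : Fin 3 → R1 × ℂ)
    (he : IsOrthonormalFrame (J := (𝓡 1).prod 𝓘(ℝ, ℂ)) X.productMetric (circleTimes f)
      (Circle.exp t, x) e) (c : RC3) :
    X.prodForm (Circle.exp t, f x) (dirac (J := (𝓡 1).prod 𝓘(ℝ, ℂ)) X.productMetric X.productForm
        (circleTimes f) v (Circle.exp t, x) e) c
      = X.form (f x)
          (Complex.I • circleDeriv f v (Circle.exp t) x (angularVelocity t)) c.2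
        + X.diracPairing f (slice f v (Circle.exp t)) x c.2
          / X.form (f x) (curveDeriv C3 f x) (curveDeriv C3 f x) := by
  obtain ⟨D, hD⟩ : ∃ D : R1 × ℂ →L[ℝ] RC3, D = mfderiv ((𝓡 1).prod 𝓘(ℝ, ℂ))
    ((𝓡 1).prod 𝓘(ℝ, C3)) (circleTimes f) (Circle.exp t, x) := ⟨_, rfl⟩
  have hDa : ∀ a : R1 × ℂ, D a = (a.1, a.2 • curveDeriv C3 f x) := fun a => by
    rw [hD]
    exact mfderiv_circleTimes hf.holomorphic (Circle.exp t, x) a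
  have hm := mdifferentiableAt_chartRep (contMDiff_slice hv (Circle.exp t)) hf.holomorphic.continuous x
  have hKeq := fun s a => X.prodCov_eq hf.holomorphic hv hv0 (Circle.exp t) x s a
  let K : R1 × ℂ →ₗ[ℝ] RC3 :=
    { toFun := X.prodCov f v (Circle.exp t, x)
      map_add' := fun a b => by
        obtain ⟨a₁, a₂⟩ := a
        obtain ⟨b₁, b₂⟩ := b
        rw [Prod.mk_add_mk, hKeq, hKeq, hKeq, map_add, X.cov_add hf.holomorphic hm]
        refine Prod.ext (add_zero _).symm ?_
        simp only [Prod.snd_add]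
        abel
      map_smul' := fun r a => by
        obtain ⟨a₁, a₂⟩ := a
        rw [Prod.smul_mk, hKeq, hKeq, map_smul, X.cov_smul hf.holomorphic hm, ← smul_add]
        exact Prod.ext (smul_zero _).symm rfl }
  have hK : ∀ s a, K (s, a) = (0, circleDeriv f v (Circle.exp t) x s
    + X.cov f (slice f v (Circle.exp t)) x a) := hKeq
  let G : RC3 →ₗ[ℝ] RC3 →ₗ[ℝ] ℝ := (X.prodForm (Circle.exp t, f x)).toLinearMap₁₂
  have hGa : ∀ a b, G a b = X.prodForm (Circle.exp t, f x) a b := fun _ _ => rfl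
  have hS := X.isSU3 (f x)
  have hG : ∀ a b, G a b = G b a := by
    intro a b
    rw [hGa, hGa, prodForm_apply, prodForm_apply, hS.symm, mul_comm]
  set b := X.stdFrame f t x with hb
  have he' : ∀ i j, G (D (e i)) (D (e j)) = if i = j then 1 else 0 := by
    rw [hD]
    exact he
  have hb' : ∀ i j, G (D (b i)) (D (b j)) = if i = j then 1 else 0 := by
    rw [hD]
    exact X.stdFrame_orthonormal hf t x
  have key := sum_normalPart_orthonormal finrank_real_prod_complex G hG (D : R1 × ℂ →ₗ[ℝ] RC3) K
    he' hb' (contract (X.prodVol (Circle.exp t, f x)) c)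
  have h1 : X.prodForm (Circle.exp t, f x) (dirac (J := (𝓡 1).prod 𝓘(ℝ, ℂ)) X.productMetric
      X.productForm (circleTimes f) v (Circle.exp t, x) e) c
      = ∑ i, contract (X.prodVol (Circle.exp t, f x)) c (D (e i))
        (K (e i) - ∑ j, G (K (e i)) (D (e j)) • D (e j)) := by
    have k1 : ∀ w : Fin 3 → RC3, X.prodForm (Circle.exp t, f x) (∑ i, w i) c
        = ∑ i, X.prodForm (Circle.exp t, f x) (w i) c := by
      intro w
      rw [map_sum, sum_apply]
    rw [hD]
    refine (k1 _).trans (Finset.sum_congr rfl fun i _ => ?_)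
    exact apply_inverse_contract (X.prodForm (Circle.exp t, f x)) (X.prodForm_pos _)
      (X.prodVol (Circle.exp t, f x)) _ _ c
  rw [h1]
  refine key.trans ?_
  have hu := X.form_unit hf x
  have hder := hasDerivAt_slice hv hf.holomorphic.continuous t x
  set F' := curveDeriv C3 f x with hF'
  set W' := circleDeriv f v (Circle.exp t) x (angularVelocity t) with hW'
  -- The tangent space of `C` at `x` does not move with the angle, so the circle derivative of a
  -- normal field is again normal.
  have hWn : ∀ a : ℂ, X.form (f x) W' (a • F') = 0 := by
    intro a
    have k1 := ((X.form (f x)).flip (a • F')).hasFDerivAt.comp_hasDerivAt t hder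
    have k2 : (((X.form (f x)).flip (a • F')) ∘
      fun t => fieldVal f (slice f v (Circle.exp t)) x) = fun _ => 0 :=
      funext fun t => hvn (Circle.exp t) x a
    rw [k2] at k1
    exact k1.unique (hasDerivAt_const t 0)
  obtain ⟨r, hr⟩ : ∃ r : ℂ, r = ((Real.sqrt (X.form (f x) F' F'))⁻¹ : ℝ) := ⟨_, rfl⟩
  have hbr : b = ![(angularVelocity t, 0), (0, r), (0, Complex.I * r)] := by
    rw [hr]
    rfl
  simp only at hu
  rw [← hr] at hu
  have hd0 : D (angularVelocity t, 0) = (angularVelocity t, 0) := by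
    rw [hDa, zero_smul]
  have hd1 : D (0, r) = (0, r • F') := hDa _
  have hd2 : D (0, Complex.I * r) = (0, Complex.I • r • F') := by
    rw [hDa, mul_smul]
  have hcovI := X.cov_add_I hf.holomorphic hm r
  set K1 := X.cov f (slice f v (Circle.exp t)) x r with hK1
  set K2 := X.cov f (slice f v (Circle.exp t)) x (Complex.I * r) with hK2
  have hk0 : K (angularVelocity t, 0) = (0, W') := by
    rw [hK]
    have := X.cov_smul hf.holomorphic hm 0 0
    rw [zero_smul, zero_smul] at this
    rw [this, add_zero]
  have hk1 : K (0, r) = (0, K1) := by rw [hK, map_zero, zero_add]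
  have hk2 : K (0, Complex.I * r) = (0, K2) := by rw [hK, map_zero, zero_add]
  set U := r • F' with hU
  have hUU : X.form (f x) U U = 1 := by
    rw [hU, hS.map_smul_smul, hu, inv_mul_cancel₀ (X.form_curveDeriv_pos hf x).ne']
  have hproj : ∀ k : C3, ((0, k) : RC3) - ∑ j, G (0, k) (D (b j)) • D (b j)
      = (0, k - (X.form (f x) k U • U + X.form (f x) k (Complex.I • U) • (Complex.I • U))) := by
    intro k
    rw [hbr, Fin.sum_univ_three]
    change (0, k) - (G (0, k) (D (angularVelocity t, 0)) • D (angularVelocity t, 0)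
      + G (0, k) (D (0, r)) • D (0, r) + G (0, k) (D (0, Complex.I * r)) • D (0, Complex.I * r)) = _
    rw [hd0, hd1, hd2, hGa, hGa, hGa, prodForm_apply, prodForm_apply, prodForm_apply]
    refine Prod.ext ?_ ?_
    · simp
    · simp
  have hIU : X.form (f x) (Complex.I • U) (Complex.I • U) = 1 := by rw [hS.map_I, hUU]
  have hUI : X.form (f x) U (Complex.I • U) = 0 := hS.map_self_I U
  have hIUU : X.form (f x) (Complex.I • U) U = 0 := by rw [hS.symm, hUI]
  have hW0 : X.form (f x) W' U = 0 := hWn r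
  have hW1 : X.form (f x) W' (Complex.I • U) = 0 := by
    rw [hU, ← mul_smul]
    exact hWn _
  have hterm : ∑ i, contract (X.prodVol (Circle.exp t, f x)) c (D (b i))
      (K (b i) - ∑ j, G (K (b i)) (D (b j)) • D (b j))
      = X.prodVol (Circle.exp t, f x) ![(angularVelocity t, 0), (0, W'), c]
      + X.prodVol (Circle.exp t, f x) ![(0, U), (0, K1 - (X.form (f x) K1 U • U
        + X.form (f x) K1 (Complex.I • U) • (Complex.I • U))), c]
      + X.prodVol (Circle.exp t, f x) ![(0, Complex.I • U), (0, K2 - (X.form (f x) K2 U • U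
        + X.form (f x) K2 (Complex.I • U) • (Complex.I • U))), c] := by
    have hb0 : b 0 = (angularVelocity t, 0) := by rw [hbr]; rfl
    have hb1 : b 1 = (0, r) := by rw [hbr]; rfl
    have hb2 : b 2 = (0, Complex.I * r) := by rw [hbr]; rfl
    rw [Fin.sum_univ_three, hb0, hb1, hb2, hk0, hk1, hk2, hproj, hproj, hproj, hd0, hd1, hd2, hW0,
      hW1, zero_smul, zero_smul, add_zero, sub_zero]
    rfl
  refine hterm.trans ?_
  clear_value U
  -- In the last two terms, `dθ ∧ ω` pairs a vector of the `I`-invariant space `TC` with a normal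
  -- vector, which gives zero; only `Re Ω` survives.
  have hn : ∀ k : C3, X.form (f x) (Complex.I • U) (k - (X.form (f x) k U • U
      + X.form (f x) k (Complex.I • U) • (Complex.I • U))) = 0 := by
    intro k
    rw [map_sub, map_add, map_smul (X.form (f x) (Complex.I • U)),
      map_smul (X.form (f x) (Complex.I • U)), hIU, hIUU, hS.symm (Complex.I • U) k]
    simp
  have hn' : ∀ k : C3, X.form (f x) (Complex.I • Complex.I • U) (k - (X.form (f x) k U • U
      + X.form (f x) k (Complex.I • U) • (Complex.I • U))) = 0 := by
    intro k
    rw [smul_smul, Complex.I_mul_I, neg_one_smul, map_neg, neg_apply, map_sub, map_add,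
      map_smul (X.form (f x) U), map_smul (X.form (f x) U), hUI, hUU, hS.symm U k]
    simp
  have hz : ∀ u w : C3, X.reVol (f x) ![0, u, w] = 0 := by
    intro u w
    have := tri_smul₀ (X.reVol (f x)) 0 0 u w
    rwa [zero_smul, zero_mul] at this
  have hIK : ∀ k : C3, X.reVol (f x) ![Complex.I • U, k, c.2]
      = X.reVol (f x) ![U, Complex.I • k, c.2] := by
    intro k
    rw [reVol_apply, reVol_apply, tri_smul₀, tri_smul₁]
  have hIn : Complex.I • (K2 - (X.form (f x) K2 U • U
      + X.form (f x) K2 (Complex.I • U) • (Complex.I • U)))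
      = Complex.I • K2 - ((-X.form (f x) K2 (Complex.I • U)) • U
        + X.form (f x) K2 U • (Complex.I • U)) := by
    rw [smul_sub, smul_add, smul_comm Complex.I (X.form (f x) K2 U),
      smul_comm Complex.I (X.form (f x) K2 (Complex.I • U)), smul_smul Complex.I Complex.I,
      Complex.I_mul_I, neg_one_smul, smul_neg, neg_smul, add_comm]
  rw [prodVol_apply, prodVol_apply, prodVol_apply]
  simp only [hn, hn', hz, hIK, hIn, reVol_normal, map_zero, zero_mul, mul_zero, zero_add, add_zero,
    dθ_angularVelocity, one_mul, smul_zero, zero_apply]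
  rw [add_assoc, ← tri_add₁, hcovI, hU, reVol_smul_smul, hu, diracPairing, div_eq_inv_mul]

/-- `S¹ × C` is an associative submanifold of `S¹ × V`. -/
theorem isAssociative_circleTimes (hf : IsComplexCurve f) :
    IsAssociative ((𝓡 1).prod 𝓘(ℝ, ℂ)) X.productMetric X.productForm (circleTimes f) := by
  rintro ⟨z, x⟩ e he
  obtain ⟨t, rfl⟩ : ∃ t, Circle.exp t = z := ⟨Complex.arg z, Circle.exp_arg z⟩
  obtain ⟨D, hD⟩ : ∃ D : R1 × ℂ →L[ℝ] RC3, D = mfderiv ((𝓡 1).prod 𝓘(ℝ, ℂ))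
    ((𝓡 1).prod 𝓘(ℝ, C3)) (circleTimes f) (Circle.exp t, x) := ⟨_, rfl⟩
  have hDa : ∀ a : R1 × ℂ, D a = (a.1, a.2 • curveDeriv C3 f x) := fun a => by
    rw [hD]
    exact mfderiv_circleTimes hf.holomorphic (Circle.exp t, x) a
  let G : RC3 →ₗ[ℝ] RC3 →ₗ[ℝ] ℝ := (X.prodForm (Circle.exp t, f x)).toLinearMap₁₂
  have hb := X.stdFrame_orthonormal hf t x
  set b := X.stdFrame f t x with hbd
  have he' : ∀ i j, G.compl₁₂ (D : R1 × ℂ →ₗ[ℝ] RC3) (D : R1 × ℂ →ₗ[ℝ] RC3) (e i) (e j)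
      = if i = j then 1 else 0 := by
    rw [hD]
    exact he
  have hb' : ∀ i j, G.compl₁₂ (D : R1 × ℂ →ₗ[ℝ] RC3) (D : R1 × ℂ →ₗ[ℝ] RC3) (b i) (b j)
      = if i = j then 1 else 0 := by
    rw [hD]
    exact hb
  have key := abs_alternating_orthonormal finrank_real_prod_complex _ he' hb'
    ((X.prodVol (Circle.exp t, f x)).toAlternatingMap.compLinearMap (D : R1 × ℂ →ₗ[ℝ] RC3))
  have h1 : (X.prodVol (Circle.exp t, f x)).toAlternatingMap.compLinearMap (D : R1 × ℂ →ₗ[ℝ] RC3) b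
      = X.prodVol (Circle.exp t, f x) ![D (b 0), D (b 1), D (b 2)] := by
    change X.prodVol (Circle.exp t, f x) (fun i => D (b i)) = _
    congr 1
    ext1 i
    fin_cases i <;> rfl
  have hu := X.form_unit hf x
  have hp := (X.form_curveDeriv_pos hf x).ne'
  have hS := X.isSU3 (f x)
  simp only at hu
  -- On the standard frame only `dθ(∂_θ) ω(U, IU)` is non-zero; `Re Ω` has a zero argument.
  have h2 : X.prodVol (Circle.exp t, f x) ![D (b 0), D (b 1), D (b 2)] = 1 := by
    have hz : ∀ u w : C3, X.reVol (f x) ![0, u, w] = 0 := by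
      intro u w
      have := tri_smul₀ (X.reVol (f x)) 0 0 u w
      rwa [zero_smul, zero_mul] at this
    rw [prodVol_apply, hDa, hDa, hDa, hbd]
    unfold stdFrame
    simp [dθ_angularVelocity, mul_smul, hS.map_I, hS.map_smul_smul, hu, hp, hz,
      -Complex.ofReal_inv, -Complex.coe_smul]
  rw [h1, h2, abs_one] at key
  rw [hD] at key
  exact key

end CalabiYau

end AssocDef
namespace AssocDef

/-! ### The two kernels as scalar equations. -/

variable {V : Type*} [TopologicalSpace V] [ChartedSpace C3 V] [IsManifold 𝓘(ℂ, C3) ∞ V]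
  {C : Type*} [TopologicalSpace C] [ChartedSpace ℂ C] [IsManifold 𝓘(ℂ, ℂ) ∞ C] {f : C → V}

namespace CalabiYau

variable (X : CalabiYau V)

theorem isNormalSection_iff (hf : IsComplexCurve f) (v : ∀ x : C, TangentSpace 𝓘(ℝ, C3) (f x)) :
    IsNormalSection 𝓘(ℝ, ℂ) X.g f v ↔
      ContMDiff 𝓘(ℝ, ℂ) 𝓘(ℝ, C3).tangent ∞
        (fun x => (⟨f x, v x⟩ : TangentBundle 𝓘(ℝ, C3) V)) ∧
      ∀ (x : C) (a : ℂ), X.form (f x) (fieldVal f v x) (a • curveDeriv C3 f x) = 0 := by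
  have h : ∀ (x : C) (a : ℂ), X.g (f x) (v x) (mfderiv 𝓘(ℝ, ℂ) 𝓘(ℝ, C3) f x a)
      = X.form (f x) (fieldVal f v x) (a • curveDeriv C3 f x) := by
    intro x a
    rw [← mfderiv_curve_real hf.holomorphic]
    rfl
  exact and_congr_right fun _ => forall_congr' fun x => forall_congr' fun a =>
    Eq.congr (h x a) rfl

theorem isNormalSection_circleTimes_iff (hf : IsComplexCurve f)
    (v : ∀ P : Circle × C, TangentSpace ((𝓡 1).prod 𝓘(ℝ, C3)) (circleTimes f P)) :
    IsNormalSection ((𝓡 1).prod 𝓘(ℝ, ℂ)) X.productMetric (circleTimes f) v ↔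
      ContMDiff ((𝓡 1).prod 𝓘(ℝ, ℂ)) ((𝓡 1).prod 𝓘(ℝ, C3)).tangent ∞ (fun P : Circle × C =>
        (⟨circleTimes f P, v P⟩ : TangentBundle ((𝓡 1).prod 𝓘(ℝ, C3)) (Circle × V))) ∧
      (∀ P, (v P : RC3).1 = 0) ∧
      ∀ z x (a : ℂ), X.form (f x) (fieldVal f (slice f v z) x) (a • curveDeriv C3 f x) = 0 := by
  have h : ∀ (P : Circle × C) (a : R1 × ℂ), X.productMetric (circleTimes f P) (v P)
      (mfderiv ((𝓡 1).prod 𝓘(ℝ, ℂ)) ((𝓡 1).prod 𝓘(ℝ, C3)) (circleTimes f) P a)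
      = dθ P.1 (v P : RC3).1 * dθ P.1 a.1
        + X.form (f P.2) (fieldVal f (slice f v P.1) P.2) (a.2 • curveDeriv C3 f P.2) := by
    intro P a
    refine Eq.trans ?_ (X.prodForm_apply (circleTimes f P) (v P)
      (a.1, a.2 • curveDeriv C3 f P.2))
    rw [← mfderiv_circleTimes hf.holomorphic P a]
    rfl
  refine and_congr_right fun _ => ⟨fun H => ⟨fun P => ?_, fun z x a => ?_⟩, fun H P a => ?_⟩
  · by_contra hc
    -- The circle component of `v` is itself tangent to `S¹ × C`; testing against it gives the
    -- square of its angle.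
    have h1 := (h P ((v P : RC3).1, 0)).symm.trans (H P _)
    simp only [zero_smul, map_zero, add_zero] at h1
    exact dθ_ne_zero P.1 hc (mul_self_eq_zero.1 h1)
  · have h1 := (h (z, x) (0, a)).symm.trans (H (z, x) _)
    simp only [map_zero, mul_zero, zero_add] at h1
    exact h1
  · refine (h P a).trans ?_
    rw [H.1 P, map_zero, zero_mul, zero_add]
    exact H.2 P.1 P.2 a.2

theorem mem_complexDiracKernel_iff (hf : IsComplexCurve f)
    (v : ∀ x : C, TangentSpace 𝓘(ℝ, C3) (f x)) :
    v ∈ X.complexDiracKernel f ↔ IsNormalSection 𝓘(ℝ, ℂ) X.g f v ∧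
      ∀ x w, X.diracPairing f v x w = 0 := by
  refine and_congr_right fun hv => forall_congr' fun x => ?_
  have hm := mdifferentiableAt_chartRep hv.1 hf.holomorphic.continuous x
  have h : ∀ a : ℂ, X.g (f x) (mfderiv 𝓘(ℝ, ℂ) 𝓘(ℝ, C3) f x a) (mfderiv 𝓘(ℝ, ℂ) 𝓘(ℝ, C3) f x a)
      = Complex.normSq a * X.form (f x) (curveDeriv C3 f x) (curveDeriv C3 f x) := by
    intro a
    rw [← (X.isSU3 (f x)).map_smul_smul, ← mfderiv_curve_real hf.holomorphic]
    rfl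
  constructor
  · intro H w
    obtain ⟨r, hr⟩ : ∃ r : ℂ,
      r = ((Real.sqrt (X.form (f x) (curveDeriv C3 f x) (curveDeriv C3 f x)))⁻¹ : ℝ) := ⟨_, rfl⟩
    have hu := X.form_unit hf x
    simp only at hu
    rw [← hr] at hu
    have h1 := H r ((h r).trans
      (by rw [hu, inv_mul_cancel₀ (X.form_curveDeriv_pos hf x).ne']))
    have h2 := X.form_complexDirac hf.holomorphic hm r w
    have h3 : X.form (f x) (X.complexDirac f v x r) w = 0 := by
      refine (congrArg (fun u : C3 => X.form (f x) u w) h1).trans ?_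
      exact congrArg (· w) (map_zero (X.form (f x)))
    rw [h3, hu] at h2
    exact (mul_eq_zero.1 h2.symm).resolve_left (inv_pos.2 (X.form_curveDeriv_pos hf x)).ne'
  · intro H a _
    obtain ⟨u, hu⟩ : ∃ u : C3, u = X.complexDirac f v x a := ⟨_, rfl⟩
    have h2 := X.form_complexDirac hf.holomorphic hm a u
    rw [H u, mul_zero, ← hu] at h2
    by_contra hc
    exact (X.form_pos (f x) u (by rw [hu]; exact hc)).ne' h2

/-- The right side of `dirac_pairing` does not involve the frame, so one frame is enough to extract
the equation, and positivity of the metric recovers the vector equation in every frame. -/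
theorem mem_diracKernel_iff (hf : IsComplexCurve f)
    (v : ∀ P : Circle × C, TangentSpace ((𝓡 1).prod 𝓘(ℝ, C3)) (circleTimes f P)) :
    v ∈ diracKernel ((𝓡 1).prod 𝓘(ℝ, ℂ)) X.productMetric X.productForm (circleTimes f) ↔
      IsNormalSection ((𝓡 1).prod 𝓘(ℝ, ℂ)) X.productMetric (circleTimes f) v ∧
      ∀ t x w, X.form (f x)
          (Complex.I • circleDeriv f v (Circle.exp t) x (angularVelocity t)) w
        + X.diracPairing f (slice f v (Circle.exp t)) x w
          / X.form (f x) (curveDeriv C3 f x) (curveDeriv C3 f x) = 0 := by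
  refine and_congr_right fun hv => ?_
  obtain ⟨hs, h0, hn⟩ := (X.isNormalSection_circleTimes_iff hf v).1 hv
  constructor
  · intro H t x w
    have h1 := X.dirac_pairing hf hs h0 hn t x _ (X.stdFrame_orthonormal hf t x) (0, w)
    have h2 := H (Circle.exp t, x) _ (X.stdFrame_orthonormal hf t x)
    refine h1.symm.trans ?_
    refine (congrArg (fun u : RC3 => X.prodForm (Circle.exp t, f x) u (0, w)) h2).trans ?_
    exact congrArg (· (0, w)) (map_zero (X.prodForm (Circle.exp t, f x)))
  · rintro H ⟨z, x⟩ e he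
    obtain ⟨t, rfl⟩ : ∃ t, Circle.exp t = z := ⟨Complex.arg z, Circle.exp_arg z⟩
    obtain ⟨u, hu⟩ : ∃ u : RC3, u = dirac (J := (𝓡 1).prod 𝓘(ℝ, ℂ)) X.productMetric X.productForm
      (circleTimes f) v (Circle.exp t, x) e := ⟨_, rfl⟩
    have h1 := X.dirac_pairing hf hs h0 hn t x e he u
    rw [H, ← hu] at h1
    by_contra hc
    exact (X.prodForm_pos (Circle.exp t, f x) u (by rw [hu]; exact hc)).ne' h1

end CalabiYau

/-- A vector field along `f`, as a vector field along `S¹ × C` tangent to `V`, is smooth. -/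
theorem contMDiff_pullBack {w : ∀ x : C, TangentSpace 𝓘(ℝ, C3) (f x)}
    (hw : ContMDiff 𝓘(ℝ, ℂ) 𝓘(ℝ, C3).tangent ∞
        (fun x => (⟨f x, w x⟩ : TangentBundle 𝓘(ℝ, C3) V))) :
    ContMDiff ((𝓡 1).prod 𝓘(ℝ, ℂ)) ((𝓡 1).prod 𝓘(ℝ, C3)).tangent ∞ (fun P : Circle × C =>
        (⟨circleTimes f P, pullBack f w P⟩ :
          TangentBundle ((𝓡 1).prod 𝓘(ℝ, C3)) (Circle × V))) := by
  have h1 : ContMDiff ((𝓡 1).prod 𝓘(ℝ, ℂ)) (𝓡 1).tangent ∞ (fun P : Circle × C =>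
      (⟨P.1, 0⟩ : TangentBundle (𝓡 1) Circle)) :=
    (Bundle.contMDiff_zeroSection ℝ (TangentSpace (𝓡 1) : Circle → Type)).comp contMDiff_fst
  have h2 : ContMDiff ((𝓡 1).prod 𝓘(ℝ, ℂ)) 𝓘(ℝ, C3).tangent ∞ (fun P : Circle × C =>
      (⟨f P.2, w P.2⟩ : TangentBundle 𝓘(ℝ, C3) V)) := hw.comp contMDiff_snd
  exact (contMDiff_equivTangentBundleProd_symm (I := 𝓡 1) (I' := 𝓘(ℝ, C3)) (M := Circle) (M' := V)
    (n := ∞)).comp (h1.prodMk h2)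

namespace CalabiYau

variable (X : CalabiYau V)

theorem isNormalSection_pullBack (hf : IsComplexCurve f)
    {w : ∀ x : C, TangentSpace 𝓘(ℝ, C3) (f x)} (hw : IsNormalSection 𝓘(ℝ, ℂ) X.g f w) :
    IsNormalSection ((𝓡 1).prod 𝓘(ℝ, ℂ)) X.productMetric (circleTimes f) (pullBack f w) :=
  (X.isNormalSection_circleTimes_iff hf _).2
    ⟨contMDiff_pullBack hw.1, fun _ => rfl, fun _ x a =>
      ((X.isNormalSection_iff hf w).1 hw).2 x a⟩

theorem pullBack_mem_diracKernel (hf : IsComplexCurve f)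
    {w : ∀ x : C, TangentSpace 𝓘(ℝ, C3) (f x)} (hw : w ∈ X.complexDiracKernel f) :
    pullBack f w ∈
      diracKernel ((𝓡 1).prod 𝓘(ℝ, ℂ)) X.productMetric X.productForm (circleTimes f) := by
  obtain ⟨hn, hD⟩ := (X.mem_complexDiracKernel_iff hf w).1 hw
  have hn' := X.isNormalSection_pullBack hf hn
  refine (X.mem_diracKernel_iff hf _).2 ⟨hn', fun t x c => ?_⟩
  have h1 := hasDerivAt_slice hn'.1 hf.holomorphic.continuous t x
  have h2 := h1.unique (hasDerivAt_const t (fieldVal f w x))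
  have h3 : X.diracPairing f (slice f (pullBack f w) (Circle.exp t)) x c = 0 := hD x c
  rw [h2, h3]
  simp

end CalabiYau

end AssocDef
namespace AssocDef

/-! ### Holomorphic sections of the quotient bundle `TV/TC`. -/

section Quotient

variable {u T : ℂ → C3} {y : ℂ} {k : Fin 3}

theorem differentiableAt_coeff (hu : DifferentiableAt ℝ u y) (hT : DifferentiableAt ℂ T y)
    (hk : T y k ≠ 0) : DifferentiableAt ℝ (fun z => (T z k)⁻¹ • u z k) y ∧
      dbar (fun z => (T z k)⁻¹ • u z k) y = (T y k)⁻¹ • dbar u y k := by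
  let L : C3 →L[ℂ] ℂ := EuclideanSpace.proj k
  have hTk : DifferentiableAt ℂ (fun z => (T z k)⁻¹) y :=
    (L.differentiableAt.comp y hT).inv hk
  have hLu : DifferentiableAt ℝ (fun z => L (u z)) y :=
    (L.restrictScalars ℝ).differentiableAt.comp y hu
  have hTk' : DifferentiableAt ℝ (fun z => (T z k)⁻¹) y := hTk.restrictScalars ℝ
  refine ⟨hTk'.smul hLu, ?_⟩
  refine (dbar_smul hTk' hLu).trans ?_
  rw [dbar_of_differentiableAt hTk, zero_smul, add_zero, dbar_clm_comp L hu]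
  rfl

/-- If `∂̄u` is a multiple of the holomorphic `T`, then a multiple of `T` can be subtracted from `u`
to obtain a holomorphic function. -/
theorem differentiableAt_sub_coeff_smul (hu : DifferentiableAt ℝ u y) (hT : DifferentiableAt ℂ T y)
    (hk : T y k ≠ 0) {c : ℂ} (h : dbar u y = c • T y) :
    DifferentiableAt ℂ (fun z => u z - ((T z k)⁻¹ • u z k) • T z) y := by
  obtain ⟨h1, h2⟩ := differentiableAt_coeff hu hT hk
  have hT' : DifferentiableAt ℝ T y := hT.restrictScalars ℝ
  have h3 : DifferentiableAt ℝ (fun z => ((T z k)⁻¹ • u z k) • T z) y := h1.smul hT'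
  refine differentiableAt_of_dbar (hu.sub h3) ?_
  -- The coefficient `u_k / T_k` has `∂̄` equal to `c`, so its multiple of `T` has the same `∂̄` as
  -- `u`.
  refine (dbar_sub hu h3).trans ?_
  rw [dbar_smul h1 hT', h2, dbar_of_differentiableAt hT, smul_zero, zero_add, h,
    PiLp.smul_apply, smul_eq_mul, smul_eq_mul, mul_comm c, inv_mul_cancel_left₀ hk, sub_self]

/-- If `u` is congruent to a holomorphic function modulo the multiples of the holomorphic `T`, then
`∂̄u` is a multiple of `T`. -/
theorem dbar_eq_smul_of_congr (hu : DifferentiableAt ℝ u y) (hT : DifferentiableAt ℂ T y)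
    (hk : T y k ≠ 0) {s : ℂ → C3} (hs : DifferentiableAt ℂ s y)
    (h : ∀ᶠ z in nhds y, ∃ a : ℂ, u z = s z + a • T z) : ∃ c : ℂ, dbar u y = c • T y := by
  have hs' : DifferentiableAt ℝ s y := hs.restrictScalars ℝ
  have hus : DifferentiableAt ℝ (fun z => u z - s z) y := hu.sub hs'
  obtain ⟨h1, h2⟩ := differentiableAt_coeff hus hT hk
  have hT' : DifferentiableAt ℝ T y := hT.restrictScalars ℝ
  have hTk : ∀ᶠ z in nhds y, T z k ≠ 0 :=
    ((EuclideanSpace.proj k : C3 →L[ℂ] ℂ).continuous.continuousAt.comp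
      hT.continuousAt).eventually_ne hk
  -- The multiple is only known to exist pointwise; where `T_k ≠ 0` the `k`-th coordinate determines
  -- it, so it is differentiable.
  have h3 : (fun z => u z - s z) =ᶠ[nhds y] fun z => ((T z k)⁻¹ • (u z - s z) k) • T z := by
    filter_upwards [h, hTk] with z ⟨a, ha⟩ hz
    rw [ha, add_sub_cancel_left, PiLp.smul_apply, smul_eq_mul, smul_eq_mul, mul_comm a,
      inv_mul_cancel_left₀ hz]
  have h4 := dbar_congr h3
  rw [dbar_sub hu hs', dbar_of_differentiableAt hs, sub_zero, dbar_smul h1 hT',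
    dbar_of_differentiableAt hT, smul_zero, zero_add] at h4
  exact ⟨_, h4⟩

end Quotient

variable {V : Type*} [TopologicalSpace V] [ChartedSpace C3 V] [IsManifold 𝓘(ℂ, C3) ∞ V]
  {C : Type*} [TopologicalSpace C] [ChartedSpace ℂ C] [IsManifold 𝓘(ℂ, ℂ) ∞ C] {f : C → V}

theorem contMDiffOn_holomorphic_section_iff {s : ∀ x : C, TangentSpace 𝓘(ℂ, C3) (f x)} {q : V}
    {U : Set C} (hU : Set.MapsTo f U (chartAt C3 q).source) :
    ContMDiffOn 𝓘(ℂ, ℂ) 𝓘(ℂ, C3).tangent ∞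
        (fun x : C => (⟨f x, s x⟩ : TangentBundle 𝓘(ℂ, C3) V)) U ↔
      ContMDiffOn 𝓘(ℂ, ℂ) 𝓘(ℂ, C3) ∞ f U ∧ ContMDiffOn 𝓘(ℂ, ℂ) 𝓘(ℂ, C3) ∞
        (fun x => (tangentCoordChange 𝓘(ℂ, C3) (f x) q (f x) (s x) : C3)) U := by
  refine (Bundle.Trivialization.contMDiffOn_iff (e := trivializationAt C3 (TangentSpace 𝓘(ℂ, C3)) q)
    ?_)
  intro x hx
  simpa using hU hx

/-- A vector field along the curve is holomorphic modulo the tangent bundle exactly when the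
Cauchy-Riemann operator sends it to a tangent vector field. -/
theorem isHolomorphicNormal_iff (hf : IsComplexCurve f)
    {v : ∀ x : C, TangentSpace 𝓘(ℝ, C3) (f x)} (hv : ContMDiff 𝓘(ℝ, ℂ) 𝓘(ℝ, C3).tangent ∞
        (fun x => (⟨f x, v x⟩ : TangentBundle 𝓘(ℝ, C3) V))) :
    IsHolomorphicNormal f v ↔ ∀ x, ∃ c : ℂ, dbarField f v x = c • curveDeriv C3 f x := by
  have hc := hf.holomorphic.continuous
  have hTd : ∀ (p : C) (q : V) {y : ℂ}, y ∈ curveDomain C3 f p q →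
      DifferentiableAt ℂ (deriv (curveRep C3 f p q)) y := fun p q y hy =>
    (((contDiffOn_curveRep hf.holomorphic p q).differentiableOn (by simp)).deriv
      (isOpen_curveDomain hc p q)).differentiableAt ((isOpen_curveDomain hc p q).mem_nhds hy)
  have hvd : ∀ (p : C) (q : V) {y : ℂ}, y ∈ curveDomain C3 f p q →
      DifferentiableAt ℝ (fieldRep f v p q) y := fun p q y hy =>
    ((contDiffOn_fieldRep hv p q).differentiableOn (by simp)).differentiableAt
      ((isOpen_curveDomain hc p q).mem_nhds hy)
  have hk : ∀ x, ∃ k, curveDeriv C3 f x k ≠ 0 := by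
    intro x
    by_contra hcon
    push Not at hcon
    exact CalabiYau.curveDeriv_ne_zero hf x (by ext k; exact hcon k)
  have hmem : ∀ x, chartAt ℂ x x ∈ curveDomain C3 f x (f x) := fun x =>
    mem_curveDomain (mem_chart_source ℂ x) (mem_chart_source C3 (f x))
  have hreal : ∀ {p q : V}, p ∈ (chartAt C3 q).source → ∀ w : C3,
      tangentCoordChange 𝓘(ℝ, C3) p q p w = tangentCoordChange 𝓘(ℂ, C3) p q p w := by
    intro p q hp w
    rw [tangentCoordChange_real (mem_chart_source C3 p) hp]
    rfl
  constructor
  · intro H x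
    obtain ⟨U, hU, hxU, s, hs, hsv⟩ := H x
    obtain ⟨k, hk⟩ := hk x
    set D := curveDomain C3 f x (f x) with hD
    let U' : Set C := U ∩ f ⁻¹' (chartAt C3 (f x)).source
    have hs' := ((contMDiffOn_holomorphic_section_iff (s := s) (U := U') (q := f x)
      (fun z hz => hz.2)).1 (hs.mono Set.inter_subset_left)).2
    let Y : Set ℂ := D ∩ (chartAt ℂ x).symm ⁻¹' U ∩ (chartAt ℂ x).target
    have hY : Y ∈ nhds (chartAt ℂ x x) := by
      have h1 : (chartAt ℂ x).target ∩ (chartAt ℂ x).symm ⁻¹' U ∈ nhds (chartAt ℂ x x) :=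
        ((chartAt ℂ x).isOpen_inter_preimage_symm hU).mem_nhds
          ⟨(chartAt ℂ x).map_source (mem_chart_source ℂ x), by simpa using hxU⟩
      filter_upwards [h1, (isOpen_curveDomain hc x (f x)).mem_nhds (hmem x)] with y h2 h3
      exact ⟨⟨h3, h2.2⟩, h2.1⟩
    let σ : ℂ → C3 := fun y => tangentCoordChange 𝓘(ℂ, C3) (f ((chartAt ℂ x).symm y)) (f x)
      (f ((chartAt ℂ x).symm y)) (s ((chartAt ℂ x).symm y))
    have hσ : DifferentiableAt ℂ σ (chartAt ℂ x x) := by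
      have h1 : ContMDiffOn 𝓘(ℂ, ℂ) 𝓘(ℂ, C3) ∞ σ Y := by
        refine hs'.comp ((contMDiffOn_extChartAt_symm (I := 𝓘(ℂ, ℂ)) x).mono ?_) ?_
        · intro w hw
          simpa using hw.2
        · intro w hw
          exact ⟨hw.1.2, hw.1.1.2⟩
      exact ((contMDiffOn_iff_contDiffOn.1 h1).contDiffAt hY).differentiableAt (by simp)
    refine dbar_eq_smul_of_congr (hvd x (f x) (hmem x)) (hTd x (f x) (hmem x)) hk hσ ?_
    filter_upwards [hY] with y hy
    set z := (chartAt ℂ x).symm y with hz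
    have hzx : z ∈ (chartAt ℂ x).source := (chartAt ℂ x).map_target hy.2
    have hzq : f z ∈ (chartAt C3 (f x)).source := hy.1.1.2
    obtain ⟨a, ha⟩ := hsv z hy.1.2
    obtain ⟨a, rfl⟩ : ∃ b : ℂ, b = a := ⟨a, rfl⟩
    have hb := mfderiv_curve (W := C3) hf.holomorphic z a
    have hder := deriv_curveRep (W := C3) hf.holomorphic hzx hzq
    rw [show chartAt ℂ x z = y from (chartAt ℂ x).right_inv hy.2] at hder
    have hcf := chartFactor_ne_zero hzx
    obtain ⟨sz, hsz⟩ : ∃ w : C3, w = s z := ⟨_, rfl⟩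
    have hva : CalabiYau.fieldVal f v z = sz + a • curveDeriv C3 f z := by
      rw [← hb, hsz]
      exact ha.symm
    -- The tangent vector `a` refers to the preferred chart at `z`, while `T` is the derivative in
    -- the chart at `x`.
    refine ⟨a / chartFactor x z, ?_⟩
    rw [hder, smul_smul, div_mul_cancel₀ _ hcf]
    have h1 : fieldRep f v x (f x) y = tangentCoordChange 𝓘(ℂ, C3) (f z) (f x) (f z) (CalabiYau.fieldVal f v z) :=
      hreal hzq _
    rw [h1, ← map_smul, hva, map_add, hsz]
  · intro H x₀
    obtain ⟨k, hk⟩ := hk x₀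
    set p := chartAt ℂ x₀ with hp
    set D := curveDomain C3 f x₀ (f x₀) with hD
    let T := deriv (curveRep C3 f x₀ (f x₀))
    let u := fieldRep f v x₀ (f x₀)
    have hDo : IsOpen D := isOpen_curveDomain hc x₀ (f x₀)
    have hTc : ContinuousOn (fun y => T y k) D := fun y hy =>
      ((EuclideanSpace.proj k : C3 →L[ℂ] ℂ).continuous.continuousAt.comp
        (hTd x₀ (f x₀) hy).continuousAt).continuousWithinAt
    let Y : Set ℂ := D ∩ (fun y => T y k) ⁻¹' {0}ᶜ
    have hYo : IsOpen Y := hTc.isOpen_inter_preimage hDo isOpen_compl_singleton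
    -- `S` is the representative of `u` modulo `T` whose `k`-th coordinate is zero: near `x₀` this
    -- normalisation trivialises the quotient bundle holomorphically.
    let S : ℂ → C3 := fun y => u y - ((T y k)⁻¹ • u y k) • T y
    have hS : DifferentiableOn ℂ S Y := by
      intro y hy
      have hyt : y ∈ p.target := hy.1.1
      have hzx : p.symm y ∈ (chartAt ℂ x₀).source := p.map_target hyt
      have hzq : f (p.symm y) ∈ (chartAt C3 (f x₀)).source := hy.1.2
      obtain ⟨c, hcx⟩ := H (p.symm y)
      have h1 := dbar_fieldRep hf.holomorphic (v := v) (hvd _ _ (hmem (p.symm y))) hzx hzq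
      have h2 := deriv_curveRep (W := C3) hf.holomorphic hzx hzq
      rw [show chartAt ℂ x₀ (p.symm y) = y from p.right_inv hyt] at h1 h2
      have h3 : dbar u y = (starRingEnd ℂ (chartFactor x₀ (p.symm y)) * c
          / chartFactor x₀ (p.symm y)) • T y := by
        refine h1.trans ?_
        change _ = _ • deriv (curveRep C3 f x₀ (f x₀)) y
        rw [h2, hcx, map_smul, smul_smul, smul_smul,
          div_mul_cancel₀ _ (chartFactor_ne_zero hzx)]
      exact (differentiableAt_sub_coeff_smul (hvd _ _ hy.1) (hTd _ _ hy.1) hy.2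
        h3).differentiableWithinAt
    let U : Set C := p.source ∩ p ⁻¹' Y
    have hUo : IsOpen U := p.isOpen_inter_preimage hYo
    let s : ∀ x : C, TangentSpace 𝓘(ℂ, C3) (f x) := fun x =>
      tangentCoordChange 𝓘(ℂ, C3) (f x₀) (f x) (f x) (S (p x))
    have hUq : ∀ x ∈ U, f x ∈ (chartAt C3 (f x₀)).source := by
      intro x hx
      have h1 : f (p.symm (p x)) ∈ (chartAt C3 (f x₀)).source := hx.2.1.2
      rwa [p.left_inv hx.1] at h1
    refine ⟨U, hUo, ⟨mem_chart_source ℂ x₀, hmem x₀, hk⟩, s, ?_, ?_⟩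
    · refine (contMDiffOn_holomorphic_section_iff hUq).2 ⟨hf.holomorphic.contMDiffOn, ?_⟩
      have h1 : ContMDiffOn 𝓘(ℂ, ℂ) 𝓘(ℂ, C3) ∞ (S ∘ extChartAt 𝓘(ℂ, ℂ) x₀) U :=
        (hS.contDiffOn hYo).contMDiffOn.comp
          ((contMDiffOn_extChartAt (I := 𝓘(ℂ, ℂ)) (x := x₀)).mono fun x hx => hx.1)
          fun x hx => hx.2
      refine h1.congr fun x hx => ?_
      have hq := hUq x hx
      change tangentCoordChange 𝓘(ℂ, C3) (f x) (f x₀) (f x)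
        (tangentCoordChange 𝓘(ℂ, C3) (f x₀) (f x) (f x) (S (p x))) = S (p x)
      rw [tangentCoordChange_comp (by simpa using hq), tangentCoordChange_self (by simpa using hq)]
    · intro x hx
      have hq := hUq x hx
      have h2 := deriv_curveRep (W := C3) hf.holomorphic hx.1 hq
      obtain ⟨h, hh⟩ : ∃ h : ℂ, h = (T (p x) k)⁻¹ • u (p x) k := ⟨_, rfl⟩
      have hSx : S (p x) = u (p x) - (h * chartFactor x₀ x) •
          tangentCoordChange 𝓘(ℂ, C3) (f x) (f x₀) (f x) (curveDeriv C3 f x) := by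
        rw [mul_smul, ← h2, hh]
      have hu : u (p x) = tangentCoordChange 𝓘(ℂ, C3) (f x) (f x₀) (f x) (CalabiYau.fieldVal f v x) := by
        have h3 : u (p x) = chartRep f v (f x₀) (p.symm (p x)) := rfl
        rw [h3, p.left_inv hx.1]
        exact hreal hq _
      have hinv : ∀ w : C3, tangentCoordChange 𝓘(ℂ, C3) (f x₀) (f x) (f x)
          (tangentCoordChange 𝓘(ℂ, C3) (f x) (f x₀) (f x) w) = w := by
        intro w
        rw [tangentCoordChange_comp (by simpa using hq), tangentCoordChange_self (by simp)]
      obtain ⟨sx, hsx'⟩ : ∃ w : C3, w = s x := ⟨_, rfl⟩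
      have hsx : sx = CalabiYau.fieldVal f v x - (h * chartFactor x₀ x) • curveDeriv C3 f x := by
        have h4 : sx = tangentCoordChange 𝓘(ℂ, C3) (f x₀) (f x) (f x) (S (p x)) := hsx'
        rw [h4, hSx, hu, map_sub, map_smul, hinv, hinv]
      refine ⟨(h * chartFactor x₀ x : ℂ), ?_⟩
      have hb := mfderiv_curve (W := C3) hf.holomorphic x (h * chartFactor x₀ x)
      refine (congrArg₂ (fun a b : C3 => a + b) (hsx'.symm.trans hsx) hb).trans ?_
      exact sub_add_cancel _ _

namespace CalabiYau

variable (X : CalabiYau V)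

/-- `F'` and `IF'` are orthogonal of equal length, so subtracting the projection onto their span
makes `∂̄v` normal without changing the pairing. A normal vector with vanishing pairing is zero by
`eq_zero_of_tri`, so `∂̄v` was tangent. -/
theorem diracPairing_eq_zero_iff (hf : IsComplexCurve f)
    (v : ∀ x : C, TangentSpace 𝓘(ℝ, C3) (f x)) (x : C) :
    (∀ w, X.diracPairing f v x w = 0) ↔ ∃ c : ℂ, dbarField f v x = c • curveDeriv C3 f x := by
  unfold diracPairing
  set F' := curveDeriv C3 f x with hF'
  set d := dbarField f v x with hd
  have hS := X.isSU3 (f x)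
  have hq := X.form_curveDeriv_pos hf x
  set q := X.form (f x) F' F' with hqd
  constructor
  · intro H
    have h1 : X.form (f x) (Complex.I • F') F' = 0 := by rw [hS.symm, hS.map_self_I]
    have h2 : X.form (f x) (Complex.I • F') (Complex.I • F') = q := hS.map_I _ _
    have h3 := hS.map_self_I F'
    have h4 := hS.eq_zero_of_tri (curveDeriv_ne_zero hf x)
      (n := d - ((X.form (f x) d F' / q) • F'
        + (X.form (f x) d (Complex.I • F') / q) • (Complex.I • F')))
      (by
        rw [map_sub, map_add, map_smul (X.form (f x)), map_smul (X.form (f x))]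
        simp only [sub_apply, add_apply, smul_apply, smul_eq_mul]
        rw [← hF', h1, ← hqd]
        field_simp
        ring)
      (by
        rw [map_sub, map_add, map_smul (X.form (f x)), map_smul (X.form (f x))]
        simp only [sub_apply, add_apply, smul_apply, smul_eq_mul]
        rw [← hF', h3, h2]
        field_simp
        ring)
      (fun w => (X.reVol_normal (f x) F' d w _ _).trans (H w))
    refine ⟨((X.form (f x) d F' / q : ℝ) : ℂ)
      + ((X.form (f x) d (Complex.I • F') / q : ℝ) : ℂ) * Complex.I, ?_⟩
    rw [add_smul, mul_smul]
    exact sub_eq_zero.1 h4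
  · rintro ⟨c, hc⟩ w
    rw [hc, reVol_apply, tri_smul₁, tri_self₀₁]
    simp

theorem mem_complexDiracKernel_iff_isHolomorphicNormal (hf : IsComplexCurve f)
    (v : ∀ x : C, TangentSpace 𝓘(ℝ, C3) (f x)) :
    v ∈ X.complexDiracKernel f ↔
      IsNormalSection 𝓘(ℝ, ℂ) X.g f v ∧ IsHolomorphicNormal f v := by
  rw [X.mem_complexDiracKernel_iff hf]
  refine and_congr_right fun hv => ?_
  rw [isHolomorphicNormal_iff hf hv.1]
  exact forall_congr' fun x => X.diracPairing_eq_zero_iff hf v x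

end CalabiYau

end AssocDef
namespace AssocDef

/-! ### Stokes' theorem in the plane. -/

section PlaneIntegrals

open MeasureTheory

/-- Integration by parts against the constant function `1`. -/
theorem integral_fderiv_eq_zero {h : ℂ → ℂ} (hd : ContDiff ℝ ∞ h) (hc : HasCompactSupport h)
    (a : ℂ) : ∫ y, fderiv ℝ h y a = 0 := by
  have h1 : Continuous fun y => fderiv ℝ h y a :=
    (hd.continuous_fderiv (by simp)).clm_apply continuous_const
  have h2 : HasCompactSupport fun y => fderiv ℝ h y a := (hc.fderiv ℝ).comp_left
    (g := fun L : ℂ →L[ℝ] ℂ => L a) (by simp)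
  have h3 := integral_mul_fderiv_eq_neg_fderiv_mul_of_integrable (μ := volume) (𝕜 := ℂ)
    (f := fun _ : ℂ => (1 : ℂ)) (g := h) (v := a) (by simp)
    (by simpa using h1.integrable_of_hasCompactSupport h2)
    (by simpa using hd.continuous.integrable_of_hasCompactSupport hc)
    (fun _ _ => differentiableAt_const _) (fun _ _ => hd.differentiable (by simp) _)
  simpa using h3

theorem integral_dbar_eq_zero {h : ℂ → ℂ} (hd : ContDiff ℝ ∞ h) (hc : HasCompactSupport h) :
    ∫ y, dbar h y = 0 := by
  have h1 : ∀ a : ℂ, Integrable fun y => fderiv ℝ h y a := fun a =>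
    ((hd.continuous_fderiv (by simp)).clm_apply continuous_const).integrable_of_hasCompactSupport
      ((hc.fderiv ℝ).comp_left (g := fun L : ℂ →L[ℝ] ℂ => L a) (by simp))
  have h2 : Integrable fun y => Complex.I • fderiv ℝ h y Complex.I := (h1 Complex.I).smul Complex.I
  unfold dbar
  rw [integral_add (h1 1) h2, integral_smul,
    integral_fderiv_eq_zero hd hc, integral_fderiv_eq_zero hd hc, smul_zero, add_zero]

end PlaneIntegrals

/-! ### Densities on a curve and their integrals over a chart. -/

section Densities

open MeasureTheory

variable {C : Type*} [TopologicalSpace C] [ChartedSpace ℂ C]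

/-- The chart image of `K` is compact, hence closed in `ℂ`, and contains the support. Extension by
zero outside the chart is therefore as regular as `g` itself. -/
theorem tsupport_indicator_target {E : Type*} [Zero E] {p : C} {K : Set C} (hK : IsCompact K)
    (hKp : K ⊆ (chartAt ℂ p).source) {g : ℂ → E}
    (hg : ∀ y ∈ (chartAt ℂ p).target, (chartAt ℂ p).symm y ∉ K → g y = 0) :
    tsupport ((chartAt ℂ p).target.indicator g) ⊆ (chartAt ℂ p) '' K ∧
      IsCompact ((chartAt ℂ p) '' K) ∧ (chartAt ℂ p) '' K ⊆ (chartAt ℂ p).target := by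
  have h1 : IsCompact ((chartAt ℂ p) '' K) :=
    hK.image_of_continuousOn ((chartAt ℂ p).continuousOn.mono hKp)
  refine ⟨closure_minimal ?_ h1.isClosed, h1, ?_⟩
  · intro y hy
    rw [Function.mem_support] at hy
    have hyt : y ∈ (chartAt ℂ p).target := by
      by_contra hc
      exact hy (Set.indicator_of_notMem hc _)
    rw [Set.indicator_of_mem hyt] at hy
    by_contra hc
    refine hy (hg y hyt fun hyK => hc ⟨_, hyK, (chartAt ℂ p).right_inv hyt⟩)
  · rintro _ ⟨x, hx, rfl⟩
    exact (chartAt ℂ p).map_source (hKp hx)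

theorem hasCompactSupport_indicator_target {E : Type*} [Zero E] {p : C} {K : Set C}
    (hK : IsCompact K) (hKp : K ⊆ (chartAt ℂ p).source) {g : ℂ → E}
    (hg : ∀ y ∈ (chartAt ℂ p).target, (chartAt ℂ p).symm y ∉ K → g y = 0) :
    HasCompactSupport ((chartAt ℂ p).target.indicator g) := by
  obtain ⟨h1, h2, -⟩ := tsupport_indicator_target hK hKp hg
  exact h2.of_isClosed_subset (isClosed_tsupport _) h1

theorem continuous_indicator_target {E : Type*} [TopologicalSpace E] [Zero E] {p : C} {K : Set C}
    (hK : IsCompact K) (hKp : K ⊆ (chartAt ℂ p).source) {g : ℂ → E}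
    (hg : ∀ y ∈ (chartAt ℂ p).target, (chartAt ℂ p).symm y ∉ K → g y = 0)
    (hc : ContinuousOn g (chartAt ℂ p).target) :
    Continuous ((chartAt ℂ p).target.indicator g) := by
  obtain ⟨h1, -, h3⟩ := tsupport_indicator_target hK hKp hg
  exact (hc.congr fun y hy => Set.indicator_of_mem hy _).continuous_of_tsupport_subset
    (chartAt ℂ p).open_target (h1.trans h3)

theorem contDiff_indicator_target {E : Type*} [NormedAddCommGroup E] [NormedSpace ℝ E] {p : C}
    {K : Set C} (hK : IsCompact K) (hKp : K ⊆ (chartAt ℂ p).source) {g : ℂ → E}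
    (hg : ∀ y ∈ (chartAt ℂ p).target, (chartAt ℂ p).symm y ∉ K → g y = 0)
    (hc : ContDiffOn ℝ ∞ g (chartAt ℂ p).target) :
    ContDiff ℝ ∞ ((chartAt ℂ p).target.indicator g) := by
  obtain ⟨h1, -, h3⟩ := tsupport_indicator_target hK hKp hg
  rw [← contMDiff_iff_contDiff]
  refine contMDiff_of_tsupport fun y hy => ?_
  rw [contMDiffAt_iff_contDiffAt]
  exact (hc.congr fun y hy => Set.indicator_of_mem hy _).contDiffAt
    ((chartAt ℂ p).open_target.mem_nhds (h3 (h1 hy)))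

variable [IsManifold 𝓘(ℂ, ℂ) ∞ C]

/-- The density `θ`, given at each point with respect to the preferred chart at that point, in the
chart at `p`. -/
def densityRep (p : C) (θ : C → ℝ) (y : ℂ) : ℝ :=
  Complex.normSq (chartFactor p ((chartAt ℂ p).symm y)) * θ ((chartAt ℂ p).symm y)

/-- The density `θ` is continuous. -/
def IsContDensity (θ : C → ℝ) : Prop :=
  ∀ p : C, ContinuousOn (densityRep p θ) (chartAt ℂ p).target

theorem IsContDensity.mul {θ : C → ℝ} (h : IsContDensity θ) {u : C → ℝ} (hu : Continuous u) :
    IsContDensity fun x => u x * θ x := by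
  intro p
  have h1 : ContinuousOn (fun y => u ((chartAt ℂ p).symm y)) (chartAt ℂ p).target :=
    hu.comp_continuousOn (chartAt ℂ p).continuousOn_symm
  exact ((h p).mul h1).congr fun y _ => by simp only [densityRep, Pi.mul_apply]; ring

/-- The integral over the chart at `p` of the density `θ`. -/
def chartIntegral (p : C) (θ : C → ℝ) : ℝ := ∫ y in (chartAt ℂ p).target, densityRep p θ y

theorem chartIntegral_eq (p : C) (θ : C → ℝ) :
    chartIntegral p θ = ∫ y, (chartAt ℂ p).target.indicator (densityRep p θ) y :=
  (integral_indicator (chartAt ℂ p).open_target.measurableSet).symm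

theorem integrableOn_densityRep {p : C} {θ : C → ℝ} (h : IsContDensity θ) {K : Set C}
    (hK : IsCompact K) (hKp : K ⊆ (chartAt ℂ p).source) (hθ : ∀ x ∉ K, θ x = 0) :
    IntegrableOn (densityRep p θ) (chartAt ℂ p).target := by
  have hg : ∀ y ∈ (chartAt ℂ p).target, (chartAt ℂ p).symm y ∉ K → densityRep p θ y = 0 := by
    intro y _ hy
    rw [densityRep, hθ _ hy, mul_zero]
  exact (integrable_indicator_iff (chartAt ℂ p).open_target.measurableSet).1
    ((continuous_indicator_target hK hKp hg (h p)).integrable_of_hasCompactSupport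
      (hasCompactSupport_indicator_target hK hKp hg))

theorem chartIntegral_sum {ι : Type*} (s : Finset ι) {p : C} {θ : ι → C → ℝ}
    (h : ∀ i ∈ s, IsContDensity (θ i)) {K : Set C} (hK : IsCompact K)
    (hKp : K ⊆ (chartAt ℂ p).source) (hθ : ∀ i ∈ s, ∀ x ∉ K, θ i x = 0) :
    chartIntegral p (fun x => ∑ i ∈ s, θ i x) = ∑ i ∈ s, chartIntegral p (θ i) := by
  unfold chartIntegral
  rw [← integral_finsetSum s fun i hi => integrableOn_densityRep (h i hi) hK hKp (hθ i hi)]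
  simp only [densityRep, Finset.mul_sum]

theorem chartFactor_trans {p p' x : C} (hx : x ∈ (chartAt ℂ p).source)
    (hx' : x ∈ (chartAt ℂ p').source) :
    chartFactor p x = chartFactor p' x * tangentCoordChange 𝓘(ℂ, ℂ) p p' x 1 := by
  have h1 := tangentCoordChange_comp (I := 𝓘(ℂ, ℂ)) (w := p) (x := p') (y := x) (z := x) (v := 1)
    (by simpa using ⟨hx, hx'⟩)
  rw [chartFactor, ← h1]
  have h2 := (tangentCoordChange 𝓘(ℂ, ℂ) p' x x).map_smul (tangentCoordChange 𝓘(ℂ, ℂ) p p' x 1) 1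
  rw [smul_eq_mul, mul_one, smul_eq_mul, mul_comm] at h2
  exact h2

theorem det_restrictScalars_complex (L : ℂ →L[ℂ] ℂ) :
    (L.restrictScalars ℝ).det = Complex.normSq (L 1) := by
  have h1 : (L.restrictScalars ℝ).det = Algebra.norm ℝ (L : ℂ →ₗ[ℂ] ℂ).det :=
    LinearMap.det_restrictScalars (R := ℝ) (S := ℂ) (A := ℂ) (f := (L : ℂ →ₗ[ℂ] ℂ))
  rw [h1, Algebra.norm_complex_apply, LinearMap.det_ring]
  rfl

/-- The change of variables formula for densities. -/
theorem chartIntegral_congr {p p' : C} {θ : C → ℝ}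
    (hθ : ∀ x, x ∉ (chartAt ℂ p).source ∩ (chartAt ℂ p').source → θ x = 0) :
    chartIntegral p θ = chartIntegral p' θ := by
  have key : ∀ q q' : C, (∀ x, x ∉ (chartAt ℂ q).source ∩ (chartAt ℂ q').source → θ x = 0) →
      chartIntegral q θ = ∫ y in (chartAt ℂ q).target ∩ (chartAt ℂ q).symm ⁻¹' (chartAt ℂ q').source,
        densityRep q θ y := by
    intro q q' h
    refine setIntegral_eq_of_subset_of_forall_sdiff_eq_zero (μ := volume) (f := densityRep q θ)
      (chartAt ℂ q).open_target.measurableSet Set.inter_subset_left ?_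
    rintro y ⟨hy, hy'⟩
    rw [densityRep, h, mul_zero]
    exact fun hc => hy' ⟨hy, hc.2⟩
  rw [key p p' hθ, key p' p (by rwa [Set.inter_comm] at hθ)]
  set s := (chartAt ℂ p).target ∩ (chartAt ℂ p).symm ⁻¹' (chartAt ℂ p').source with hs
  set τ : ℂ → ℂ := fun w => chartAt ℂ p' ((chartAt ℂ p).symm w) with hτ
  have hso : IsOpen s := (chartAt ℂ p).isOpen_inter_preimage_symm (chartAt ℂ p').open_source
  have himg : τ '' s
      = (chartAt ℂ p').target ∩ (chartAt ℂ p').symm ⁻¹' (chartAt ℂ p).source := by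
    ext y
    constructor
    · rintro ⟨w, hw, rfl⟩
      refine ⟨(chartAt ℂ p').map_source hw.2, ?_⟩
      have : (chartAt ℂ p').symm (τ w) = (chartAt ℂ p).symm w := (chartAt ℂ p').left_inv hw.2
      rw [Set.mem_preimage, this]
      exact (chartAt ℂ p).map_target hw.1
    · rintro ⟨hy, hy'⟩
      refine ⟨chartAt ℂ p ((chartAt ℂ p').symm y), ⟨(chartAt ℂ p).map_source hy', ?_⟩, ?_⟩
      · rw [Set.mem_preimage, (chartAt ℂ p).left_inv hy']
        exact (chartAt ℂ p').map_target hy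
      · rw [hτ]
        simp only
        rw [(chartAt ℂ p).left_inv hy', (chartAt ℂ p').right_inv hy]
  have hinj : Set.InjOn τ s := by
    intro a ha b hb hab
    have h1 := congrArg (chartAt ℂ p').symm hab
    simp only [hτ] at h1
    rw [(chartAt ℂ p').left_inv ha.2, (chartAt ℂ p').left_inv hb.2] at h1
    exact (chartAt ℂ p).symm.injOn ha.1 hb.1 h1
  have hder : ∀ y ∈ s, HasFDerivWithinAt τ
      ((tangentCoordChange 𝓘(ℂ, ℂ) p p' ((chartAt ℂ p).symm y)).restrictScalars ℝ) s y := by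
    intro y hy
    have h1 := (hasFDerivAt_chart_trans (W := ℂ) ((chartAt ℂ p).map_target hy.1) hy.2)
    rw [(chartAt ℂ p).right_inv hy.1] at h1
    exact (h1.restrictScalars ℝ).hasFDerivWithinAt
  -- The real Jacobian of a holomorphic transition map is the squared modulus of its derivative,
  -- which is the ratio of the squared chart factors in `densityRep`.
  rw [← himg, integral_image_eq_integral_abs_det_fderiv_smul volume hso.measurableSet hder hinj]
  refine setIntegral_congr_fun hso.measurableSet fun y hy => ?_
  have h1 : (chartAt ℂ p').symm (τ y) = (chartAt ℂ p).symm y := (chartAt ℂ p').left_inv hy.2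
  simp only [densityRep, h1, det_restrictScalars_complex, smul_eq_mul]
  rw [abs_of_nonneg (Complex.normSq_nonneg _),
    chartFactor_trans ((chartAt ℂ p).map_target hy.1) hy.2, Complex.normSq_mul]
  ring

end Densities

end AssocDef
namespace AssocDef

/-! ### Stokes' theorem for `Ω(·, v, w)` in a chart. -/

theorem alternating_apply_eq_det (Ω : C3 [⋀^Fin 3]→L[ℂ] ℂ) (a b c : C3) :
    Ω ![a, b, c] = Ω (EuclideanSpace.basisFun (Fin 3) ℂ).toBasis *
      (a 0 * (b 1 * c 2 - b 2 * c 1) - a 1 * (b 0 * c 2 - b 2 * c 0)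
        + a 2 * (b 0 * c 1 - b 1 * c 0)) := by
  have h := congrArg (fun φ : C3 [⋀^Fin 3]→ₗ[ℂ] ℂ => φ ![a, b, c])
    (AlternatingMap.eq_smul_basis_det (EuclideanSpace.basisFun (Fin 3) ℂ).toBasis
      Ω.toAlternatingMap)
  refine h.trans ?_
  rw [AlternatingMap.smul_apply, Module.Basis.det_apply, Matrix.det_fin_three]
  simp only [Module.Basis.toMatrix_apply, OrthonormalBasis.coe_toBasis_repr_apply,
    EuclideanSpace.basisFun_repr, smul_eq_mul, Matrix.cons_val]
  refine congrArg₂ (· * ·) rfl ?_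
  ring

theorem ContDiffOn.alternating_apply {S : Set ℂ} {Ω : ℂ → C3 [⋀^Fin 3]→L[ℂ] ℂ} {a b c : ℂ → C3}
    (hΩ : ContDiffOn ℝ ∞ Ω S) (ha : ContDiffOn ℝ ∞ a S) (hb : ContDiffOn ℝ ∞ b S)
    (hc : ContDiffOn ℝ ∞ c S) : ContDiffOn ℝ ∞ (fun y => Ω y ![a y, b y, c y]) S := by
  have hcoord : ∀ {u : ℂ → C3}, ContDiffOn ℝ ∞ u S → ∀ i, ContDiffOn ℝ ∞ (fun y => u y i) S :=
    fun hu i => ((EuclideanSpace.proj i : C3 →L[ℂ] ℂ).restrictScalars ℝ).contDiff.comp_contDiffOn hu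
  have h0 : ContDiffOn ℝ ∞ (fun y => Ω y (EuclideanSpace.basisFun (Fin 3) ℂ).toBasis) S :=
    ((ContinuousAlternatingMap.apply ℂ C3 ℂ
      (EuclideanSpace.basisFun (Fin 3) ℂ).toBasis).restrictScalars ℝ).contDiff.comp_contDiffOn hΩ
  simp only [alternating_apply_eq_det]
  have a0 := hcoord ha 0
  have a1 := hcoord ha 1
  have a2 := hcoord ha 2
  have b0 := hcoord hb 0
  have b1 := hcoord hb 1
  have b2 := hcoord hb 2
  have c0 := hcoord hc 0
  have c1 := hcoord hc 1
  have c2 := hcoord hc 2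
  exact h0.mul (((a0.mul ((b1.mul c2).sub (b2.mul c1))).sub
    (a1.mul ((b0.mul c2).sub (b2.mul c0)))).add (a2.mul ((b0.mul c1).sub (b1.mul c0))))

/-- The product rule for the Cauchy-Riemann operator. -/
theorem dbar_alternating_apply {y : ℂ} {Ω : ℂ → C3 [⋀^Fin 3]→L[ℂ] ℂ} {a b c : ℂ → C3}
    (hΩ : DifferentiableAt ℝ Ω y) (ha : DifferentiableAt ℝ a y) (hb : DifferentiableAt ℝ b y)
    (hc : DifferentiableAt ℝ c y) :
    dbar (fun z => Ω z ![a z, b z, c z]) y = dbar Ω y ![a y, b y, c y]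
      + (Ω y ![dbar a y, b y, c y] + Ω y ![a y, dbar b y, c y] + Ω y ![a y, b y, dbar c y]) := by
  let L : (C3 [⋀^Fin 3]→L[ℂ] ℂ) →L[ℝ] (C3 [⋀^Fin 3]→L[ℝ] ℂ) :=
    ContinuousAlternatingMap.restrictScalarsCLM ℝ
  have hL : HasFDerivAt (fun z => L (Ω z)) (L.comp (fderiv ℝ Ω y)) y :=
    L.hasFDerivAt.comp y hΩ.hasFDerivAt
  have hg : ∀ i, DifferentiableAt ℝ ((![a, b, c] : Fin 3 → ℂ → C3) i) y := by
    intro i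
    fin_cases i
    · exact ha
    · exact hb
    · exact hc
  have hm : ∀ z, (fun i => (![a, b, c] : Fin 3 → ℂ → C3) i z) = ![a z, b z, c z] := by
    intro z
    funext i
    fin_cases i <;> rfl
  have hfun : (fun z => Ω z ![a z, b z, c z])
      = fun z => L (Ω z) (fun i => (![a, b, c] : Fin 3 → ℂ → C3) i z) := by
    funext z
    rw [hm]
    rfl
  have key : ∀ t : ℂ, fderiv ℝ (fun z => Ω z ![a z, b z, c z]) y t
      = fderiv ℝ Ω y t ![a y, b y, c y] + (Ω y ![fderiv ℝ a y t, b y, c y]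
        + Ω y ![a y, fderiv ℝ b y t, c y] + Ω y ![a y, b y, fderiv ℝ c y t]) := by
    intro t
    rw [hfun, fderiv_continuousAlternatingMap_apply_apply hL.differentiableAt hg, hL.fderiv, hm,
      Fin.sum_univ_three]
    have hu : ∀ i w, Function.update ![a y, b y, c y] i w
        = ![if i = 0 then w else a y, if i = 1 then w else b y, if i = 2 then w else c y] := by
      intro i w
      funext j
      fin_cases i <;> fin_cases j <;> rfl
    simp only [hu]
    rfl
  have hsplit : ∀ (A B : C3 [⋀^Fin 3]→L[ℂ] ℂ) (m : Fin 3 → C3),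
      (A + Complex.I • B) m = A m + Complex.I * B m := fun _ _ _ => rfl
  unfold dbar
  rw [key, key, hsplit]
  simp only [tri_add₀, tri_add₁, tri_add₂, tri_smul₀, tri_smul₁, tri_smul₂, smul_eq_mul]
  ring

variable {V : Type*} [TopologicalSpace V] [ChartedSpace C3 V] [IsManifold 𝓘(ℂ, C3) ∞ V]
  {C : Type*} [TopologicalSpace C] [ChartedSpace ℂ C] [IsManifold 𝓘(ℂ, ℂ) ∞ C] {f : C → V}

namespace CalabiYau

variable (X : CalabiYau V)

/-- The 1-form `Ω(·, v, w)` on the curve, in the chart at `p`. -/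
def volOneForm (f : C → V) (v w : ∀ x : C, TangentSpace 𝓘(ℝ, C3) (f x)) (p : C) (y : ℂ) : ℂ :=
  X.vol (f ((chartAt ℂ p).symm y)) ![chartFactor p ((chartAt ℂ p).symm y) •
    curveDeriv C3 f ((chartAt ℂ p).symm y), fieldVal f v ((chartAt ℂ p).symm y),
    fieldVal f w ((chartAt ℂ p).symm y)]

/-- The exterior derivative of `Ω(·, v, w)` on the curve, as a density. -/
def stokesDensity (f : C → V) (v w : ∀ x : C, TangentSpace 𝓘(ℝ, C3) (f x)) (x : C) : ℝ :=
  (X.vol (f x) ![curveDeriv C3 f x, dbarField f v x, fieldVal f w x]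
    + X.vol (f x) ![curveDeriv C3 f x, fieldVal f v x, dbarField f w x]).im

/-- `volOneForm` is defined with the preferred charts at each point; here it is expressed in one
target chart, where it can be differentiated. The chart factor in its definition supplies the
derivative of the curve in the chart at `p`. -/
theorem volOneForm_eq (hf : ContMDiff 𝓘(ℂ, ℂ) 𝓘(ℂ, C3) ∞ f)
    (v w : ∀ x : C, TangentSpace 𝓘(ℝ, C3) (f x)) {p : C} {q : V} {y : ℂ}
    (hy : y ∈ curveDomain C3 f p q) :
    X.volOneForm f v w p y = volInChart X.Ω q (curveRep C3 f p q y)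
      ![deriv (curveRep C3 f p q) y, fieldRep f v p q y, fieldRep f w p q y] := by
  set x := (chartAt ℂ p).symm y with hx
  have hxp : x ∈ (chartAt ℂ p).source := (chartAt ℂ p).map_target hy.1
  have hxq : f x ∈ (chartAt C3 q).source := hy.2
  have hder := deriv_curveRep (W := C3) hf hxp hxq
  rw [show chartAt ℂ p x = y from (chartAt ℂ p).right_inv hy.1] at hder
  have h1 := X.vol_eq_volInChart hxq ![chartFactor p x • curveDeriv C3 f x, fieldVal f v x,
    fieldVal f w x]
  refine h1.trans ?_
  change volInChart X.Ω q (curveRep C3 f p q y) _ = _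
  have hreal : ∀ u : C3, tangentCoordChange 𝓘(ℂ, C3) (f x) q (f x) u
      = tangentCoordChange 𝓘(ℝ, C3) (f x) q (f x) u := by
    intro u
    rw [tangentCoordChange_real (mem_chart_source C3 (f x)) hxq]
    rfl
  congr 1
  funext i
  fin_cases i
  · refine Eq.trans ?_ hder.symm
    exact map_smul _ _ _
  · exact hreal _
  · exact hreal _

theorem contDiffOn_volOneForm (hf : ContMDiff 𝓘(ℂ, ℂ) 𝓘(ℂ, C3) ∞ f)
    {v w : ∀ x : C, TangentSpace 𝓘(ℝ, C3) (f x)}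
    (hv : ContMDiff 𝓘(ℝ, ℂ) 𝓘(ℝ, C3).tangent ∞
      (fun x => (⟨f x, v x⟩ : TangentBundle 𝓘(ℝ, C3) V)))
    (hw : ContMDiff 𝓘(ℝ, ℂ) 𝓘(ℝ, C3).tangent ∞
      (fun x => (⟨f x, w x⟩ : TangentBundle 𝓘(ℝ, C3) V))) (p : C) :
    ContDiffOn ℝ ∞ (X.volOneForm f v w p) (chartAt ℂ p).target := by
  intro y hy
  set q := f ((chartAt ℂ p).symm y) with hq
  have hD : IsOpen (curveDomain C3 f p q) := isOpen_curveDomain hf.continuous p q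
  have hyD : y ∈ curveDomain C3 f p q := ⟨hy, mem_chart_source C3 q⟩
  have hrep := contDiffOn_curveRep (W := C3) hf p q
  have h1 : ContDiffOn ℝ ∞ (fun y => volInChart X.Ω q (curveRep C3 f p q y)
      ![deriv (curveRep C3 f p q) y, fieldRep f v p q y, fieldRep f w p q y])
      (curveDomain C3 f p q) := by
    refine ContDiffOn.alternating_apply ?_ ?_ (contDiffOn_fieldRep hv p q)
      (contDiffOn_fieldRep hw p q)
    · refine (X.contDiffOn_volInChart q).comp (hrep.restrict_scalars ℝ) fun z hz => ?_
      exact (chartAt C3 q).map_source hz.2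
    · exact (hrep.deriv_of_isOpen hD (by simp)).restrict_scalars ℝ
  exact ((h1.congr fun z hz => X.volOneForm_eq hf v w hz).contDiffAt
    (hD.mem_nhds hyD)).contDiffWithinAt

/-- Of the four terms of the product rule, the one differentiating `Ω` vanishes because `Ω` is
parallel, and the one differentiating the velocity because the curve is holomorphic. In the others
the chart factor meets its conjugate, so the result transforms as a density. -/
theorem dbar_volOneForm (hf : ContMDiff 𝓘(ℂ, ℂ) 𝓘(ℂ, C3) ∞ f)
    {v w : ∀ x : C, TangentSpace 𝓘(ℝ, C3) (f x)}
    (hv : ContMDiff 𝓘(ℝ, ℂ) 𝓘(ℝ, C3).tangent ∞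
      (fun x => (⟨f x, v x⟩ : TangentBundle 𝓘(ℝ, C3) V)))
    (hw : ContMDiff 𝓘(ℝ, ℂ) 𝓘(ℝ, C3).tangent ∞
      (fun x => (⟨f x, w x⟩ : TangentBundle 𝓘(ℝ, C3) V))) {p x : C}
    (hx : x ∈ (chartAt ℂ p).source) :
    dbar (X.volOneForm f v w p) (chartAt ℂ p x) = Complex.normSq (chartFactor p x) *
      (X.vol (f x) ![curveDeriv C3 f x, dbarField f v x, fieldVal f w x]
        + X.vol (f x) ![curveDeriv C3 f x, fieldVal f v x, dbarField f w x]) := by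
  set q := f x with hq
  set y := chartAt ℂ p x with hy
  have hyx : (chartAt ℂ p).symm y = x := (chartAt ℂ p).left_inv hx
  have hD : IsOpen (curveDomain C3 f p q) := isOpen_curveDomain hf.continuous p q
  have hyD : y ∈ curveDomain C3 f p q := mem_curveDomain hx (mem_chart_source C3 q)
  have hrep := contDiffOn_curveRep (W := C3) hf p q
  have hdv : ∀ {u : ∀ x : C, TangentSpace 𝓘(ℝ, C3) (f x)}, ContMDiff 𝓘(ℝ, ℂ) 𝓘(ℝ, C3).tangent ∞
      (fun x => (⟨f x, u x⟩ : TangentBundle 𝓘(ℝ, C3) V)) → ∀ (p : C) (q : V) {y : ℂ},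
      y ∈ curveDomain C3 f p q → DifferentiableAt ℝ (fieldRep f u p q) y := fun hu p q y hy =>
    ((contDiffOn_fieldRep hu p q).differentiableOn (by simp)).differentiableAt
      ((isOpen_curveDomain hf.continuous p q).mem_nhds hy)
  have hxx : chartAt ℂ x x ∈ curveDomain C3 f x q :=
    mem_curveDomain (mem_chart_source ℂ x) (mem_chart_source C3 q)
  have hT : DifferentiableAt ℂ (deriv (curveRep C3 f p q)) y :=
    ((hrep.deriv_of_isOpen (n := ∞) (m := ∞) hD (by simp)).differentiableOn
      (by simp)).differentiableAt (hD.mem_nhds hyD)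
  obtain ⟨hΩ, hΩ0⟩ := X.dbar_volInChart hf hx
  have h1 : X.volOneForm f v w p =ᶠ[nhds y] fun y => volInChart X.Ω q (curveRep C3 f p q y)
      ![deriv (curveRep C3 f p q) y, fieldRep f v p q y, fieldRep f w p q y] := by
    filter_upwards [hD.mem_nhds hyD] with z hz using X.volOneForm_eq hf v w hz
  have hself : ∀ u : C3, tangentCoordChange 𝓘(ℂ, C3) q q q u = u := fun u =>
    tangentCoordChange_self (by simp)
  have hTy : deriv (curveRep C3 f p q) y = chartFactor p x • curveDeriv C3 f x := by
    rw [hy, deriv_curveRep hf hx (mem_chart_source C3 q), hself]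
  have hdy : ∀ {u : ∀ x : C, TangentSpace 𝓘(ℝ, C3) (f x)}, ContMDiff 𝓘(ℝ, ℂ) 𝓘(ℝ, C3).tangent ∞
      (fun x => (⟨f x, u x⟩ : TangentBundle 𝓘(ℝ, C3) V)) →
      dbar (fieldRep f u p q) y = starRingEnd ℂ (chartFactor p x) • dbarField f u x := by
    intro u hu
    rw [hy, dbar_fieldRep hf (hdv hu x q hxx) hx (mem_chart_source C3 q), hself]
  have huy : ∀ u : ∀ x : C, TangentSpace 𝓘(ℝ, C3) (f x), fieldRep f u p q y = fieldVal f u x := by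
    intro u
    have : fieldRep f u p q y = chartRep f u q ((chartAt ℂ p).symm y) := rfl
    rw [this, hyx]
    exact chartRep_self f u x
  have hΩy : volInChart X.Ω q (curveRep C3 f p q y) = X.vol q := by
    have : curveRep C3 f p q y = chartAt C3 q q := by
      change chartAt C3 q (f ((chartAt ℂ p).symm y)) = _
      rw [hyx]
    rw [this, volInChart_self]
  rw [dbar_congr h1, dbar_alternating_apply hΩ (hT.restrictScalars ℝ) (hdv hv p q hyD)
    (hdv hw p q hyD), hΩ0, dbar_of_differentiableAt hT, hdy hv, hdy hw, hTy, huy, huy, hΩy]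
  have h0 : ∀ a b : C3, X.vol q ![0, a, b] = 0 := by
    intro a b
    have := tri_smul₀ (X.vol q) 0 0 a b
    rwa [zero_smul, zero_mul] at this
  have h00 : ∀ m : Fin 3 → C3, (0 : C3 [⋀^Fin 3]→L[ℂ] ℂ) m = 0 := fun _ => rfl
  simp only [h0, h00, tri_smul₀, tri_smul₁, tri_smul₂]
  rw [← Complex.mul_conj]
  ring

theorem isContDensity_stokesDensity (hf : ContMDiff 𝓘(ℂ, ℂ) 𝓘(ℂ, C3) ∞ f)
    {v w : ∀ x : C, TangentSpace 𝓘(ℝ, C3) (f x)}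
    (hv : ContMDiff 𝓘(ℝ, ℂ) 𝓘(ℝ, C3).tangent ∞
      (fun x => (⟨f x, v x⟩ : TangentBundle 𝓘(ℝ, C3) V)))
    (hw : ContMDiff 𝓘(ℝ, ℂ) 𝓘(ℝ, C3).tangent ∞
      (fun x => (⟨f x, w x⟩ : TangentBundle 𝓘(ℝ, C3) V))) (p : C) :
    (∀ y ∈ (chartAt ℂ p).target, densityRep p (X.stokesDensity f v w) y
      = (dbar (X.volOneForm f v w p) y).im) ∧
    ContinuousOn (densityRep p (X.stokesDensity f v w)) (chartAt ℂ p).target := by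
  have h1 : ∀ y ∈ (chartAt ℂ p).target, densityRep p (X.stokesDensity f v w) y
      = (dbar (X.volOneForm f v w p) y).im := by
    intro y hy
    have h2 := X.dbar_volOneForm hf hv hw ((chartAt ℂ p).map_target hy)
    rw [(chartAt ℂ p).right_inv hy] at h2
    rw [h2, Complex.im_ofReal_mul]
    rfl
  refine ⟨h1, ContinuousOn.congr ?_ h1⟩
  have h3 : ContinuousOn (fderiv ℝ (X.volOneForm f v w p)) (chartAt ℂ p).target :=
    (X.contDiffOn_volOneForm hf hv hw p).continuousOn_fderiv_of_isOpen (chartAt ℂ p).open_target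
      (by simp)
  exact Complex.continuous_im.comp_continuousOn ((h3.clm_apply continuousOn_const).add
    ((h3.clm_apply continuousOn_const).const_smul Complex.I))

/-- Stokes' theorem in a chart. -/
theorem chartIntegral_stokesDensity (hf : ContMDiff 𝓘(ℂ, ℂ) 𝓘(ℂ, C3) ∞ f)
    {v w : ∀ x : C, TangentSpace 𝓘(ℝ, C3) (f x)}
    (hv : ContMDiff 𝓘(ℝ, ℂ) 𝓘(ℝ, C3).tangent ∞
      (fun x => (⟨f x, v x⟩ : TangentBundle 𝓘(ℝ, C3) V)))
    (hw : ContMDiff 𝓘(ℝ, ℂ) 𝓘(ℝ, C3).tangent ∞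
      (fun x => (⟨f x, w x⟩ : TangentBundle 𝓘(ℝ, C3) V))) {p : C} {K : Set C} (hK : IsCompact K)
    (hKp : K ⊆ (chartAt ℂ p).source) (hvK : ∀ x ∉ K, fieldVal f v x = 0) :
    chartIntegral p (X.stokesDensity f v w) = 0 := by
  set h := (chartAt ℂ p).target.indicator (X.volOneForm f v w p) with hh
  have hg : ∀ y ∈ (chartAt ℂ p).target, (chartAt ℂ p).symm y ∉ K → X.volOneForm f v w p y = 0 := by
    intro y _ hy
    have := tri_smul₁ (X.vol (f ((chartAt ℂ p).symm y))) 0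
      (chartFactor p ((chartAt ℂ p).symm y) • curveDeriv C3 f ((chartAt ℂ p).symm y)) 0
      (fieldVal f w ((chartAt ℂ p).symm y))
    rw [zero_smul, zero_mul] at this
    rw [volOneForm, hvK _ hy, this]
  have hd : ContDiff ℝ ∞ h :=
    contDiff_indicator_target hK hKp hg (X.contDiffOn_volOneForm hf hv hw p)
  have hc : HasCompactSupport h := hasCompactSupport_indicator_target hK hKp hg
  have h1 := congrArg Complex.im (integral_dbar_eq_zero hd hc)
  have h2 : MeasureTheory.Integrable (dbar h) := by
    have k1 : ∀ a : ℂ, MeasureTheory.Integrable fun y => fderiv ℝ h y a := fun a =>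
      ((hd.continuous_fderiv (by simp)).clm_apply continuous_const).integrable_of_hasCompactSupport
        ((hc.fderiv ℝ).comp_left (g := fun L : ℂ →L[ℝ] ℂ => L a) (by simp))
    exact (k1 1).add ((k1 Complex.I).smul Complex.I)
  have h3 : ∫ y, (dbar h y).im = 0 := by
    rw [← Complex.zero_im, ← h1]
    exact integral_im h2
  rw [chartIntegral_eq, ← h3]
  congr 1
  funext y
  by_cases hy : y ∈ (chartAt ℂ p).target
  · rw [Set.indicator_of_mem hy, (X.isContDensity_stokesDensity hf hv hw p).1 y hy]
    congr 1
    refine dbar_congr ?_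
    filter_upwards [(chartAt ℂ p).open_target.mem_nhds hy] with z hz
    exact (Set.indicator_of_mem hz _).symm
  · rw [Set.indicator_of_notMem hy]
    obtain ⟨k1, -, k3⟩ := tsupport_indicator_target hK hKp hg
    have k4 : h =ᶠ[nhds y] fun _ => 0 :=
      notMem_tsupport_iff_eventuallyEq.1 fun hc => hy (k3 (k1 hc))
    rw [dbar_congr k4, dbar_of_differentiableAt (differentiableAt_const _)]
    simp

end CalabiYau

end AssocDef
namespace AssocDef

/-! ### The area measure of a compact curve and global Stokes. -/

section Densities

open MeasureTheory

variable {C : Type*} [TopologicalSpace C] [ChartedSpace ℂ C] [IsManifold 𝓘(ℂ, ℂ) ∞ C]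

theorem chartIntegral_add {p : C} {θ θ' : C → ℝ} (h : IsContDensity θ) (h' : IsContDensity θ')
    {K : Set C} (hK : IsCompact K) (hKp : K ⊆ (chartAt ℂ p).source) (hθ : ∀ x ∉ K, θ x = 0)
    (hθ' : ∀ x ∉ K, θ' x = 0) :
    chartIntegral p (fun x => θ x + θ' x) = chartIntegral p θ + chartIntegral p θ' := by
  unfold chartIntegral
  rw [← integral_add (integrableOn_densityRep h hK hKp hθ) (integrableOn_densityRep h' hK hKp hθ')]
  simp only [densityRep, mul_add]

theorem chartIntegral_const_mul (p : C) (c : ℝ) (θ : C → ℝ) :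
    chartIntegral p (fun x => c * θ x) = c * chartIntegral p θ := by
  unfold chartIntegral
  rw [← integral_const_mul]
  simp only [densityRep, mul_left_comm]

theorem chartIntegral_nonneg {p : C} {θ : C → ℝ} (h : ∀ x, 0 ≤ θ x) : 0 ≤ chartIntegral p θ :=
  integral_nonneg fun _ => mul_nonneg (Complex.normSq_nonneg _) (h _)

theorem eq_zero_of_chartIntegral_eq_zero {p : C} {θ : C → ℝ} (h : IsContDensity θ)
    (h0 : ∀ x, 0 ≤ θ x) {K : Set C} (hK : IsCompact K) (hKp : K ⊆ (chartAt ℂ p).source)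
    (hθ : ∀ x ∉ K, θ x = 0) (hi : chartIntegral p θ = 0) (x : C) : θ x = 0 := by
  by_cases hx : x ∈ K
  swap
  · exact hθ x hx
  have hg : ∀ y ∈ (chartAt ℂ p).target, (chartAt ℂ p).symm y ∉ K → densityRep p θ y = 0 := by
    intro y _ hy
    rw [densityRep, hθ _ hy, mul_zero]
  have hxp := hKp hx
  by_contra hc
  rw [chartIntegral_eq] at hi
  refine (Continuous.integral_pos_of_hasCompactSupport_nonneg_nonzero (μ := volume)
    (x := chartAt ℂ p x) (continuous_indicator_target hK hKp hg (h p))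
    (hasCompactSupport_indicator_target hK hKp hg) ?_ ?_).ne' hi
  · exact fun y => Set.indicator_nonneg
      (fun _ _ => mul_nonneg (Complex.normSq_nonneg _) (h0 _)) y
  · rw [Set.indicator_of_mem ((chartAt ℂ p).map_source hxp), densityRep,
      (chartAt ℂ p).left_inv hxp]
    exact mul_ne_zero ((map_ne_zero Complex.normSq).2 (chartFactor_ne_zero hxp)) hc

end Densities

variable {V : Type*} [TopologicalSpace V] [ChartedSpace C3 V] [IsManifold 𝓘(ℂ, C3) ∞ V]
  {C : Type*} [TopologicalSpace C] [ChartedSpace ℂ C] [IsManifold 𝓘(ℂ, ℂ) ∞ C] {f : C → V}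

/-- The product of a function and a vector field along `f`. -/
def smulField (ρ : C → ℝ) (v : ∀ x : C, TangentSpace 𝓘(ℝ, C3) (f x)) (x : C) :
    TangentSpace 𝓘(ℝ, C3) (f x) := ρ x • v x

theorem contMDiff_smulField (hf : ContMDiff 𝓘(ℝ, ℂ) 𝓘(ℝ, C3) ∞ f) {ρ : C → ℝ}
    (hρ : ContMDiff 𝓘(ℝ, ℂ) 𝓘(ℝ, ℝ) ∞ ρ) {v : ∀ x : C, TangentSpace 𝓘(ℝ, C3) (f x)}
    (hv : ContMDiff 𝓘(ℝ, ℂ) 𝓘(ℝ, C3).tangent ∞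
      (fun x => (⟨f x, v x⟩ : TangentBundle 𝓘(ℝ, C3) V))) :
    ContMDiff 𝓘(ℝ, ℂ) 𝓘(ℝ, C3).tangent ∞
      (fun x => (⟨f x, smulField ρ v x⟩ : TangentBundle 𝓘(ℝ, C3) V)) := by
  intro x
  have ho : IsOpen (f ⁻¹' (chartAt C3 (f x)).source) :=
    (chartAt C3 (f x)).open_source.preimage hf.continuous
  refine ((contMDiffOn_section_iff_chartRep (f := f) (q := f x)
    (s := f ⁻¹' (chartAt C3 (f x)).source) (fun _ h => h)).2
    ⟨hf.contMDiffOn, ?_⟩).contMDiffAt (ho.mem_nhds (mem_chart_source C3 (f x)))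
  refine (hρ.contMDiffOn.smul (contMDiffOn_chartRep hv (f x))).congr fun z _ => ?_
  exact map_smul (tangentCoordChange 𝓘(ℝ, C3) (f z) (f x) (f z)) (ρ z) (v z)

theorem dbarField_eq_zero {v : ∀ x : C, TangentSpace 𝓘(ℝ, C3) (f x)} {x : C}
    (h : ∀ᶠ z in nhds x, v z = 0) : dbarField f v x = 0 := by
  have h1 : fieldRep f v x (f x) =ᶠ[nhds (chartAt ℂ x x)] fun _ => 0 := by
    have hc := (chartAt ℂ x).symm.continuousAt ((chartAt ℂ x).map_source (mem_chart_source ℂ x))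
    rw [ContinuousAt, (chartAt ℂ x).left_inv (mem_chart_source ℂ x)] at hc
    filter_upwards [hc.eventually h] with y hy
    exact (congrArg (tangentCoordChange 𝓘(ℝ, C3) _ _ _) hy).trans
      (map_zero (tangentCoordChange 𝓘(ℝ, C3) _ _ _))
  rw [dbarField, dbar_congr h1, dbar_of_differentiableAt (differentiableAt_const _)]

theorem dbarField_sum {ι : Type*} [Fintype ι] (hf : Continuous f)
    {v : ∀ x : C, TangentSpace 𝓘(ℝ, C3) (f x)} {u : ι → ∀ x : C, TangentSpace 𝓘(ℝ, C3) (f x)}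
    (hu : ∀ i, ContMDiff 𝓘(ℝ, ℂ) 𝓘(ℝ, C3).tangent ∞
      (fun x => (⟨f x, u i x⟩ : TangentBundle 𝓘(ℝ, C3) V)))
    (h : ∀ x, v x = ∑ i, u i x) (x : C) : dbarField f v x = ∑ i, dbarField f (u i) x := by
  have h1 : fieldRep f v x (f x) = fun y => ∑ i, fieldRep f (u i) x (f x) y := by
    funext y
    refine (congrArg (tangentCoordChange 𝓘(ℝ, C3) _ _ _) (h _)).trans ?_
    exact map_sum (tangentCoordChange 𝓘(ℝ, C3) _ _ _) _ _
  have h2 : ∀ i ∈ Finset.univ, DifferentiableAt ℝ (fieldRep f (u i) x (f x)) (chartAt ℂ x x) :=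
    fun i _ => ((contDiffOn_fieldRep (hu i) x (f x)).differentiableOn (by simp)).differentiableAt
      ((isOpen_curveDomain hf x (f x)).mem_nhds
        (mem_curveDomain (mem_chart_source ℂ x) (mem_chart_source C3 (f x))))
  unfold dbarField dbar
  rw [h1, fderiv_fun_sum h2]
  simp only [sum_apply, Finset.smul_sum, Finset.sum_add_distrib]

namespace CalabiYau

variable (X : CalabiYau V)

/-- The area density of the curve. -/
def areaDensity (f : C → V) (x : C) : ℝ := X.form (f x) (curveDeriv C3 f x) (curveDeriv C3 f x)

theorem isContDensity_areaDensity (hf : ContMDiff 𝓘(ℂ, ℂ) 𝓘(ℂ, C3) ∞ f) :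
    IsContDensity (X.areaDensity f) := by
  intro p y hy
  set q := f ((chartAt ℂ p).symm y) with hq
  have hD : IsOpen (curveDomain C3 f p q) := isOpen_curveDomain hf.continuous p q
  have hyD : y ∈ curveDomain C3 f p q := ⟨hy, mem_chart_source C3 q⟩
  have hrep := contDiffOn_curveRep (W := C3) hf p q
  have h1 : ContinuousOn (fun y => X.chartForm q (curveRep C3 f p q y)
      (deriv (curveRep C3 f p q) y) (deriv (curveRep C3 f p q) y)) (curveDomain C3 f p q) := by
    have k1 : ContinuousOn (fun y => X.chartForm q (curveRep C3 f p q y)) (curveDomain C3 f p q) :=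
      (X.contDiffOn_chartForm q).continuousOn.comp hrep.continuousOn
        fun z hz => (chartAt C3 q).map_source hz.2
    have k2 : ContinuousOn (deriv (curveRep C3 f p q)) (curveDomain C3 f p q) :=
      (hrep.deriv_of_isOpen (n := ∞) (m := ∞) hD (by simp)).continuousOn
    exact (k1.clm_apply k2).clm_apply k2
  refine ((h1.congr fun z hz => ?_).continuousAt (hD.mem_nhds hyD)).continuousWithinAt
  set x := (chartAt ℂ p).symm z with hx
  have hxp : x ∈ (chartAt ℂ p).source := (chartAt ℂ p).map_target hz.1
  have hxq : f x ∈ (chartAt C3 q).source := hz.2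
  have hder := deriv_curveRep (W := C3) hf hxp hxq
  rw [show chartAt ℂ p x = z from (chartAt ℂ p).right_inv hz.1] at hder
  rw [densityRep, areaDensity, ← (X.isSU3 (f x)).map_smul_smul, X.form_eq_chartForm hxq, hder,
    ← map_smul]
  rw [tangentCoordChange_real (mem_chart_source C3 (f x)) hxq]
  rfl

theorem stokesDensity_eq_zero {v w : ∀ x : C, TangentSpace 𝓘(ℝ, C3) (f x)} {x : C}
    (h : ∀ᶠ z in nhds x, v z = 0) : X.stokesDensity f v w x = 0 := by
  have h0 : fieldVal f v x = 0 := h.self_of_nhds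
  have h1 := tri_smul₁ (X.vol (f x)) 0 (curveDeriv C3 f x) 0 (fieldVal f w x)
  have h2 := tri_smul₁ (X.vol (f x)) 0 (curveDeriv C3 f x) 0 (dbarField f w x)
  rw [zero_smul, zero_mul] at h1 h2
  rw [stokesDensity, dbarField_eq_zero h, h0, h1, h2, add_zero, Complex.zero_im]

theorem stokesDensity_sum {ι : Type*} [Fintype ι] (hf : Continuous f)
    {v w : ∀ x : C, TangentSpace 𝓘(ℝ, C3) (f x)} {u : ι → ∀ x : C, TangentSpace 𝓘(ℝ, C3) (f x)}
    (hu : ∀ i, ContMDiff 𝓘(ℝ, ℂ) 𝓘(ℝ, C3).tangent ∞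
      (fun x => (⟨f x, u i x⟩ : TangentBundle 𝓘(ℝ, C3) V)))
    (h : ∀ x, v x = ∑ i, u i x) (x : C) :
    X.stokesDensity f v w x = ∑ i, X.stokesDensity f (u i) w x := by
  have h0 : fieldVal f v x = ∑ i, fieldVal f (u i) x := h x
  have hs : ∀ (c : ι → C3) (b : C3), X.vol (f x) ![curveDeriv C3 f x, ∑ i, c i, b]
      = ∑ i, X.vol (f x) ![curveDeriv C3 f x, c i, b] := by
    intro c b
    let L : C3 →ₗ[ℂ] ℂ :=
      { toFun := fun a => X.vol (f x) ![curveDeriv C3 f x, a, b]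
        map_add' := fun _ _ => tri_add₁ _ _ _ _ _
        map_smul' := fun _ _ => tri_smul₁ _ _ _ _ _ }
    exact map_sum L c Finset.univ
  unfold stokesDensity
  rw [dbarField_sum hf hu h, h0, hs, hs, ← Finset.sum_add_distrib, Complex.im_sum]

open MeasureTheory in
/-- The area measure of a compact complex curve, and Stokes' theorem for `Ω(·, v, w)`. -/
theorem exists_areaMeasure [CompactSpace C] [T2Space C] [MeasurableSpace C] [BorelSpace C]
    (hf : IsComplexCurve f) : ∃ μ : Measure C, IsFiniteMeasure μ ∧
      (∀ u : C → ℝ, Continuous u → (∀ x, 0 ≤ u x) → ∫ x, u x ∂μ = 0 → ∀ x, u x = 0) ∧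
      ∀ v w : ∀ x : C, TangentSpace 𝓘(ℝ, C3) (f x),
        ContMDiff 𝓘(ℝ, ℂ) 𝓘(ℝ, C3).tangent ∞
          (fun x => (⟨f x, v x⟩ : TangentBundle 𝓘(ℝ, C3) V)) →
        ContMDiff 𝓘(ℝ, ℂ) 𝓘(ℝ, C3).tangent ∞
          (fun x => (⟨f x, w x⟩ : TangentBundle 𝓘(ℝ, C3) V)) →
        Continuous (fun x => X.stokesDensity f v w x / X.areaDensity f x) →
        ∫ x, X.stokesDensity f v w x / X.areaDensity f x ∂μ = 0 := by
  have hloc : LocallyCompactSpace C := ChartedSpace.locallyCompactSpace ℂ C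
  obtain ⟨t, -, ht⟩ := (isCompact_univ (X := C)).elim_nhds_subcover
    (fun x => (chartAt ℂ x).source) fun x _ => (chartAt ℂ x).open_source.mem_nhds
      (mem_chart_source ℂ x)
  obtain ⟨ρ, hρ⟩ := SmoothPartitionOfUnity.exists_isSubordinate 𝓘(ℝ, ℂ) (isClosed_univ (X := C))
    (fun i : t => (chartAt ℂ (i : C)).source) (fun i => (chartAt ℂ (i : C)).open_source)
    (fun x hx => by simpa using ht hx)
  have hρc : ∀ i, Continuous (ρ i) := fun i => (ρ i).contMDiff.continuous
  have hρ0 : ∀ i x, x ∉ tsupport (ρ i) → ρ i x = 0 := fun i x hx => image_eq_zero_of_notMem_tsupport hx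
  have hρ1 : ∀ x, ∑ i, ρ i x = 1 := fun x => by
    rw [← finsum_eq_sum_of_fintype]
    exact ρ.sum_eq_one (Set.mem_univ x)
  have hK : ∀ i, IsCompact (tsupport (ρ i)) := fun i => (isClosed_tsupport _).isCompact
  have hA := X.isContDensity_areaDensity hf.holomorphic
  have hApos : ∀ x, 0 < X.areaDensity f x := X.form_curveDeriv_pos hf
  have hden : ∀ i (u : C → ℝ), Continuous u →
      IsContDensity fun x => ρ i x * u x * X.areaDensity f x := fun i u hu =>
    hA.mul ((hρc i).mul hu)
  have hden0 : ∀ i (u : C → ℝ), ∀ x ∉ tsupport (ρ i), ρ i x * u x * X.areaDensity f x = 0 :=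
    fun i u x hx => by rw [hρ0 i x hx, zero_mul, zero_mul]
  -- Integration against the area density, assembled from charts with a partition of unity; the
  -- Riesz-Markov theorem turns this positive functional into a measure.
  let Λ₀ : CompactlySupportedContinuousMap C ℝ →ₗ[ℝ] ℝ :=
    { toFun := fun u => ∑ i : t, chartIntegral (i : C) fun x => ρ i x * u x * X.areaDensity f x
      map_add' := fun u u' => by
        rw [← Finset.sum_add_distrib]
        refine Finset.sum_congr rfl fun i _ => ?_
        rw [← chartIntegral_add (hden i u u.continuous) (hden i u' u'.continuous) (hK i) (hρ i)
          (hden0 i u) (hden0 i u')]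
        congr 1
        funext x
        simp only [CompactlySupportedContinuousMap.add_apply]
        ring
      map_smul' := fun c u => by
        rw [RingHom.id_apply, smul_eq_mul, Finset.mul_sum]
        refine Finset.sum_congr rfl fun i _ => ?_
        rw [← chartIntegral_const_mul]
        congr 1
        funext x
        simp only [CompactlySupportedContinuousMap.smul_apply, smul_eq_mul]
        ring }
  let Λ := PositiveLinearMap.mk₀ Λ₀ fun u hu => Finset.sum_nonneg fun i _ =>
    chartIntegral_nonneg fun x => mul_nonneg (mul_nonneg (ρ.nonneg i x)
      (CompactlySupportedContinuousMap.le_def.1 hu x)) (hApos x).le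
  have hΛ : ∀ u : C → ℝ, Continuous u → ∫ x, u x ∂(RealRMK.rieszMeasure Λ)
      = ∑ i : t, chartIntegral (i : C) fun x => ρ i x * u x * X.areaDensity f x := by
    intro u hu
    exact RealRMK.integral_rieszMeasure Λ ⟨⟨u, hu⟩, HasCompactSupport.of_compactSpace u⟩
  refine ⟨RealRMK.rieszMeasure Λ, inferInstance, fun u hu hu0 hint x => ?_,
    fun v w hv hw hcont => ?_⟩
  · rw [hΛ u hu, Finset.sum_eq_zero_iff_of_nonneg fun i _ => chartIntegral_nonneg fun x =>
      mul_nonneg (mul_nonneg (ρ.nonneg i x) (hu0 x)) (hApos x).le] at hint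
    have h1 : ∀ i, ρ i x * u x = 0 := fun i =>
      (mul_eq_zero.1 (eq_zero_of_chartIntegral_eq_zero (hden i u hu)
        (fun x => mul_nonneg (mul_nonneg (ρ.nonneg i x) (hu0 x)) (hApos x).le) (hK i) (hρ i)
        (hden0 i u) (hint i (Finset.mem_univ i)) x)).resolve_right (hApos x).ne'
    rw [← one_mul (u x), ← hρ1 x, Finset.sum_mul]
    exact Finset.sum_eq_zero fun i _ => h1 i
  · rw [hΛ _ hcont]
    have hvj : ∀ j, ContMDiff 𝓘(ℝ, ℂ) 𝓘(ℝ, C3).tangent ∞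
        (fun x => (⟨f x, smulField (ρ j) v x⟩ : TangentBundle 𝓘(ℝ, C3) V)) := fun j =>
      contMDiff_smulField (contMDiff_real hf.holomorphic) (ρ j).contMDiff hv
    have hsum : ∀ x, v x = ∑ j, smulField (ρ j) v x := by
      intro x
      have : fieldVal f v x = ∑ j, ρ j x • fieldVal f v x := by
        rw [← Finset.sum_smul, hρ1, one_smul]
      exact this
    -- The partition of unity is inserted a second time, now inside `v`, so that each piece is
    -- supported in one chart and Stokes in the plane applies.
    set D : t → C → ℝ := fun j => X.stokesDensity f (smulField (ρ j) v) w with hD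
    have hDc : ∀ j, IsContDensity (D j) := fun j p =>
      (X.isContDensity_stokesDensity hf.holomorphic (hvj j) hw p).2
    have hD0 : ∀ j, ∀ x ∉ tsupport (ρ j), D j x = 0 := by
      intro j x hx
      refine X.stokesDensity_eq_zero ?_
      filter_upwards [(isClosed_tsupport (ρ j)).isOpen_compl.mem_nhds hx] with z hz
      have : ρ j z • fieldVal f v z = 0 := by rw [hρ0 j z hz, zero_smul]
      exact this
    have h1 : ∀ i : t, (fun x => ρ i x * (X.stokesDensity f v w x / X.areaDensity f x)
        * X.areaDensity f x) = fun x => ∑ j, ρ i x * D j x := by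
      intro i
      funext x
      rw [mul_assoc, div_mul_cancel₀ _ (hApos x).ne',
        X.stokesDensity_sum hf.holomorphic.continuous hvj hsum, Finset.mul_sum]
    -- Each product `ρ_i D_j` vanishes off the overlap of the two charts, so it can be integrated in
    -- chart `j`; summing over `i` first then removes `ρ_i`.
    have h2 : ∀ i : t, chartIntegral (i : C) (fun x => ∑ j, ρ i x * D j x)
        = ∑ j : t, chartIntegral (j : C) fun x => ρ i x * D j x := by
      intro i
      rw [chartIntegral_sum _ (fun j _ => (hDc j).mul (hρc i)) (hK i) (hρ i)
        fun j _ x hx => by rw [hρ0 i x hx, zero_mul]]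
      refine Finset.sum_congr rfl fun j _ => chartIntegral_congr fun x hx => ?_
      by_cases hxi : x ∈ (chartAt ℂ (i : C)).source
      · rw [hD0 j x fun hc => hx ⟨hxi, hρ j hc⟩, mul_zero]
      · rw [hρ0 i x fun hc => hxi (hρ i hc), zero_mul]
    have h3 : ∀ j : t, ∑ i : t, chartIntegral (j : C) (fun x => ρ i x * D j x) = 0 := by
      intro j
      rw [← chartIntegral_sum _ (fun i _ => (hDc j).mul (hρc i)) (hK j) (hρ j)
        fun i _ x hx => by rw [hD0 j x hx, mul_zero]]
      have h4 : (fun x => ∑ i, ρ i x * D j x) = D j := by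
        funext x
        rw [← Finset.sum_mul, hρ1, one_mul]
      rw [h4]
      refine X.chartIntegral_stokesDensity hf.holomorphic (hvj j) hw (hK j) (hρ j) fun x hx => ?_
      have : ρ j x • fieldVal f v x = 0 := by rw [hρ0 j x hx, zero_smul]
      exact this
    simp only [h1, h2]
    rw [Finset.sum_comm]
    exact Finset.sum_eq_zero fun j _ => h3 j

end CalabiYau

end AssocDef
namespace AssocDef

/-! ### Constancy along the circle. -/

/-- A symmetric kernel `P`, given by a family of vectors depending periodically on `t`, that is
constant on the antidiagonals: the family is constant. -/
theorem eq_zero_of_antidiagonal {P : ℝ → ℝ → ℝ} {T : ℝ} (hT : 0 < T)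
    (hP : ∀ c t t', P t (c - t) = P t' (c - t')) (hcont : Continuous fun t => P t t)
    (hper : Function.Periodic (fun t => P t t) T)
    (hnonneg : ∀ a b, 0 ≤ P a a + P b b - 2 * P a b) (a b : ℝ) :
    P a a + P b b - 2 * P a b = 0 := by
  have hmid : ∀ t s, P (t + s) (t - s) = P t t := by
    intro t s
    have h := hP (2 * t) (t + s) t
    rwa [show 2 * t - (t + s) = t - s by ring, show 2 * t - t = t by ring] at h
  obtain ⟨t₀, -, ht₀⟩ := (isCompact_Icc (a := (0 : ℝ)) (b := T)).exists_isMaxOn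
    ⟨0, Set.left_mem_Icc.2 hT.le⟩ hcont.continuousOn
  have hmax : ∀ t, P t t ≤ P t₀ t₀ := by
    intro t
    obtain ⟨s, hs, hts⟩ := hper.exists_mem_Ico₀ hT t
    exact (le_of_eq hts).trans (ht₀ (Set.Ico_subset_Icc_self hs))
  -- By `hmid`, non-negativity at the points `t₀ ± s` says that their diagonal values have mean at
  -- least the maximum, so both equal it.
  have hconst : ∀ t, P t t = P t₀ t₀ := by
    intro t
    have h1 := hmid t₀ (t - t₀)
    have h2 := hnonneg (t₀ + (t - t₀)) (t₀ - (t - t₀))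
    rw [h1] at h2
    have h3 := hmax (t₀ - (t - t₀))
    have h4 := hmax t
    rw [add_sub_cancel] at h2
    linarith
  have h := hmid ((a + b) / 2) ((a - b) / 2)
  rw [show (a + b) / 2 + (a - b) / 2 = a by ring, show (a + b) / 2 - (a - b) / 2 = b by ring,
    hconst] at h
  rw [h, hconst a, hconst b]
  ring

section Integrals

open MeasureTheory

variable {C : Type*} [TopologicalSpace C] [CompactSpace C]

/-- Compactness of `[t - 1, t + 1] × C` bounds the derivative by a constant, which is integrable as
`μ` is finite. -/
theorem hasDerivAt_integral_of_continuous [MeasurableSpace C] [BorelSpace C] {μ : Measure C}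
    [IsFiniteMeasure μ] {G G' : ℝ × C → ℝ} (hG : Continuous G) (hG' : Continuous G')
    (h : ∀ t x, HasDerivAt (fun t => G (t, x)) (G' (t, x)) t) (t : ℝ) :
    HasDerivAt (fun t => ∫ x, G (t, x) ∂μ) (∫ x, G' (t, x) ∂μ) t := by
  have hm : ∀ {u : ℝ × C → ℝ}, Continuous u → ∀ s, Continuous fun x => u (s, x) :=
    fun hu s => hu.comp (Continuous.prodMk_right s)
  obtain ⟨b, hb⟩ := ((isCompact_Icc (a := t - 1) (b := t + 1)).prod
    (isCompact_univ (X := C))).exists_bound_of_continuousOn hG'.continuousOn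
  exact (hasDerivAt_integral_of_dominated_loc_of_deriv_le (bound := fun _ => b)
    (Icc_mem_nhds (sub_one_lt t) (lt_add_one t))
    (Filter.Eventually.of_forall fun s => (hm hG s).aestronglyMeasurable)
    ((hm hG t).integrable_of_hasCompactSupport (HasCompactSupport.of_compactSpace _))
    (hm hG' t).aestronglyMeasurable
    (Filter.Eventually.of_forall fun x s hs => hb (s, x) ⟨hs, Set.mem_univ x⟩)
    (integrable_const b) (Filter.Eventually.of_forall fun x s _ => h s x)).2

end Integrals

section Smooth

variable {C : Type*} [TopologicalSpace C] [ChartedSpace ℂ C] [IsManifold 𝓘(ℂ, ℂ) ∞ C]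

theorem exists_continuous_hasDerivAt {G : ℝ × C → ℝ}
    (hG : ContMDiff (𝓘(ℝ, ℝ).prod 𝓘(ℝ, ℂ)) 𝓘(ℝ, ℝ) ∞ G) :
    ∃ G' : ℝ × C → ℝ, Continuous G' ∧ ∀ t x, HasDerivAt (fun t => G (t, x)) (G' (t, x)) t := by
  have hloc : ∀ p : C, ContDiffOn ℝ ∞ (fun y : ℝ × ℂ => G (y.1, (chartAt ℂ p).symm y.2))
      (Set.univ ×ˢ (chartAt ℂ p).target) := by
    intro p
    have h1 : ContMDiffOn 𝓘(ℝ, ℝ × ℂ) (𝓘(ℝ, ℝ).prod 𝓘(ℝ, ℂ)) ∞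
        (fun y : ℝ × ℂ => (y.1, (chartAt ℂ p).symm y.2)) (Set.univ ×ˢ (chartAt ℂ p).target) := by
      refine ContMDiffOn.prodMk contDiff_fst.contMDiff.contMDiffOn ?_
      exact (contMDiffOn_chart_symm (I := 𝓘(ℝ, ℂ)) (n := ∞) (x := p)).comp
        contDiff_snd.contMDiff.contMDiffOn fun y hy => hy.2
    exact (hG.comp_contMDiffOn h1).contDiffOn
  have hopen : ∀ p : C, IsOpen ((Set.univ : Set ℝ) ×ˢ (chartAt ℂ p).target) := fun p =>
    isOpen_univ.prod (chartAt ℂ p).open_target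
  have hder : ∀ (p : C) t x, x ∈ (chartAt ℂ p).source → HasDerivAt (fun t => G (t, x))
      (fderiv ℝ (fun y : ℝ × ℂ => G (y.1, (chartAt ℂ p).symm y.2)) (t, chartAt ℂ p x) (1, 0)) t := by
    intro p t x hx
    have h1 : DifferentiableAt ℝ (fun y : ℝ × ℂ => G (y.1, (chartAt ℂ p).symm y.2))
        (t, chartAt ℂ p x) :=
      ((hloc p).differentiableOn (by simp)).differentiableAt
        ((hopen p).mem_nhds ⟨Set.mem_univ t, (chartAt ℂ p).map_source hx⟩)
    have h2 : HasDerivAt (fun t : ℝ => (t, chartAt ℂ p x)) (1, 0) t :=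
      (hasDerivAt_id t).prodMk (hasDerivAt_const t _)
    have h3 := h1.hasFDerivAt.comp_hasDerivAt t h2
    refine h3.congr_of_eventuallyEq (Filter.Eventually.of_forall fun s => ?_)
    simp only [Function.comp_apply, (chartAt ℂ p).left_inv hx]
  refine ⟨fun P => deriv (fun t => G (t, P.2)) P.1, ?_, fun t x =>
    (hder x t x (mem_chart_source ℂ x)).differentiableAt.hasDerivAt⟩
  rw [continuous_iff_continuousAt]
  rintro ⟨t, p⟩
  have ho : IsOpen ((Set.univ : Set ℝ) ×ˢ (chartAt ℂ p).source) :=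
    isOpen_univ.prod (chartAt ℂ p).open_source
  have h1 : ContinuousOn (fun P : ℝ × C => (P.1, chartAt ℂ p P.2))
      (Set.univ ×ˢ (chartAt ℂ p).source) :=
    continuous_fst.continuousOn.prodMk
      ((chartAt ℂ p).continuousOn.comp continuous_snd.continuousOn fun P hP => hP.2)
  have h2 := (((hloc p).continuousOn_fderiv_of_isOpen (hopen p) (by simp)).comp h1
    fun P hP => ⟨Set.mem_univ _, (chartAt ℂ p).map_source hP.2⟩).clm_apply
    (continuousOn_const (c := ((1, 0) : ℝ × ℂ)))
  refine (h2.congr fun P hP => ?_).continuousAt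
    (ho.mem_nhds ⟨Set.mem_univ t, mem_chart_source ℂ p⟩)
  exact (hder p P.1 P.2 hP.2).deriv

end Smooth

variable {V : Type*} [TopologicalSpace V] [ChartedSpace C3 V] [IsManifold 𝓘(ℂ, C3) ∞ V]
  {C : Type*} [TopologicalSpace C] [ChartedSpace ℂ C] [IsManifold 𝓘(ℂ, ℂ) ∞ C] {f : C → V}

namespace CalabiYau

variable (X : CalabiYau V)

theorem contMDiff_metric_apply {F K N : Type*} [NormedAddCommGroup F] [NormedSpace ℝ F]
    [TopologicalSpace K] {J : ModelWithCorners ℝ F K} [TopologicalSpace N] [ChartedSpace K N]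
    {b : N → V} {v w : ∀ x : N, TangentSpace 𝓘(ℝ, C3) (b x)}
    (hv : ContMDiff J 𝓘(ℝ, C3).tangent ∞ (fun x => (⟨b x, v x⟩ : TangentBundle 𝓘(ℝ, C3) V)))
    (hw : ContMDiff J 𝓘(ℝ, C3).tangent ∞ (fun x => (⟨b x, w x⟩ : TangentBundle 𝓘(ℝ, C3) V))) :
    ContMDiff J 𝓘(ℝ, ℝ) ∞ (fun x => X.g (b x) (v x) (w x)) := by
  intro x
  have hb : ContMDiffAt J 𝓘(ℝ, C3) ∞ b x := (Bundle.contMDiffAt_totalSpace.1 (hv x)).1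
  have h := ContMDiffAt.clm_bundle_apply₂ (F₁ := C3) (F₂ := C3) (F₃ := ℝ)
    (E₃ := Bundle.Trivial V ℝ) (X.metric.contMDiff.contMDiffAt.comp x hb) (hv x) (hw x)
  exact (Bundle.contMDiffAt_totalSpace.1 h).2

theorem contMDiff_form_slice
    {v : ∀ P : Circle × C, TangentSpace ((𝓡 1).prod 𝓘(ℝ, C3)) (circleTimes f P)}
    (hv : ContMDiff ((𝓡 1).prod 𝓘(ℝ, ℂ)) ((𝓡 1).prod 𝓘(ℝ, C3)).tangent ∞ (fun P : Circle × C =>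
      (⟨circleTimes f P, v P⟩ : TangentBundle ((𝓡 1).prod 𝓘(ℝ, C3)) (Circle × V))))
    {σ τ : ℝ → ℝ} (hσ : ContDiff ℝ ∞ σ) (hτ : ContDiff ℝ ∞ τ) :
    ContMDiff (𝓘(ℝ, ℝ).prod 𝓘(ℝ, ℂ)) 𝓘(ℝ, ℝ) ∞ (fun P : ℝ × C => X.form (f P.2)
      (fieldVal f (slice f v (Circle.exp (σ P.1))) P.2)
      (fieldVal f (slice f v (Circle.exp (τ P.1))) P.2)) := by
  have h : ∀ {σ : ℝ → ℝ}, ContDiff ℝ ∞ σ → ContMDiff (𝓘(ℝ, ℝ).prod 𝓘(ℝ, ℂ)) 𝓘(ℝ, C3).tangent ∞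
      (fun P : ℝ × C => (⟨f P.2, slice f v (Circle.exp (σ P.1)) P.2⟩ :
        TangentBundle 𝓘(ℝ, C3) V)) := fun hσ =>
    (contMDiff_vert hv).comp
      (((contMDiff_circleExp.comp hσ.contMDiff).comp contMDiff_fst).prodMk contMDiff_snd)
  exact X.contMDiff_metric_apply (h hσ) (h hτ)

/-- The kernel equation is tested against `Iw`: `I` is an isometry and `Re (iz) = -Im z`. This is
the evolution form `∂_t v = Av`. -/
theorem form_circleDeriv (hf : IsComplexCurve f)
    {v : ∀ P : Circle × C, TangentSpace ((𝓡 1).prod 𝓘(ℝ, C3)) (circleTimes f P)}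
    (hv : v ∈ diracKernel ((𝓡 1).prod 𝓘(ℝ, ℂ)) X.productMetric X.productForm (circleTimes f))
    (t : ℝ) (x : C) (w : C3) :
    X.form (f x) (circleDeriv f v (Circle.exp t) x (angularVelocity t)) w
      = (X.vol (f x) ![curveDeriv C3 f x, dbarField f (slice f v (Circle.exp t)) x, w]).im
        / X.areaDensity f x := by
  have h := ((X.mem_diracKernel_iff hf v).1 hv).2 t x (Complex.I • w)
  rw [(X.isSU3 (f x)).map_I, diracPairing, reVol_apply, tri_smul₂, Complex.I_mul_re] at h
  rw [areaDensity]
  linarith [neg_div (X.form (f x) (curveDeriv C3 f x) (curveDeriv C3 f x))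
    (X.vol (f x) ![curveDeriv C3 f x, dbarField f (slice f v (Circle.exp t)) x, w]).im]

/-- The derivative is `g(A v_t, v_{c-t}) - g(v_t, A v_{c-t})`. Exchanging the last two arguments of
`Ω` in the second term absorbs the minus sign and produces the density that Stokes integrates to
zero. -/
theorem hasDerivAt_form_antidiagonal (hf : IsComplexCurve f)
    {v : ∀ P : Circle × C, TangentSpace ((𝓡 1).prod 𝓘(ℝ, C3)) (circleTimes f P)}
    (hv : v ∈ diracKernel ((𝓡 1).prod 𝓘(ℝ, ℂ)) X.productMetric X.productForm (circleTimes f))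
    (c t : ℝ) (x : C) :
    HasDerivAt (fun t => X.form (f x) (fieldVal f (slice f v (Circle.exp t)) x)
        (fieldVal f (slice f v (Circle.exp (c - t))) x))
      (X.stokesDensity f (slice f v (Circle.exp t)) (slice f v (Circle.exp (c - t))) x
        / X.areaDensity f x) t := by
  have hs := ((X.mem_diracKernel_iff hf v).1 hv).1.1
  have h1 := hasDerivAt_slice hs hf.holomorphic.continuous t x
  have h2 := (hasDerivAt_slice hs hf.holomorphic.continuous (c - t) x).scomp t
    ((hasDerivAt_id t).const_sub c)
  have h3 := ((X.form (f x)).hasFDerivAt.comp_hasDerivAt t h1).clm_apply h2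
  refine h3.congr_deriv ?_
  simp only [Function.comp_apply, neg_smul, one_smul, map_neg]
  rw [(X.isSU3 (f x)).symm _ (circleDeriv f v (Circle.exp (c - t)) x _),
    X.form_circleDeriv hf hv, X.form_circleDeriv hf hv, stokesDensity,
    tri_swap₁₂ _ _ (dbarField f (slice f v (Circle.exp (c - t))) x), Complex.neg_im,
    Complex.add_im]
  ring

open MeasureTheory in
/-- The solutions of the Dirac equation on `S¹ × C` are constant along the circle. -/
theorem fieldVal_slice_eq [CompactSpace C] (hf : IsComplexCurve f) [T2Space V]
    {v : ∀ P : Circle × C, TangentSpace ((𝓡 1).prod 𝓘(ℝ, C3)) (circleTimes f P)}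
    (hv : v ∈ diracKernel ((𝓡 1).prod 𝓘(ℝ, ℂ)) X.productMetric X.productForm (circleTimes f))
    (a b : ℝ) (x : C) :
    fieldVal f (slice f v (Circle.exp a)) x = fieldVal f (slice f v (Circle.exp b)) x := by
  have := hf.embedding.t2Space
  let : MeasurableSpace C := borel C
  have : BorelSpace C := ⟨rfl⟩
  have hs := ((X.mem_diracKernel_iff hf v).1 hv).1.1
  obtain ⟨μ, hμ, hpos, hstokes⟩ := X.exists_areaMeasure hf
  set B : ℝ → ℝ → C → ℝ := fun s t x => X.form (f x) (fieldVal f (slice f v (Circle.exp s)) x)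
    (fieldVal f (slice f v (Circle.exp t)) x) with hB
  have hBc : ∀ s t, Continuous (B s t) := fun s t =>
    (X.contMDiff_form_slice hs (σ := fun _ => s) (τ := fun _ => t) contDiff_const
      contDiff_const).continuous.comp (Continuous.prodMk_right (0 : ℝ))
  have hBi : ∀ s t, Integrable (B s t) μ := fun s t =>
    (hBc s t).integrable_of_hasCompactSupport (HasCompactSupport.of_compactSpace _)
  have hsq : ∀ s t x, B s s x + B t t x - 2 * B s t x
      = X.form (f x) (fieldVal f (slice f v (Circle.exp s)) x
        - fieldVal f (slice f v (Circle.exp t)) x) (fieldVal f (slice f v (Circle.exp s)) x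
        - fieldVal f (slice f v (Circle.exp t)) x) := by
    intro s t x
    simp only [hB, map_sub, sub_apply]
    rw [(X.isSU3 (f x)).symm (fieldVal f (slice f v (Circle.exp t)) x)
      (fieldVal f (slice f v (Circle.exp s)) x)]
    ring
  have hsq0 : ∀ s t x, 0 ≤ B s s x + B t t x - 2 * B s t x := by
    intro s t x
    rw [hsq]
    by_cases h : fieldVal f (slice f v (Circle.exp s)) x
        - fieldVal f (slice f v (Circle.exp t)) x = 0
    · rw [h, map_zero]
    · exact (X.form_pos (f x) _ h).le
  have hint : ∀ s t, ∫ x, (B s s x + B t t x - 2 * B s t x) ∂μ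
      = ∫ x, B s s x ∂μ + ∫ x, B t t x ∂μ - 2 * ∫ x, B s t x ∂μ := by
    intro s t
    refine (integral_sub ((hBi s s).add (hBi t t)) ((hBi s t).const_mul 2)).trans ?_
    rw [integral_const_mul]
    exact congrArg (· - _) (integral_add (hBi s s) (hBi t t))
  -- Symmetry of `A`: differentiating under the integral leaves a Stokes density. Its continuity,
  -- required by `hstokes`, comes from identifying it with the continuous `t`-derivative `G'`.
  have hanti : ∀ c t t', ∫ x, B t (c - t) x ∂μ = ∫ x, B t' (c - t') x ∂μ := by
    intro c
    have hG := X.contMDiff_form_slice hs (σ := fun t => t) (τ := fun t => c - t) contDiff_id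
      (contDiff_const.sub contDiff_id)
    obtain ⟨G', hG', hd⟩ := exists_continuous_hasDerivAt hG
    have hG'eq : ∀ t x, G' (t, x) = X.stokesDensity f (slice f v (Circle.exp t))
        (slice f v (Circle.exp (c - t))) x / X.areaDensity f x := fun t x =>
      (hd t x).unique (X.hasDerivAt_form_antidiagonal hf hv c t x)
    have h1 : ∀ t, HasDerivAt (fun t => ∫ x, B t (c - t) x ∂μ) 0 t := by
      intro t
      refine (hasDerivAt_integral_of_continuous (μ := μ) hG.continuous hG' hd t).congr_deriv ?_
      have h2 := hstokes _ _ (contMDiff_slice hs (Circle.exp t))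
        (contMDiff_slice hs (Circle.exp (c - t)))
      simp only [← hG'eq] at h2
      exact h2 (hG'.comp (Continuous.prodMk_right t))
    exact is_const_of_deriv_eq_zero (fun t => (h1 t).differentiableAt) fun t => (h1 t).deriv
  have hdiag : Continuous fun t => ∫ x, B t t x ∂μ := by
    have hG := X.contMDiff_form_slice hs (σ := fun t => t) (τ := fun t => t) contDiff_id contDiff_id
    obtain ⟨G', hG', hd⟩ := exists_continuous_hasDerivAt hG
    exact continuous_iff_continuousAt.2 fun t =>
      (hasDerivAt_integral_of_continuous (μ := μ) hG.continuous hG' hd t).continuousAt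
  have hper : Function.Periodic (fun t => ∫ x, B t t x ∂μ) (2 * Real.pi) := by
    intro t
    simp only [hB, Circle.exp_add, Circle.exp_two_pi, mul_one]
  have hzero := eq_zero_of_antidiagonal (P := fun s t => ∫ x, B s t x ∂μ) Real.two_pi_pos hanti hdiag hper
    (fun s t => by rw [← hint]; exact integral_nonneg (hsq0 s t)) a b
  rw [← hint] at hzero
  -- The integrand is the squared length of `v_a - v_b`, continuous and non-negative with zero
  -- integral.
  have h0 := hpos _ (((hBc a a).add (hBc b b)).sub (continuous_const.mul (hBc a b))) (hsq0 a b)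
    hzero x
  by_contra hne
  have h1 := X.form_pos (f x) _ (sub_ne_zero.2 hne)
  rw [← hsq] at h1
  exact h1.ne' h0

theorem diracKernel_eq [CompactSpace C] [T2Space V] (hf : IsComplexCurve f) :
    diracKernel ((𝓡 1).prod 𝓘(ℝ, ℂ)) X.productMetric X.productForm (circleTimes f)
      = pullBack f '' X.complexDiracKernel f := by
  refine Set.Subset.antisymm (fun v hv => ?_) ?_
  · obtain ⟨hn, hD⟩ := (X.mem_diracKernel_iff hf v).1 hv
    obtain ⟨hs, h0, hn'⟩ := (X.isNormalSection_circleTimes_iff hf v).1 hn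
    -- All slices coincide, so any angle would serve; the circle term of the equation then vanishes
    -- and only the condition of `𝒟ᶜ` is left.
    refine ⟨slice f v (Circle.exp 0), (X.mem_complexDiracKernel_iff hf _).2
      ⟨(X.isNormalSection_iff hf _).2 ⟨contMDiff_slice hs _, hn' _⟩, fun x w => ?_⟩, ?_⟩
    · have h1 := hasDerivAt_slice hs hf.holomorphic.continuous 0 x
      have h2 : (fun t => fieldVal f (slice f v (Circle.exp t)) x)
          = fun _ => fieldVal f (slice f v (Circle.exp 0)) x :=
        funext fun t => X.fieldVal_slice_eq hf hv t 0 x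
      rw [h2] at h1
      have h3 := hD 0 x w
      rw [h1.unique (hasDerivAt_const (0 : ℝ) _), smul_zero, map_zero, zero_apply,
        zero_add] at h3
      exact (div_eq_zero_iff.1 h3).resolve_right (X.form_curveDeriv_pos hf x).ne'
    · funext P
      obtain ⟨z, x⟩ := P
      obtain ⟨t, rfl⟩ : ∃ t, Circle.exp t = z := ⟨Complex.arg z, Circle.exp_arg z⟩
      have h1 : fieldVal f (slice f v (Circle.exp 0)) x = fieldVal f (slice f v (Circle.exp t)) x :=
        X.fieldVal_slice_eq hf hv 0 t x
      have h2 : ((0 : R1), fieldVal f (slice f v (Circle.exp 0)) x) = (v (Circle.exp t, x) : RC3) :=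
        Prod.ext (h0 (Circle.exp t, x)).symm h1
      exact h2
  · rintro _ ⟨w, hw, rfl⟩
    exact X.pullBack_mem_diracKernel hf hw

theorem isRigidAssociative_circleTimes_iff [CompactSpace C] [T2Space V] (hf : IsComplexCurve f) :
    IsRigidAssociative ((𝓡 1).prod 𝓘(ℝ, ℂ)) X.productMetric X.productForm (circleTimes f) ↔
      X.IsRigidCurve f := by
  constructor
  · intro H w hw hol x
    have h1 := H _ (X.pullBack_mem_diracKernel hf
      ((X.mem_complexDiracKernel_iff_isHolomorphicNormal hf w).2 ⟨hw, hol⟩)) (1, x)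
    exact congrArg (fun u : RC3 => u.2) h1
  · intro H v hv P
    rw [X.diracKernel_eq hf] at hv
    obtain ⟨w, hw, rfl⟩ := hv
    obtain ⟨hn, hol⟩ := (X.mem_complexDiracKernel_iff_isHolomorphicNormal hf w).1 hw
    have h1 : ((0 : R1), fieldVal f w P.2) = (0 : RC3) := Prod.ext rfl (H w hn hol P.2)
    exact h1

end CalabiYau

end AssocDef
theorem lemma5p11 {V : Type*} [TopologicalSpace V] [T2Space V] [SecondCountableTopology V]
    [ChartedSpace AssocDef.C3 V] [IsManifold 𝓘(ℂ, AssocDef.C3) ∞ V] (X : AssocDef.CalabiYau V)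
    {C : Type*} [TopologicalSpace C] [CompactSpace C] [ChartedSpace ℂ C] [IsManifold 𝓘(ℂ, ℂ) ∞ C]
    (f : C → V) (hf : AssocDef.IsComplexCurve f) :
    AssocDef.IsAssociative ((𝓡 1).prod 𝓘(ℝ, ℂ)) X.productMetric X.productForm
        (AssocDef.circleTimes f) ∧
      AssocDef.diracKernel ((𝓡 1).prod 𝓘(ℝ, ℂ)) X.productMetric X.productForm
          (AssocDef.circleTimes f)
        = AssocDef.pullBack f '' X.complexDiracKernel f ∧
      (AssocDef.IsRigidAssociative ((𝓡 1).prod 𝓘(ℝ, ℂ)) X.productMetric X.productForm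
          (AssocDef.circleTimes f) ↔ X.IsRigidCurve f) :=
  ⟨X.isAssociative_circleTimes hf, X.diracKernel_eq hf, X.isRigidAssociative_circleTimes_iff hf⟩
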